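/- Let $n\in\mathbb N$, $m\ge 0$ real, $0\le\delta\le\rho\le 1$, $\delta<1$. Let $\sigma$ belong to the bilinear Hörmander class $BS^m_{\rho,\delta}(\mathbb R^n)$, i.e. $\sigma:\mathbb R^n\times\mathbb R^n\times\mathbb R^n\to\mathbb C$ is $C^\infty$ and for all multi-indices $\alpha,\beta,\gamma$ there is a constant $C_{\alpha\beta\gamma}$ with $$|\partial_x^\alpha\partial_\xi^\beta\partial_\eta^\gamma\sigma(x,\xi,\eta)|\le C_{\alpha\beta\gamma}(1+|\xi|+|\eta|)^{m+\delta|\alpha|-\rho(|\beta|+|\gamma|)}\qquad\text{for all }x,\xi,\eta\in\mathbb R^n.$$ For $f,g\in C_c^\infty(\mathbb R^n)$ (complex-valued) put $$T_\sigma(f,g)(x)=\int_{\mathbb R^n}\int_{\mathbb R^n}\sigma(x,\xi,\eta)\,\widehat f(\xi)\,\widehat g(\eta)\,e^{ix\cdot(\xi+\eta)}\,d\xi\,d\eta,\qquad \widehat f(\xi)=\int_{\mathbb R^n}e^{-iy\cdot\xi}f(y)\,dy.$$ Let $s$ be any integer with $$s>\frac{[n/2]+1}{1-\delta}+n,$$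 where $[\cdot]$ is the integer part. Then there is a constant $C$, independent of $f$ and $g$, such that for all $f,g\in C_c^\infty(\mathbb R^n)$ the function $T_\sigma(f,g)$ lies in $L^2(\mathbb R^n)$ and $$\|T_\sigma(f,g)\|_{L^2}\le C\left(\|f\|_{W^{m,2}}\|g\|_{W_0^{s,\infty}}+\|f\|_{W_0^{s,\infty}}\|g\|_{W^{m,2}}\right).$$ Here $\|g\|_{W_0^{s,\infty}}=\sup_{|\gamma|\le s}\|\partial^\gamma g\|_{L^\infty}$, and $\|f\|_{W^{m,2}}=\|J^mf\|_{L^2}$, where $J^m$ is the Fourier multiplier with symbol $(1+|\xi|^2)^{m/2}$. -/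

import Mathlib

open MeasureTheory
open scoped ContDiff ENNReal NNReal

noncomputable section

namespace BilinearPDO

/-- The Euclidean space `ℝⁿ`. -/
abbrev Euc (n : ℕ) : Type := EuclideanSpace ℝ (Fin n)

variable {n : ℕ}

/-- The first order partial derivative `∂f/∂xᵢ`. -/
def partialDeriv (i : Fin n) (f : Euc n → ℂ) : Euc n → ℂ :=
  fun x => fderiv ℝ f x (EuclideanSpace.single i 1)

/-- The partial derivative `∂^α = ∂₁^{α₁} ⋯ ∂ₙ^{αₙ}` for a multi-index `α`. -/
def multiDeriv (α : Fin n → ℕ) (f : Euc n → ℂ) : Euc n → ℂ :=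
  (List.finRange n).foldr (fun i F => (partialDeriv i)^[α i] F) f

/-- The mixed derivative `∂_x^α ∂_ξ^β ∂_η^γ σ (x, ξ, η)`. -/
def symbolDeriv (α β γ : Fin n → ℕ) (σ : Euc n → Euc n → Euc n → ℂ) (x ξ η : Euc n) : ℂ :=
  multiDeriv α (fun x' => multiDeriv β (fun ξ' => multiDeriv γ (fun η' => σ x' ξ' η') η) ξ) x

/-- The bilinear Hörmander class `BS^m_{ρ,δ}(ℝⁿ)`: smooth symbols with
`|∂_x^α ∂_ξ^β ∂_η^γ σ(x, ξ, η)| ≤ C_{αβγ} (1 + |ξ| + |η|)^{m + δ|α| - ρ(|β| + |γ|)}`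
for all multi-indices `α`, `β`, `γ`. -/
structure BS (m ρ δ : ℝ) (σ : Euc n → Euc n → Euc n → ℂ) : Prop where
  smooth : ContDiff ℝ ∞ (fun p : Euc n × Euc n × Euc n => σ p.1 p.2.1 p.2.2)
  bound : ∀ α β γ : Fin n → ℕ, ∃ C : ℝ, ∀ x ξ η : Euc n,
    ‖symbolDeriv α β γ σ x ξ η‖ ≤ C * (1 + ‖ξ‖ + ‖η‖) ^
      (m + δ * ((∑ i, α i : ℕ) : ℝ) - ρ * (((∑ i, β i : ℕ) : ℝ) + ((∑ i, γ i : ℕ) : ℝ)))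

/-- The exponential `e^{i x·ξ}`. -/
def expI (x ξ : Euc n) : ℂ := Complex.exp (Complex.I * ((inner ℝ x ξ : ℝ) : ℂ))

/-- The Fourier transform `f̂(ξ) = ∫ e^{-i y·ξ} f(y) dy`. -/
def fourier (f : Euc n → ℂ) (ξ : Euc n) : ℂ := ∫ y : Euc n, expI (-y) ξ * f y

/-- The bilinear pseudodifferential operator
`T_σ(f, g)(x) = ∫∫ σ(x, ξ, η) f̂(ξ) ĝ(η) e^{i x·(ξ + η)} dξ dη`. -/
def bilinearOp (σ : Euc n → Euc n → Euc n → ℂ) (f g : Euc n → ℂ) (x : Euc n) : ℂ :=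
  ∫ η : Euc n, ∫ ξ : Euc n, σ x ξ η * fourier f ξ * fourier g η * expI x (ξ + η)

/-- The Bessel potential `J^m`, the Fourier multiplier with symbol `(1 + |ξ|²)^{m/2}`,
acting on test functions:
`J^m f(x) = (2π)^{-n} ∫ (1 + |ξ|²)^{m/2} f̂(ξ) e^{i x·ξ} dξ`. -/
def besselJ (m : ℝ) (f : Euc n → ℂ) (x : Euc n) : ℂ :=
  (((2 * Real.pi) ^ n : ℝ) : ℂ)⁻¹ *
    ∫ ξ : Euc n, (((1 + ‖ξ‖ ^ 2) ^ (m / 2) : ℝ) : ℂ) * fourier f ξ * expI x ξ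

/-- The `L²`-based Sobolev norm `‖f‖_{W^{m,2}} = ‖J^m f‖_{L²}` of real order `m`
of a test function. -/
def sobolevNorm (m : ℝ) (f : Euc n → ℂ) : ℝ≥0∞ := eLpNorm (besselJ m f) 2 volume

/-- The norm `‖g‖_{W_0^{s,∞}} = sup_{|γ| ≤ s} ‖∂^γ g‖_{L^∞}`. -/
def supNorm (s : ℕ) (g : Euc n → ℂ) : ℝ≥0∞ :=
  ⨆ γ : Fin n → ℕ, ⨆ _ : ∑ i, γ i ≤ s, eLpNorm (multiDeriv γ g) ⊤ volume

end BilinearPDO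

end

/-! Write R = ⟨ξ⟩² + ⟨η⟩². Since δ ≤ ρ and 1 + |ξ| + |η| ≥ 1, σ may be treated as a symbol of type
(δ, δ). The two terms of the estimate come from expanding 1 = (⟨ξ⟩²/R + ⟨η⟩²/R)^(2p+1): half of the
binomial terms carry ⟨ξ⟩² to a power at least p + 1. For p large, σ times such a term is controlled,
together with a fixed number of x-derivatives, by powers of ⟨ξ⟩ alone, uniformly in η
(`firstDominant_mul_firstPart`, `exists_firstDominant_add`). The other half is the same after
exchanging the frequencies, that is f and g. It remains to bound T_τ(f, g) by ‖f‖_{W^{m,2}}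
‖g‖_{W^{s,∞}} when ξ dominates τ.

The smoothness of g is spent on decay in η: ĝ = ⟨η⟩^(-2r) Ĝ, where G = (1 - Δ)^r g is bounded and 2r
> n. Once the integrable weight is moved into the symbol, integration by parts in η gives a kernel
integrable in x - y. The operator is then dominated pointwise by ‖G‖_∞ times an η-integral of linear
pseudodifferential operators in which η is a parameter.

On |ξ| ∼ 2^k such a linear symbol loses λ = 2^(δk) per x-derivative and gains 1/λ per ξ-derivative.
Its L² bound comes from freezing coefficients. By φ(0) = ∫₀^∞ e^(-t) (φ - φ')(t) dt in each
coordinate, the symbol at x is an average of ∏(1 - λ⁻¹ ∂_i) applied to it, taken at the points z = x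
+ t/λ. For fixed z there remains a Fourier multiplier whose kernel lives at scale 1/λ, so it is
bounded on L² with a polynomial weight centred at z at that scale
(`eLpNorm_weighted_multiplier_le`). Integrating over z restores the unweighted norm
(`lintegral_frozen_le`).

This gives the size 2^(mk) for the k-th dyadic piece in ξ. The pieces are summed by almost
orthogonality (`FirstDominant.almostOrth`). Write τ = τ/⟨ξ⟩² + Σ_l iξ_l c_l with c_l of order m - 1.
In the pairing of the pieces j ≤ k the factor iξ_l on the higher frequency is an x-derivative up to
harmless terms, and integrating it by parts gains 2^(-(1-δ)(k-j)). As δ < 1, Schur's test sums the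
pieces, and Fatou's lemma removes the frequency truncation. -/

namespace BilinearPDO

/-! ### Iterated directional derivatives -/

section DirectionalDerivatives

variable {ι W : Type*} [NormedAddCommGroup W] [NormedSpace ℝ W]

/-- The derivative of `f` in the direction `v i`. -/
noncomputable def dirDeriv (v : ι → W) (i : ι) (f : W → ℂ) : W → ℂ := fun p => fderiv ℝ f p (v i)

/-- The iterated derivative of `f` in the directions of the list, the head being applied first. -/
noncomputable def dirDerivs (v : ι → W) : List ι → (W → ℂ) → W → ℂ
  | [], f => f
  | i :: L, f => dirDerivs v L (dirDeriv v i f)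

variable {v : ι → W} {f g : W → ℂ}

lemma dirDerivs_nil : dirDerivs v [] f = f := rfl

lemma dirDerivs_cons (i : ι) (L : List ι) :
    dirDerivs v (i :: L) f = dirDerivs v L (dirDeriv v i f) := rfl

lemma contDiff_dirDeriv (hf : ContDiff ℝ ∞ f) (i : ι) : ContDiff ℝ ∞ (dirDeriv v i f) :=
  (hf.fderiv_right (m := ∞) (by simp)).clm_apply contDiff_const

lemma contDiff_dirDerivs (L : List ι) (hf : ContDiff ℝ ∞ f) : ContDiff ℝ ∞ (dirDerivs v L f) := by
  induction L generalizing f with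
  | nil => exact hf
  | cons i L ih => exact ih (contDiff_dirDeriv hf i)

lemma dirDerivs_append (L L' : List ι) :
    dirDerivs v (L ++ L') f = dirDerivs v L' (dirDerivs v L f) := by
  induction L generalizing f with
  | nil => rfl
  | cons i L ih => exact ih

lemma hasDerivAt_line (hf : ContDiff ℝ ∞ f) (p u : W) (t : ℝ) :
    HasDerivAt (fun s : ℝ => f (p + s • u)) (fderiv ℝ f (p + t • u) u) t := by
  have h1 : HasDerivAt (fun s : ℝ => p + s • u) u t := by
    simpa using ((hasDerivAt_id t).smul_const u).const_add p
  exact ((hf.differentiable (by simp)) _).hasFDerivAt.comp_hasDerivAt t h1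

lemma dirDeriv_comm (hf : ContDiff ℝ ∞ f) (i j : ι) :
    dirDeriv v i (dirDeriv v j f) = dirDeriv v j (dirDeriv v i f) := by
  have key : ∀ i j p, dirDeriv v i (dirDeriv v j f) p = fderiv ℝ (fderiv ℝ f) p (v i) (v j) := by
    intro i j p
    have h : DifferentiableAt ℝ (fderiv ℝ f) p :=
      ((hf.fderiv_right (m := ∞) (by simp)).differentiable (by simp)) p
    change fderiv ℝ (fun q => fderiv ℝ f q (v j)) p (v i) = _
    rw [fderiv_clm_apply h (differentiableAt_const _)]
    simp
  funext p
  rw [key, key]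
  exact (hf.contDiffAt.isSymmSndFDerivAt (by simp; norm_cast)).eq _ _

/-- Second derivatives are symmetric. This lets symbol bounds, which are assumed for one fixed order
of differentiation, be used for arbitrary lists of directions. -/
lemma dirDerivs_perm {L L' : List ι} (h : L.Perm L') (hf : ContDiff ℝ ∞ f) :
    dirDerivs v L f = dirDerivs v L' f := by
  induction h generalizing f with
  | nil => rfl
  | cons i _ ih => exact ih (contDiff_dirDeriv hf i)
  | swap i j L => simp only [dirDerivs_cons, dirDeriv_comm hf i j]
  | trans _ _ ih1 ih2 => exact (ih1 hf).trans (ih2 hf)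

lemma dirDeriv_add (hf : ContDiff ℝ ∞ f) (hg : ContDiff ℝ ∞ g) (i : ι) :
    dirDeriv v i (fun p => f p + g p) = fun p => dirDeriv v i f p + dirDeriv v i g p := by
  funext p
  simp only [dirDeriv]
  rw [fderiv_fun_add (hf.differentiable (by simp) p) (hg.differentiable (by simp) p)]
  rfl

lemma dirDeriv_mul (hf : ContDiff ℝ ∞ f) (hg : ContDiff ℝ ∞ g) (i : ι) :
    dirDeriv v i (fun p => f p * g p) =
      fun p => dirDeriv v i f p * g p + f p * dirDeriv v i g p := by
  funext p
  simp only [dirDeriv]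
  rw [fderiv_fun_mul (hf.differentiable (by simp) p) (hg.differentiable (by simp) p)]
  simp only [add_apply, smul_apply, smul_eq_mul]
  ring

lemma dirDeriv_const_mul (hf : ContDiff ℝ ∞ f) (c : ℂ) (i : ι) :
    dirDeriv v i (fun p => c * f p) = fun p => c * dirDeriv v i f p := by
  rw [dirDeriv_mul contDiff_const hf]
  funext p
  simp [dirDeriv]

lemma dirDerivs_add (hf : ContDiff ℝ ∞ f) (hg : ContDiff ℝ ∞ g) (L : List ι) :
    dirDerivs v L (fun p => f p + g p) = fun p => dirDerivs v L f p + dirDerivs v L g p := by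
  induction L generalizing f g with
  | nil => rfl
  | cons i L ih =>
    rw [dirDerivs_cons, dirDeriv_add hf hg, ih (contDiff_dirDeriv hf i) (contDiff_dirDeriv hg i)]
    rfl

lemma dirDerivs_const_mul (hf : ContDiff ℝ ∞ f) (c : ℂ) (L : List ι) :
    dirDerivs v L (fun p => c * f p) = fun p => c * dirDerivs v L f p := by
  induction L generalizing f with
  | nil => rfl
  | cons i L ih =>
    rw [dirDerivs_cons, dirDeriv_const_mul hf, ih (contDiff_dirDeriv hf i)]
    rfl

lemma dirDerivs_comp_linear {W' : Type*} [NormedAddCommGroup W'] [NormedSpace ℝ W']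
    (T : W →L[ℝ] W') {f : W' → ℂ} (hf : ContDiff ℝ ∞ f) (L : List ι) :
    dirDerivs v L (fun p => f (T p)) = fun p => dirDerivs (fun i => T (v i)) L f (T p) := by
  induction L generalizing f with
  | nil => rfl
  | cons i L ih =>
    have : dirDeriv v i (fun p => f (T p)) = fun p => dirDeriv (fun i => T (v i)) i f (T p) := by
      funext p
      simp only [dirDeriv]
      have := ((hf.differentiable (by simp) (T p)).hasFDerivAt).comp p T.hasFDerivAt
      rw [show (fun p => f (T p)) = f ∘ T from rfl, this.fderiv]
      rfl
    rw [dirDerivs_cons, this, ih (contDiff_dirDeriv hf i)]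
    rfl

lemma tsupport_dirDeriv_subset (i : ι) : tsupport (dirDeriv v i f) ⊆ tsupport f := by
  refine closure_minimal (fun p hp => ?_) isClosed_closure
  by_contra h
  apply hp
  have : fderiv ℝ f p = 0 := by
    by_contra h'
    exact h (support_fderiv_subset ℝ h')
  simp [dirDeriv, this]

lemma tsupport_dirDerivs_subset (L : List ι) : tsupport (dirDerivs v L f) ⊆ tsupport f := by
  induction L generalizing f with
  | nil => exact subset_rfl
  | cons i L ih => exact (ih (f := dirDeriv v i f)).trans (tsupport_dirDeriv_subset i)

end DirectionalDerivatives

/-! ### Abstract symbol classes and their calculus -/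

section SymbolClasses

variable {ι κ W : Type*} [NormedAddCommGroup W] [NormedSpace ℝ W]

/-- The family `τ` satisfies `|∂_L τ| ≤ C w s^L` for all lists `L` of at most `N` directions. -/
def SymBound (v : ι → W) (s : ι → W → ℝ) (C : ℝ) : ℕ → (κ → W → ℝ) → (κ → W → ℂ) → Prop
  | 0, w, τ => ∀ k p, ‖τ k p‖ ≤ C * w k p
  | N + 1, w, τ => (∀ k p, ‖τ k p‖ ≤ C * w k p) ∧
      ∀ i, SymBound v s C N (fun k p => w k p * s i p) (fun k => dirDeriv v i (τ k))

/-- Families of smooth symbols of weight `w` which gain `s i` with each derivative in the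
direction `v i`, up to order `N`. -/
def SymOrder (v : ι → W) (s : ι → W → ℝ) (N : ℕ) (w : κ → W → ℝ) (τ : κ → W → ℂ) : Prop :=
  (∀ k, ContDiff ℝ ∞ (τ k)) ∧ ∃ C, 0 ≤ C ∧ SymBound v s C N w τ

/-- Families of smooth symbols of weight `w` which gain `s i` with each derivative in the
direction `v i`. -/
def Sym (v : ι → W) (s : ι → W → ℝ) (w : κ → W → ℝ) (τ : κ → W → ℂ) : Prop :=
  ∀ N, SymOrder v s N w τ

variable {v : ι → W} {s : ι → W → ℝ} {w w' : κ → W → ℝ} {τ τ' : κ → W → ℂ} {C C' : ℝ} {N : ℕ}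

lemma SymBound.zero (h : SymBound v s C N w τ) (k : κ) (p : W) : ‖τ k p‖ ≤ C * w k p := by
  cases N with
  | zero => exact h k p
  | succ N => exact h.1 k p

lemma SymBound.pred (h : SymBound v s C (N + 1) w τ) : SymBound v s C N w τ := by
  induction N generalizing w τ with
  | zero => exact h.1
  | succ N ih => exact ⟨h.1, fun i => ih (h.2 i)⟩

lemma SymBound.mono (h : SymBound v s C N w τ) {s' : ι → W → ℝ} (hs : ∀ i p, 0 ≤ s i p)
    (hss' : ∀ i p, s i p ≤ s' i p) (hw : ∀ k p, C * w k p ≤ C' * w' k p)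
    (hw0 : ∀ k p, 0 ≤ C' * w' k p) :
    SymBound v s' C' N w' τ := by
  induction N generalizing w w' τ with
  | zero => exact fun k p => (h k p).trans (hw k p)
  | succ N ih =>
    refine ⟨fun k p => (h.1 k p).trans (hw k p), fun i => ih (h.2 i) (fun k p => ?_) fun k p => ?_⟩
    · calc C * (w k p * s i p) = (C * w k p) * s i p := by ring
        _ ≤ (C' * w' k p) * s' i p :=
          mul_le_mul (hw k p) (hss' i p) (hs i p) (hw0 k p)
        _ = C' * (w' k p * s' i p) := by ring
    · rw [← mul_assoc]
      exact mul_nonneg (hw0 k p) ((hs i p).trans (hss' i p))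

lemma SymBound.add (h : SymBound v s C N w τ) (h' : SymBound v s C' N w τ')
    (hτ : ∀ k, ContDiff ℝ ∞ (τ k)) (hτ' : ∀ k, ContDiff ℝ ∞ (τ' k)) :
    SymBound v s (C + C') N w (fun k p => τ k p + τ' k p) := by
  induction N generalizing w τ τ' with
  | zero =>
    intro k p
    exact (norm_add_le _ _).trans (by linarith [h k p, h' k p])
  | succ N ih =>
    refine ⟨fun k p => (norm_add_le _ _).trans (by linarith [h.1 k p, h'.1 k p]), fun i => ?_⟩
    simp only [dirDeriv_add (hτ _) (hτ' _)]
    exact ih (h.2 i) (h'.2 i) (fun k => contDiff_dirDeriv (hτ k) i)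
      fun k => contDiff_dirDeriv (hτ' k) i

/-- Leibniz rule: each derivative produces two products of the same kind, whence the factor 2^N. -/
lemma SymBound.mul (h : SymBound v s C N w τ) (h' : SymBound v s C' N w' τ')
    (hτ : ∀ k, ContDiff ℝ ∞ (τ k)) (hτ' : ∀ k, ContDiff ℝ ∞ (τ' k)) :
    SymBound v s (2 ^ N * (C * C')) N (fun k p => w k p * w' k p) (fun k p => τ k p * τ' k p) := by
  have base : ∀ {τ τ' : κ → W → ℂ} {w w' : κ → W → ℝ}, (∀ k p, ‖τ k p‖ ≤ C * w k p) →
      (∀ k p, ‖τ' k p‖ ≤ C' * w' k p) → ∀ k p, ‖τ k p * τ' k p‖ ≤ C * C' * (w k p * w' k p) := by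
    intro τ τ' w w' h h' k p
    rw [norm_mul]
    calc _ ≤ (C * w k p) * (C' * w' k p) :=
          mul_le_mul (h k p) (h' k p) (norm_nonneg _) ((norm_nonneg _).trans (h k p))
      _ = _ := by ring
  induction N generalizing w w' τ τ' with
  | zero => simpa [SymBound] using base h h'
  | succ N ih =>
    refine ⟨fun k p => (base h.1 h'.1 k p).trans ?_, fun i => ?_⟩
    · have h0 : 0 ≤ C * C' * (w k p * w' k p) := (norm_nonneg _).trans (base h.1 h'.1 k p)
      have : (1 : ℝ) ≤ 2 ^ (N + 1) := one_le_pow₀ (by norm_num)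
      nlinarith
    · simp only [dirDeriv_mul (hτ _) (hτ' _)]
      have h1 := ih (h.2 i) h'.pred (fun k => contDiff_dirDeriv (hτ k) i) hτ'
      have h2 := ih h.pred (h'.2 i) hτ (fun k => contDiff_dirDeriv (hτ' k) i)
      have e1 : (fun k p => w k p * s i p * w' k p) = fun k p => w k p * w' k p * s i p := by
        funext k p; ring
      have e2 : (fun k p => w k p * (w' k p * s i p)) = fun k p => w k p * w' k p * s i p := by
        funext k p; ring
      rw [e1] at h1
      rw [e2] at h2
      have h3 := h1.add h2 (fun k => (contDiff_dirDeriv (hτ k) i).mul (hτ' k))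
        fun k => (hτ k).mul (contDiff_dirDeriv (hτ' k) i)
      rw [show 2 ^ (N + 1) * (C * C') = 2 ^ N * (C * C') + 2 ^ N * (C * C') by ring]
      exact h3

/-- The recursive definition suits inductions on the order. This lemma and `symBound_of_dirDerivs`
translate it to and from bounds on explicit iterated derivatives. -/
lemma SymBound.dirDerivs (h : SymBound v s C N w τ) (L : List ι) (hL : L.length ≤ N) (k : κ)
    (p : W) : ‖dirDerivs v L (τ k) p‖ ≤ C * w k p * (L.map fun i => s i p).prod := by
  induction L generalizing N w τ with
  | nil => simpa [BilinearPDO.dirDerivs_nil] using h.zero k p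
  | cons i L ih =>
    obtain ⟨N, rfl⟩ : ∃ M, N = M + 1 := ⟨N - 1, by simp at hL; omega⟩
    have := ih (h.2 i) (by simpa using hL)
    rw [dirDerivs_cons, List.map_cons, List.prod_cons]
    refine this.trans_eq (by ring)

lemma symBound_of_dirDerivs
    (h : ∀ L : List ι, L.length ≤ N → ∀ k p,
      ‖BilinearPDO.dirDerivs v L (τ k) p‖ ≤ C * w k p * (L.map fun i => s i p).prod) :
    SymBound v s C N w τ := by
  induction N generalizing w τ with
  | zero => exact fun k p => by simpa [dirDerivs_nil] using h [] (by simp) k p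
  | succ N ih =>
    refine ⟨fun k p => by simpa [dirDerivs_nil] using h [] (by simp) k p, fun i => ?_⟩
    refine ih fun L hL k p => ?_
    have := h (i :: L) (by simpa using hL) k p
    rw [dirDerivs_cons, List.map_cons, List.prod_cons] at this
    exact this.trans_eq (by ring)

lemma SymOrder.mono (h : SymOrder v s N w τ) {s' : ι → W → ℝ} (hs : ∀ i p, 0 ≤ s i p)
    (hss' : ∀ i p, s i p ≤ s' i p) (hw' : ∀ k p, 0 ≤ w' k p)
    (hw : ∃ A, 0 ≤ A ∧ ∀ k p, w k p ≤ A * w' k p) : SymOrder v s' N w' τ := by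
  obtain ⟨hτ, C, hC, h⟩ := h
  obtain ⟨A, hA, hw⟩ := hw
  refine ⟨hτ, C * A, by positivity, h.mono hs hss' (fun k p => ?_) fun k p => ?_⟩
  · rw [mul_assoc]
    exact mul_le_mul_of_nonneg_left (hw k p) hC
  · exact mul_nonneg (by positivity) (hw' k p)

lemma SymOrder.mul (h : SymOrder v s N w τ) (h' : SymOrder v s N w' τ') :
    SymOrder v s N (fun k p => w k p * w' k p) (fun k p => τ k p * τ' k p) := by
  obtain ⟨hτ, C, hC, h⟩ := h
  obtain ⟨hτ', C', hC', h'⟩ := h'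
  exact ⟨fun k => (hτ k).mul (hτ' k), _, by positivity, h.mul h' hτ hτ'⟩

lemma SymOrder.add (h : SymOrder v s N w τ) (h' : SymOrder v s N w τ') :
    SymOrder v s N w (fun k p => τ k p + τ' k p) := by
  obtain ⟨hτ, C, hC, h⟩ := h
  obtain ⟨hτ', C', hC', h'⟩ := h'
  exact ⟨fun k => (hτ k).add (hτ' k), _, by positivity, h.add h' hτ hτ'⟩

/-- There are finitely many directions, so the constants for the first derivatives have a common
bound. This is the induction step of the composition results below. -/
lemma symOrder_succ [Finite ι] (hw : ∀ k p, 0 ≤ w k p) (hs : ∀ i p, 0 ≤ s i p)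
    (h0 : SymOrder v s 0 w τ)
    (h : ∀ i, SymOrder v s N (fun k p => w k p * s i p) (fun k => dirDeriv v i (τ k))) :
    SymOrder v s (N + 1) w τ := by
  obtain ⟨hτ, C, hC, h0⟩ := h0
  choose _ D hD h using h
  obtain ⟨M, hM⟩ := (Set.finite_range D).bddAbove
  have hM' : ∀ i, D i ≤ M := fun i => hM ⟨i, rfl⟩
  have hM0 : 0 ≤ max C M := hC.trans (le_max_left _ _)
  refine ⟨hτ, max C M, hM0, fun k p => (h0 k p).trans ?_, fun i => ?_⟩
  · exact mul_le_mul_of_nonneg_right (le_max_left _ _) (hw k p)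
  · refine (h i).mono hs (fun _ _ => le_rfl) (fun k p => ?_) fun k p => ?_
    · exact mul_le_mul_of_nonneg_right ((hM' i).trans (le_max_right _ _))
        (mul_nonneg (hw k p) (hs i p))
    · exact mul_nonneg hM0 (mul_nonneg (hw k p) (hs i p))

lemma SymOrder.dirDeriv (h : SymOrder v s (N + 1) w τ) (i : ι) :
    SymOrder v s N (fun k p => w k p * s i p) (fun k => dirDeriv v i (τ k)) :=
  ⟨fun k => contDiff_dirDeriv (h.1 k) i, h.2.imp fun _ hC => ⟨hC.1, hC.2.2 i⟩⟩

lemma Sym.contDiff (h : Sym v s w τ) (k : κ) : ContDiff ℝ ∞ (τ k) := (h 0).1 k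

lemma Sym.mul (h : Sym v s w τ) (h' : Sym v s w' τ') :
    Sym v s (fun k p => w k p * w' k p) (fun k p => τ k p * τ' k p) := fun N => (h N).mul (h' N)

lemma Sym.add (h : Sym v s w τ) (h' : Sym v s w τ') :
    Sym v s w (fun k p => τ k p + τ' k p) := fun N => (h N).add (h' N)

lemma Sym.dirDeriv (h : Sym v s w τ) (i : ι) :
    Sym v s (fun k p => w k p * s i p) (fun k => BilinearPDO.dirDeriv v i (τ k)) :=
  fun N => (h (N + 1)).dirDeriv i

lemma Sym.mono (h : Sym v s w τ) {s' : ι → W → ℝ} (hs : ∀ i p, 0 ≤ s i p)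
    (hss' : ∀ i p, s i p ≤ s' i p) (hw' : ∀ k p, 0 ≤ w' k p)
    (hw : ∃ A, 0 ≤ A ∧ ∀ k p, w k p ≤ A * w' k p) : Sym v s' w' τ :=
  fun N => (h N).mono hs hss' hw' hw

lemma Sym.comp {κ' : Type*} (h : Sym v s w τ) (φ : κ' → κ) :
    Sym v s (fun k => w (φ k)) (fun k => τ (φ k)) := by
  intro N
  obtain ⟨hτ, C, hC, h⟩ := h N
  refine ⟨fun k => hτ _, C, hC, symBound_of_dirDerivs fun L hL k p => h.dirDerivs L hL _ p⟩

lemma symBound_zero_fun (hw : ∀ k p, 0 ≤ w k p) (hs : ∀ i p, 0 ≤ s i p) :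
    SymBound v s 0 N w (fun _ _ => (0 : ℂ)) := by
  induction N generalizing w with
  | zero => intro k p; simp
  | succ N ih =>
    refine ⟨fun k p => by simp, fun i => ?_⟩
    have : BilinearPDO.dirDeriv v i (fun _ : W => (0 : ℂ)) = fun _ => 0 := by
      funext p; simp [BilinearPDO.dirDeriv]
    simp only [this]
    exact ih fun k p => mul_nonneg (hw k p) (hs i p)

lemma sym_const (c : ℂ) (hw : ∀ k p, 0 ≤ w k p) (hs : ∀ i p, 0 ≤ s i p)
    (hc : ∃ A, 0 ≤ A ∧ ∀ k p, ‖c‖ ≤ A * w k p) :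
    Sym v s w (fun _ _ => c) := by
  obtain ⟨A, hA, hc⟩ := hc
  intro N
  refine ⟨fun k => contDiff_const, A, hA, ?_⟩
  cases N with
  | zero => intro k p; exact hc k p
  | succ N =>
    refine ⟨hc, fun i => ?_⟩
    have : BilinearPDO.dirDeriv v i (fun _ : W => c) = fun _ => 0 := by
      funext p; simp [BilinearPDO.dirDeriv]
    simp only [this]
    have h0 := fun k p => mul_nonneg (hw k p) (hs i p)
    exact (symBound_zero_fun (N := N) h0 hs).mono hs (fun _ _ => le_rfl)
      (fun k p => by simpa using mul_nonneg hA (h0 k p)) fun k p => mul_nonneg hA (h0 k p)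

lemma sym_clm [Finite ι] (l : W →L[ℝ] ℝ) (hw : ∀ k p, 0 ≤ w k p) (hs : ∀ i p, 0 ≤ s i p)
    (h0 : ∀ k p, |l p| ≤ w k p) (h1 : ∀ i, ∃ A, 0 ≤ A ∧ ∀ k p, |l (v i)| ≤ A * (w k p * s i p)) :
    Sym v s w (fun _ p => (l p : ℂ)) := by
  have hsm : ContDiff ℝ ∞ (fun p => (l p : ℂ)) := Complex.ofRealCLM.contDiff.comp l.contDiff
  have hz : SymOrder v s 0 w (fun _ p => (l p : ℂ)) :=
    ⟨fun _ => hsm, 1, zero_le_one, fun k p => by simpa using h0 k p⟩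
  intro N
  cases N with
  | zero => exact hz
  | succ N =>
    refine symOrder_succ hw hs hz fun i => ?_
    have : BilinearPDO.dirDeriv v i (fun p => (l p : ℂ)) = fun _ => (l (v i) : ℂ) := by
      funext p
      have := Complex.ofRealCLM.hasFDerivAt.comp p l.hasFDerivAt
      simp only [BilinearPDO.dirDeriv]
      rw [show (fun p => (l p : ℂ)) = Complex.ofRealCLM ∘ l from rfl, this.fderiv]
      rfl
    simp only [this]
    exact sym_const _ (fun k p => mul_nonneg (hw k p) (hs i p)) hs
      ((h1 i).imp fun A hA => ⟨hA.1, fun k p => by simpa using hA.2 k p⟩) N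

lemma sym_sum {α : Type*} (S : Finset α) {T : α → κ → W → ℂ} (hw : ∀ k p, 0 ≤ w k p)
    (hs : ∀ i p, 0 ≤ s i p) (h : ∀ a ∈ S, Sym v s w (T a)) :
    Sym v s w (fun k p => ∑ a ∈ S, T a k p) := by
  classical
  induction S using Finset.induction_on with
  | empty => simpa using sym_const 0 hw hs ⟨0, le_rfl, by simp⟩
  | insert a S ha ih =>
    simp only [Finset.sum_insert ha]
    exact (h a (Finset.mem_insert_self _ _)).add
      (ih fun b hb => h b (Finset.mem_insert_of_mem hb))

/-! ### Powers and cutoffs of elliptic symbols -/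

section Elliptic

variable {r : W → ℝ}

lemma dirDeriv_ofReal_comp {φ : ℝ → ℝ} {φ' : ℝ} {p : W} (i : ι) (hr : Differentiable ℝ r)
    (hφ : HasDerivAt φ φ' (r p)) :
    BilinearPDO.dirDeriv v i (fun p => ((φ (r p) : ℝ) : ℂ)) p =
      (φ' : ℂ) * BilinearPDO.dirDeriv v i (fun p => (r p : ℂ)) p := by
  have h1 := Complex.ofRealCLM.hasFDerivAt.comp p (hφ.comp_hasFDerivAt p (hr p).hasFDerivAt)
  have h2 := Complex.ofRealCLM.hasFDerivAt.comp p (hr p).hasFDerivAt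
  simp only [BilinearPDO.dirDeriv]
  rw [show (fun p => ((φ (r p) : ℝ) : ℂ)) = Complex.ofRealCLM ∘ φ ∘ r from rfl, h1.fderiv,
    show (fun p => (r p : ℂ)) = Complex.ofRealCLM ∘ r from rfl, h2.fderiv]
  simp

/-- Real powers of an elliptic symbol. -/
lemma Sym.rpow [Finite ι] (hs : ∀ i p, 0 ≤ s i p) (hr0 : ∀ p, 0 < r p) (hr : ContDiff ℝ ∞ r)
    (h : Sym v s (fun (_ : κ) => r) (fun _ p => (r p : ℂ))) (a : ℝ) :
    Sym v s (fun (_ : κ) p => r p ^ a) (fun _ p => ((r p ^ a : ℝ) : ℂ)) := by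
  have hsm : ∀ a : ℝ, ContDiff ℝ ∞ fun p => ((r p ^ a : ℝ) : ℂ) := fun a =>
    Complex.ofRealCLM.contDiff.comp (hr.rpow_const_of_ne fun p => (hr0 p).ne')
  have hpos : ∀ (a : ℝ) p, 0 ≤ r p ^ a := fun a p => (Real.rpow_pos_of_pos (hr0 p) a).le
  have hz : ∀ a : ℝ, SymOrder v s 0 (fun (_ : κ) p => r p ^ a)
      (fun _ p => ((r p ^ a : ℝ) : ℂ)) := fun a =>
    ⟨fun _ => hsm a, 1, zero_le_one, fun k p => by
      rw [Complex.norm_real, Real.norm_of_nonneg (hpos a p), one_mul]⟩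
  intro N
  induction N generalizing a with
  | zero => exact hz a
  | succ N ih =>
    refine symOrder_succ (fun _ => hpos a) hs (hz a) fun i => ?_
    -- The exponent drops to a - 1, which is why the induction on N runs over all exponents at once;
    -- the weight r of ∂_i r makes up for the loss.
    have e : BilinearPDO.dirDeriv v i (fun p => ((r p ^ a : ℝ) : ℂ)) = fun p =>
        ((a : ℂ) * ((r p ^ (a - 1) : ℝ) : ℂ)) * BilinearPDO.dirDeriv v i (fun p => (r p : ℂ)) p := by
      funext p
      rw [dirDeriv_ofReal_comp (φ := fun t => t ^ a) i (hr.differentiable (by simp))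
        (Real.hasDerivAt_rpow_const (Or.inl (hr0 p).ne'))]
      push_cast
      rfl
    simp only [e]
    have hc : Sym v s (fun (_ : κ) _ => 1) (fun _ _ => (a : ℂ)) :=
      sym_const _ (fun _ _ => zero_le_one) hs ⟨‖(a : ℂ)‖, norm_nonneg _, by simp⟩
    refine (((hc N).mul (ih (a - 1))).mul (h.dirDeriv i N)).mono hs (fun _ _ => le_rfl)
      (fun k p => mul_nonneg (hpos a p) (hs i p)) ⟨1, zero_le_one, fun k p => ?_⟩
    have : r p ^ a = r p ^ (a - 1) * r p := by
      rw [← Real.rpow_add_one (hr0 p).ne']; simp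
    rw [this]
    exact le_of_eq (by ring)

/-- Cutoffs localizing an elliptic symbol to a range of size `1 / ε`. -/
lemma Sym.cutoff [Finite ι] (hs : ∀ i p, 0 ≤ s i p) (hr0 : ∀ p, 0 < r p) (hr : ContDiff ℝ ∞ r)
    (h : Sym v s (fun (_ : κ) => r) (fun _ p => (r p : ℂ))) (ε : κ → ℝ) {c₁ c₂ : ℝ}
    {φ : ℝ → ℝ} (hφ : ContDiff ℝ ∞ φ) (hφs : tsupport φ ⊆ Set.Icc c₁ c₂) :
    Sym v s (fun k p => (Set.Icc c₁ c₂).indicator 1 (ε k * r p))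
      (fun k p => ((φ (ε k * r p) : ℝ) : ℂ)) := by
  have hind : ∀ k p, (0 : ℝ) ≤ (Set.Icc c₁ c₂).indicator 1 (ε k * r p) := fun k p =>
    Set.indicator_nonneg (fun _ _ => zero_le_one) _
  have hz : ∀ {φ : ℝ → ℝ}, ContDiff ℝ ∞ φ → tsupport φ ⊆ Set.Icc c₁ c₂ →
      SymOrder v s 0 (fun k p => (Set.Icc c₁ c₂).indicator 1 (ε k * r p))
        (fun k p => ((φ (ε k * r p) : ℝ) : ℂ)) := by
    intro φ hφ hφs
    have hK : HasCompactSupport φ := isCompact_Icc.of_isClosed_subset isClosed_closure hφs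
    obtain ⟨C, hC⟩ := hφ.continuous.bounded_above_of_compact_support hK
    refine ⟨fun k => Complex.ofRealCLM.contDiff.comp (hφ.comp (contDiff_const.mul hr)), C,
      (norm_nonneg _).trans (hC 0), fun k p => ?_⟩
    rw [Complex.norm_real]
    by_cases hp : ε k * r p ∈ Set.Icc c₁ c₂
    · simpa [Set.indicator_of_mem hp] using hC (ε k * r p)
    · have : φ (ε k * r p) = 0 := image_eq_zero_of_notMem_tsupport fun h => hp (hφs h)
      simp [this, Set.indicator_of_notMem hp]
  intro N
  induction N generalizing φ with
  | zero => exact hz hφ hφs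
  | succ N ih =>
    refine symOrder_succ hind hs (hz hφ hφs) fun i => ?_
    -- The scale ε is absorbed into t φ'(t), a profile with the same support, so the constants do
    -- not depend on k; the remaining factor r⁻¹ ∂_i r has the size of the gain s i.
    have e : ∀ k, BilinearPDO.dirDeriv v i (fun p => ((φ (ε k * r p) : ℝ) : ℂ)) = fun p =>
        (((ε k * r p) * deriv φ (ε k * r p) : ℝ) : ℂ) *
          (((r p ^ (-1 : ℝ) : ℝ) : ℂ) * BilinearPDO.dirDeriv v i (fun p => (r p : ℂ)) p) := by
      intro k
      funext p
      have hd : HasDerivAt (fun t => φ (ε k * t)) (deriv φ (ε k * r p) * ε k) (r p) := by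
        have h1 := (hφ.differentiable (by simp) (ε k * r p)).hasDerivAt
        exact HasDerivAt.comp (r p) h1 (by simpa using (hasDerivAt_id (r p)).const_mul (ε k))
      rw [dirDeriv_ofReal_comp (φ := fun t => φ (ε k * t)) i (hr.differentiable (by simp)) hd,
        Real.rpow_neg_one, ← mul_assoc]
      congr 1
      have := (hr0 p).ne'
      norm_cast
      field_simp
    simp only [e]
    have hφ1 : ContDiff ℝ ∞ fun t => t * deriv φ t := by
      have := (contDiff_infty_iff_deriv.1 hφ).2
      exact contDiff_id.mul this
    have hφ2 : tsupport (fun t => t * deriv φ t) ⊆ Set.Icc c₁ c₂ :=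
      (tsupport_mul_subset_right.trans (closure_minimal (support_deriv_subset) isClosed_closure)).trans
        hφs
    refine ((ih hφ1 hφ2).mul (((h.rpow hs hr0 hr (-1)) N).mul (h.dirDeriv i N))).mono hs
      (fun _ _ => le_rfl) (fun k p => mul_nonneg (hind k p) (hs i p))
      ⟨1, zero_le_one, fun k p => le_of_eq ?_⟩
    have : r p ^ (-1 : ℝ) * (r p * s i p) = s i p := by
      rw [Real.rpow_neg_one]; field_simp [(hr0 p).ne']
    rw [this, one_mul]

end Elliptic

end SymbolClasses

end BilinearPDO

namespace BilinearPDO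

/-! ### Phase space and the Hörmander class as an abstract symbol class -/

section PhaseSpace

variable {n : ℕ}

/-- The space of triples `(x, ξ, η)`. -/
abbrev Phase (n : ℕ) : Type := Euc n × Euc n × Euc n

/-- The index set of the `3n` coordinate directions of `Phase n`. -/
abbrev Idx (n : ℕ) : Type := Fin n ⊕ Fin n ⊕ Fin n

/-- The standard basis of `ℝⁿ`. -/
noncomputable def basisVec (i : Fin n) : Euc n := EuclideanSpace.single i 1

/-- The coordinate directions of `Phase n`. -/
noncomputable def axis : Idx n → Phase n
  | .inl i => (basisVec i, 0, 0)
  | .inr (.inl i) => (0, basisVec i, 0)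
  | .inr (.inr i) => (0, 0, basisVec i)

abbrev xIdx (i : Fin n) : Idx n := .inl i
abbrev ξIdx (i : Fin n) : Idx n := .inr (.inl i)
abbrev ηIdx (i : Fin n) : Idx n := .inr (.inr i)

/-- The list in which each index `i` occurs `α i` times, in the order used by `multiDeriv`. -/
def multiList (α : Fin n → ℕ) : List (Fin n) :=
  (List.finRange n).reverse.flatMap fun i => List.replicate (α i) i

lemma dirDerivs_replicate {ι W : Type*} [NormedAddCommGroup W] [NormedSpace ℝ W] (v : ι → W)
    (k : ℕ) (i : ι) (f : W → ℂ) :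
    dirDerivs v (List.replicate k i) f = (dirDeriv v i)^[k] f := by
  induction k generalizing f with
  | zero => rfl
  | succ k ih => rw [List.replicate_succ, dirDerivs_cons, ih, Function.iterate_succ_apply]

lemma multiDeriv_eq_dirDerivs (α : Fin n → ℕ) (f : Euc n → ℂ) :
    multiDeriv α f = dirDerivs basisVec (multiList α) f := by
  have : ∀ L : List (Fin n), L.foldr (fun i F => (partialDeriv i)^[α i] F) f =
      dirDerivs basisVec (L.reverse.flatMap fun i => List.replicate (α i) i) f := by
    intro L
    induction L with
    | nil => rfl
    | cons i L ih =>
      rw [List.foldr_cons, ih, List.reverse_cons, List.flatMap_append, dirDerivs_append]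
      simp only [List.flatMap_cons, List.flatMap_nil, List.append_nil, dirDerivs_replicate]
      rfl
  exact this _

lemma length_multiList (α : Fin n → ℕ) : (multiList α).length = ∑ i, α i := by
  rw [multiList, List.length_flatMap, Fin.sum_univ_def]
  simp [List.map_reverse, List.sum_reverse]

lemma perm_multiList (L : List (Fin n)) : L.Perm (multiList fun i => L.count i) := by
  classical
  rw [List.perm_iff_count]
  intro j
  rw [multiList, List.count_flatMap]
  have : (List.count j ∘ fun i => List.replicate (L.count i) i) =
      fun i => if i = j then L.count j else 0 := by
    funext i
    by_cases h : i = j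
    · subst h; simp
    · simp [List.count_replicate, h]
  rw [this, List.map_reverse, List.sum_reverse, ← Fin.sum_univ_def]
  simp

/-- Chain rule along an affine map. It identifies derivatives in one group of variables, the others
being fixed, with derivatives on the whole phase space. -/
lemma dirDerivs_slice {W ι ι' : Type*} [NormedAddCommGroup W] [NormedSpace ℝ W]
    {W' : Type*} [NormedAddCommGroup W'] [NormedSpace ℝ W'] (T : W →L[ℝ] W') (c : W')
    {v : ι → W} {v' : ι' → W'} (φ : ι → ι') (hφ : ∀ i, T (v i) = v' (φ i)) {f : W' → ℂ}
    (hf : ContDiff ℝ ∞ f) (L : List ι) :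
    dirDerivs v L (fun p => f (c + T p)) = fun p => dirDerivs v' (L.map φ) f (c + T p) := by
  induction L generalizing f with
  | nil => rfl
  | cons i L ih =>
    have : dirDeriv v i (fun p => f (c + T p)) = fun p => dirDeriv v' (φ i) f (c + T p) := by
      funext p
      simp only [dirDeriv, ← hφ]
      have := ((hf.differentiable (by simp) (c + T p)).hasFDerivAt).comp p
        (T.hasFDerivAt.const_add c)
      rw [show (fun p => f (c + T p)) = f ∘ (fun p => c + T p) from rfl, this.fderiv]
      rfl
    rw [dirDerivs_cons, this, ih (contDiff_dirDeriv hf (φ i))]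
    rfl

/-- The canonical list of directions of the derivative `∂_x^α ∂_ξ^β ∂_η^γ`. -/
def phaseList (α β γ : Fin n → ℕ) : List (Idx n) :=
  (multiList γ).map ηIdx ++ (multiList β).map ξIdx ++ (multiList α).map xIdx

/-- A symbol as a function on `Phase n`. -/
def uncurry3 (σ : Euc n → Euc n → Euc n → ℂ) (p : Phase n) : ℂ := σ p.1 p.2.1 p.2.2

lemma symbolDeriv_eq_dirDerivs {σ : Euc n → Euc n → Euc n → ℂ}
    (hσ : ContDiff ℝ ∞ (uncurry3 σ)) (α β γ : Fin n → ℕ) (x ξ η : Euc n) :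
    symbolDeriv α β γ σ x ξ η = dirDerivs axis (phaseList α β γ) (uncurry3 σ) (x, ξ, η) := by
  simp only [symbolDeriv, multiDeriv_eq_dirDerivs, phaseList, dirDerivs_append]
  have hη : ∀ x ξ, dirDerivs basisVec (multiList γ) (fun η => σ x ξ η) = fun η =>
      dirDerivs axis ((multiList γ).map ηIdx) (uncurry3 σ) (x, ξ, η) := by
    intro x ξ
    have := dirDerivs_slice
      ((ContinuousLinearMap.inr ℝ (Euc n) (Euc n × Euc n)).comp
        (ContinuousLinearMap.inr ℝ (Euc n) (Euc n))) (x, ξ, 0) (v := basisVec) (v' := axis)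
      ηIdx (fun i => rfl) hσ (multiList γ)
    simpa [uncurry3] using this
  simp only [hη]
  have h1 := contDiff_dirDerivs (v := axis) ((multiList γ).map ηIdx) hσ
  have hξ : ∀ x, dirDerivs basisVec (multiList β) (fun ξ =>
      dirDerivs axis ((multiList γ).map ηIdx) (uncurry3 σ) (x, ξ, η)) = fun ξ =>
      dirDerivs axis ((multiList β).map ξIdx)
        (dirDerivs axis ((multiList γ).map ηIdx) (uncurry3 σ)) (x, ξ, η) := by
    intro x
    have := dirDerivs_slice
      ((ContinuousLinearMap.inr ℝ (Euc n) (Euc n × Euc n)).comp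
        (ContinuousLinearMap.inl ℝ (Euc n) (Euc n))) (x, 0, η) (v := basisVec) (v' := axis)
      ξIdx (fun i => rfl) h1 (multiList β)
    simpa using this
  simp only [hξ]
  have h2 := contDiff_dirDerivs (v := axis) ((multiList β).map ξIdx) h1
  have := dirDerivs_slice (ContinuousLinearMap.inl ℝ (Euc n) (Euc n × Euc n)) (0, ξ, η)
    (v := basisVec) (v' := axis) xIdx (fun i => rfl) h2 (multiList α)
  simpa using congrFun this x

/-- Needed for comparing lists of directions by counting multiplicities. -/
instance : LawfulBEq (Idx n) where
  eq_of_beq {a b} h := by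
    rcases a with a | a | a <;> rcases b with b | b | b <;>
      first
        | exact absurd (show false = true from h) (by decide)
        | (rw [eq_of_beq (α := Fin n) (a := a) (b := b) h])
  rfl {a} := by
    rcases a with a | a | a <;> exact beq_self_eq_true (α := Fin n) a

lemma perm_phaseList (L : List (Idx n)) :
    L.Perm (phaseList (fun i => L.count (xIdx i)) (fun i => L.count (ξIdx i))
      (fun i => L.count (ηIdx i))) := by
  classical
  have hc : ∀ (M : Fin n → ℕ) (j : Fin n), (multiList M).count j = M j := by
    intro M j
    rw [multiList, List.count_flatMap]
    have : (List.count j ∘ fun i => List.replicate (M i) i) =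
        fun i => if i = j then M j else 0 := by
      funext i
      by_cases h : i = j
      · subst h; simp
      · simp [List.count_replicate, h]
    rw [this, List.map_reverse, List.sum_reverse, ← Fin.sum_univ_def]
    simp
  have hx : Function.Injective (xIdx (n := n)) := Sum.inl_injective
  have hξ : Function.Injective (ξIdx (n := n)) := Sum.inr_injective.comp Sum.inl_injective
  have hη : Function.Injective (ηIdx (n := n)) := Sum.inr_injective.comp Sum.inr_injective
  have hz : ∀ (φ : Fin n → Idx n) (M : List (Fin n)) (a : Idx n), (∀ i, φ i ≠ a) →
      (M.map φ).count a = 0 := fun φ M a h =>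
    List.count_eq_zero.2 fun ha => by
      obtain ⟨i, -, hi⟩ := List.mem_map.1 ha
      exact h i hi
  rw [List.perm_iff_count]
  intro j
  simp only [phaseList, List.count_append]
  rcases j with j | j | j
  · rw [List.count_map_of_injective _ _ hx, hc]
    rw [hz _ _ _ (fun i => by simp), hz _ _ _ (fun i => by simp)]
    simp
  · rw [List.count_map_of_injective _ _ hξ, hc]
    rw [hz _ _ _ (fun i => by simp), hz _ _ _ (fun i => by simp)]
    simp
  · rw [List.count_map_of_injective _ _ hη, hc]
    rw [hz _ _ _ (fun i => by simp), hz _ _ _ (fun i => by simp)]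
    simp

/-- `1 + |ξ|²`. -/
noncomputable def japξ (p : Phase n) : ℝ := 1 + ‖p.2.1‖ ^ 2

/-- `1 + |η|²`. -/
noncomputable def japη (p : Phase n) : ℝ := 1 + ‖p.2.2‖ ^ 2

/-- `2 + |ξ|² + |η|²`. -/
noncomputable def jap (p : Phase n) : ℝ := japξ p + japη p

lemma one_le_japξ (p : Phase n) : 1 ≤ japξ p := by simp [japξ]
lemma one_le_japη (p : Phase n) : 1 ≤ japη p := by simp [japη]
lemma japξ_pos (p : Phase n) : 0 < japξ p := zero_lt_one.trans_le (one_le_japξ p)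
lemma japη_pos (p : Phase n) : 0 < japη p := zero_lt_one.trans_le (one_le_japη p)
lemma jap_pos (p : Phase n) : 0 < jap p := add_pos (japξ_pos p) (japη_pos p)
lemma japξ_le_jap (p : Phase n) : japξ p ≤ jap p := by
  have := japη_pos p; simp only [jap]; linarith
lemma japη_le_jap (p : Phase n) : japη p ≤ jap p := by
  have := japξ_pos p; simp only [jap]; linarith
lemma one_le_jap (p : Phase n) : 1 ≤ jap p := (one_le_japξ p).trans (japξ_le_jap p)

lemma contDiff_japξ : ContDiff ℝ ∞ (japξ (n := n)) :=
  contDiff_const.add ((contDiff_snd.fst).norm_sq ℝ)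
lemma contDiff_japη : ContDiff ℝ ∞ (japη (n := n)) :=
  contDiff_const.add ((contDiff_snd.snd).norm_sq ℝ)
lemma contDiff_jap : ContDiff ℝ ∞ (jap (n := n)) := contDiff_japξ.add contDiff_japη

/-- The gains of the bilinear class of type `(δ, δ)`. -/
noncomputable def bilinearScale (δ : ℝ) : Idx n → Phase n → ℝ
  | .inl _ => fun p => jap p ^ (δ / 2)
  | .inr _ => fun p => jap p ^ (-(δ / 2))

/-- The gains used after the frequencies `ξ` have been made dominant. -/
noncomputable def linearScale (δ : ℝ) : Idx n → Phase n → ℝ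
  | .inl _ => fun p => jap p ^ (δ / 2)
  | .inr (.inl _) => fun p => japξ p ^ (-(δ / 2))
  | .inr (.inr _) => fun _ => 1

lemma bilinearScale_nonneg (δ : ℝ) (i : Idx n) (p : Phase n) : 0 ≤ bilinearScale δ i p := by
  rcases i with i | i <;> exact (Real.rpow_pos_of_pos (jap_pos p) _).le

lemma linearScale_nonneg (δ : ℝ) (i : Idx n) (p : Phase n) : 0 ≤ linearScale δ i p := by
  rcases i with i | i | i
  · exact (Real.rpow_pos_of_pos (jap_pos p) _).le
  · exact (Real.rpow_pos_of_pos (japξ_pos p) _).le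
  · exact zero_le_one

/-- The gains are weakened on purpose: powers of ⟨ξ⟩ or ⟨η⟩ alone improve under differentiation only
by powers of ⟨ξ⟩ or ⟨η⟩, not of ⟨ξ⟩² + ⟨η⟩², and the splitting multiplies σ by such powers. -/
lemma bilinearScale_le_linearScale {δ : ℝ} (hδ : 0 ≤ δ) (i : Idx n) (p : Phase n) :
    bilinearScale δ i p ≤ linearScale δ i p := by
  rcases i with i | i | i
  · exact le_rfl
  · exact Real.rpow_le_rpow_of_nonpos (japξ_pos p) (japξ_le_jap p) (by linarith)
  · exact Real.rpow_le_one_of_one_le_of_nonpos (one_le_jap p) (by linarith)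

lemma jap_le_sq (p : Phase n) : jap p ≤ 2 * (1 + ‖p.2.1‖ + ‖p.2.2‖) ^ 2 := by
  have h1 := norm_nonneg p.2.1
  have h2 := norm_nonneg p.2.2
  simp only [jap, japξ, japη]
  nlinarith [mul_nonneg h1 h2]

lemma sq_le_jap (p : Phase n) : (1 + ‖p.2.1‖ + ‖p.2.2‖) ^ 2 ≤ 3 * jap p := by
  have h1 := norm_nonneg p.2.1
  have h2 := norm_nonneg p.2.2
  simp only [jap, japξ, japη]
  nlinarith [sq_nonneg (‖p.2.1‖ - 1), sq_nonneg (‖p.2.2‖ - 1), sq_nonneg (‖p.2.1‖ - ‖p.2.2‖)]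

/-- The quantities (1 + |ξ| + |η|)² and `jap` are comparable from both sides; the sign of e decides
which side is used. -/
lemma rpow_le_jap (e : ℝ) : ∃ A, 0 ≤ A ∧ ∀ p : Phase n,
    (1 + ‖p.2.1‖ + ‖p.2.2‖) ^ e ≤ A * jap p ^ (e / 2) := by
  have hsq : ∀ p : Phase n, (1 + ‖p.2.1‖ + ‖p.2.2‖) ^ e =
      ((1 + ‖p.2.1‖ + ‖p.2.2‖) ^ 2) ^ (e / 2) := by
    intro p
    rw [← Real.rpow_natCast, ← Real.rpow_mul (by positivity)]
    congr 1
    push_cast; ring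
  rcases le_total 0 e with he | he
  · refine ⟨3 ^ (e / 2), by positivity, fun p => ?_⟩
    rw [hsq, ← Real.mul_rpow (by norm_num) (jap_pos p).le]
    exact Real.rpow_le_rpow (by positivity) (sq_le_jap p) (by linarith)
  · refine ⟨2⁻¹ ^ (e / 2), by positivity, fun p => ?_⟩
    rw [hsq, ← Real.mul_rpow (by norm_num) (jap_pos p).le]
    refine Real.rpow_le_rpow_of_nonpos (mul_pos (by norm_num) (jap_pos p)) ?_ (by linarith)
    have := jap_le_sq p
    linarith

lemma prod_map_bilinearScale (δ : ℝ) (α β γ : Fin n → ℕ) (p : Phase n) :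
    ((phaseList α β γ).map fun i => bilinearScale δ i p).prod =
      jap p ^ ((δ * ((∑ i, α i : ℕ) : ℝ) -
        δ * (((∑ i, β i : ℕ) : ℝ) + ((∑ i, γ i : ℕ) : ℝ))) / 2) := by
  have h : ∀ (M : List (Fin n)) (e : ℝ) (φ : Fin n → Idx n),
      (∀ i, bilinearScale δ (φ i) p = jap p ^ e) →
      ((M.map φ).map fun i => bilinearScale δ i p).prod = jap p ^ (e * M.length) := by
    intro M e φ hφ
    rw [List.map_map]
    have : ((fun i => bilinearScale δ i p) ∘ φ) = fun _ => jap p ^ e := funext hφ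
    rw [this, List.map_const', List.prod_replicate, Real.rpow_mul_natCast (jap_pos p).le]
  rw [phaseList, List.map_append, List.map_append, List.prod_append, List.prod_append,
    h _ (-(δ / 2)) _ (fun _ => rfl), h _ (-(δ / 2)) _ (fun _ => rfl), h _ (δ / 2) _ (fun _ => rfl),
    ← Real.rpow_add (jap_pos p), ← Real.rpow_add (jap_pos p), length_multiList, length_multiList,
    length_multiList]
  congr 1
  ring

/-- Symbols in the bilinear Hörmander class satisfy the abstract symbol estimates. -/
lemma BS.sym {m ρ δ : ℝ} (hδρ : δ ≤ ρ) {σ : Euc n → Euc n → Euc n → ℂ} (hσ : BS m ρ δ σ) :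
    Sym (axis (n := n)) (bilinearScale δ) (fun (_ : Unit) p => jap p ^ (m / 2))
      (fun _ => uncurry3 σ) := by
  classical
  have hsm : ContDiff ℝ ∞ (uncurry3 σ) := hσ.smooth
  have hL : ∀ L : List (Idx n), ∃ C, 0 ≤ C ∧ ∀ p, ‖dirDerivs axis L (uncurry3 σ) p‖ ≤
      C * jap p ^ (m / 2) * (L.map fun i => bilinearScale δ i p).prod := by
    intro L
    set α : Fin n → ℕ := fun i => L.count (xIdx i)
    set β : Fin n → ℕ := fun i => L.count (ξIdx i)
    set γ : Fin n → ℕ := fun i => L.count (ηIdx i)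
    obtain ⟨C, hC⟩ := hσ.bound α β γ
    set e := m + δ * ((∑ i, α i : ℕ) : ℝ) - ρ * (((∑ i, β i : ℕ) : ℝ) + ((∑ i, γ i : ℕ) : ℝ))
    -- The gain ρ per frequency derivative is lowered to δ, which only raises the exponent of a base
    -- that is at least 1.
    set e' := m + δ * ((∑ i, α i : ℕ) : ℝ) - δ * (((∑ i, β i : ℕ) : ℝ) + ((∑ i, γ i : ℕ) : ℝ))
    have hee : e ≤ e' := by
      have : δ * (((∑ i, β i : ℕ) : ℝ) + ((∑ i, γ i : ℕ) : ℝ)) ≤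
        ρ * (((∑ i, β i : ℕ) : ℝ) + ((∑ i, γ i : ℕ) : ℝ)) :=
        mul_le_mul_of_nonneg_right hδρ (by positivity)
      simp only [e, e']
      linarith
    obtain ⟨A, hA, hAe⟩ := rpow_le_jap (n := n) e'
    refine ⟨|C| * A, by positivity, fun p => ?_⟩
    have hperm := perm_phaseList L
    rw [dirDerivs_perm hperm hsm, (hperm.map _).prod_eq, prod_map_bilinearScale,
      mul_assoc, ← Real.rpow_add (jap_pos p)]
    have h1 := hC p.1 p.2.1 p.2.2
    rw [symbolDeriv_eq_dirDerivs hsm] at h1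
    have hb : (0 : ℝ) ≤ (1 + ‖p.2.1‖ + ‖p.2.2‖) ^ e := by positivity
    calc ‖dirDerivs axis (phaseList α β γ) (uncurry3 σ) p‖
        ≤ C * (1 + ‖p.2.1‖ + ‖p.2.2‖) ^ e := h1
      _ ≤ |C| * (1 + ‖p.2.1‖ + ‖p.2.2‖) ^ e := mul_le_mul_of_nonneg_right (le_abs_self C) hb
      _ ≤ |C| * (1 + ‖p.2.1‖ + ‖p.2.2‖) ^ e' := by
          refine mul_le_mul_of_nonneg_left ?_ (abs_nonneg C)
          exact Real.rpow_le_rpow_of_exponent_le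
            (by linarith [norm_nonneg p.2.1, norm_nonneg p.2.2]) hee
      _ ≤ |C| * (A * jap p ^ (e' / 2)) := mul_le_mul_of_nonneg_left (hAe p) (abs_nonneg C)
      _ = _ := by
          rw [mul_assoc]
          congr 4
          simp only [e']
          ring
  intro N
  choose C hC0 hC using hL
  -- Only finitely many lists of directions have length at most N, so one constant serves them all.
  obtain ⟨M, hM⟩ := ((List.finite_length_le (Idx n) N).image C).bddAbove
  refine ⟨fun _ => hsm, max M 0, le_max_right _ _, symBound_of_dirDerivs fun L hLN _ p =>
    (hC L p).trans ?_⟩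
  have hCM : C L ≤ max M 0 := (hM ⟨L, hLN, rfl⟩).trans (le_max_left _ _)
  have h1 : 0 ≤ jap p ^ (m / 2) := (Real.rpow_pos_of_pos (jap_pos p) _).le
  have h2 : 0 ≤ (L.map fun i => bilinearScale δ i p).prod :=
    List.prod_nonneg fun a ha => by
      obtain ⟨i, -, rfl⟩ := List.mem_map.1 ha
      exact bilinearScale_nonneg δ i p
  gcongr

end PhaseSpace

end BilinearPDO

namespace BilinearPDO

/-! ### Fourier multipliers on polynomially weighted L² -/

section WeightedMultiplier

open SchwartzMap FourierTransform LineDeriv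
open scoped SchwartzMap

variable {n : ℕ}

/-- The factor `1 + iλ(x_j - z_j)`. -/
noncomputable def linFactor (lam : ℝ) (z : Euc n) (j : Fin n) (x : Euc n) : ℂ :=
  1 + Complex.I * ((lam * (x j - z j) : ℝ) : ℂ)

/-- The product of the factors `1 + iλ(x_j - z_j)` over a list of coordinates. -/
noncomputable def linProd (lam : ℝ) (z : Euc n) (J : List (Fin n)) (x : Euc n) : ℂ :=
  (J.map fun j => linFactor lam z j x).prod

/-- The imaginary unit makes an affine function of x into a nowhere vanishing weight. Being affine,
it has a commutator with a multiplier consisting of a single derivative of that multiplier. -/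
lemma normSq_linFactor (lam : ℝ) (z : Euc n) (j : Fin n) (x : Euc n) :
    ‖linFactor lam z j x‖ ^ 2 = 1 + (lam * (x j - z j)) ^ 2 := by
  rw [linFactor, ← Complex.normSq_eq_norm_sq, Complex.normSq_apply]
  simp
  ring

lemma one_le_norm_linFactor (lam : ℝ) (z : Euc n) (j : Fin n) (x : Euc n) :
    1 ≤ ‖linFactor lam z j x‖ := by
  have := normSq_linFactor lam z j x
  nlinarith [sq_nonneg (lam * (x j - z j)), norm_nonneg (linFactor lam z j x)]

lemma linFactor_ne_zero (lam : ℝ) (z : Euc n) (j : Fin n) (x : Euc n) :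
    linFactor lam z j x ≠ 0 := by
  have := one_le_norm_linFactor lam z j x
  rw [← norm_pos_iff]; linarith

lemma linProd_ne_zero (lam : ℝ) (z : Euc n) (J : List (Fin n)) (x : Euc n) :
    linProd lam z J x ≠ 0 := by
  rw [linProd, Ne, List.prod_eq_zero_iff]
  intro h
  obtain ⟨j, -, hj⟩ := List.mem_map.1 h
  exact linFactor_ne_zero lam z j x hj

lemma linProd_cons (lam : ℝ) (z : Euc n) (j : Fin n) (J : List (Fin n)) (x : Euc n) :
    linProd lam z (j :: J) x = linFactor lam z j x * linProd lam z J x := by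
  simp [linProd]

lemma hasTemperateGrowth_coord (j : Fin n) :
    (fun x : Euc n => x j).HasTemperateGrowth :=
  (EuclideanSpace.proj (𝕜 := ℝ) j : Euc n →L[ℝ] ℝ).hasTemperateGrowth

lemma hasTemperateGrowth_coord_ofReal (j : Fin n) :
    (fun x : Euc n => ((x j : ℝ) : ℂ)).HasTemperateGrowth :=
  Function.HasTemperateGrowth.comp Function.Complex.hasTemperateGrowth_ofReal (hasTemperateGrowth_coord j)

lemma hasTemperateGrowth_linFactor (lam : ℝ) (z : Euc n) (j : Fin n) :
    (linFactor lam z j).HasTemperateGrowth := by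
  have h : (fun x : Euc n => lam * (x j - z j)).HasTemperateGrowth :=
    (Function.HasTemperateGrowth.const lam).mul
      ((hasTemperateGrowth_coord j).sub (Function.HasTemperateGrowth.const (z j)))
  exact (Function.HasTemperateGrowth.const 1).add ((Function.HasTemperateGrowth.const Complex.I).mul
    (Function.HasTemperateGrowth.comp Function.Complex.hasTemperateGrowth_ofReal h))

lemma hasTemperateGrowth_linFactor_inv (lam : ℝ) (z : Euc n) (j : Fin n) :
    (fun x => (linFactor lam z j x)⁻¹).HasTemperateGrowth := by
  have h : (fun x : Euc n => lam * (x j - z j)).HasTemperateGrowth :=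
    (Function.HasTemperateGrowth.const lam).mul
      ((hasTemperateGrowth_coord j).sub (Function.HasTemperateGrowth.const (z j)))
  have h1 := (Function.HasTemperateGrowth.const (1 : ℂ)).sub
    ((Function.HasTemperateGrowth.const Complex.I).mul (Function.HasTemperateGrowth.comp Function.Complex.hasTemperateGrowth_ofReal h))
  have h2 := Function.HasTemperateGrowth.comp Function.Complex.hasTemperateGrowth_ofReal
    ((Function.hasTemperateGrowth_one_add_norm_sq_rpow ℝ (-1)).comp h)
  suffices e : (fun x => (linFactor lam z j x)⁻¹) =
      ((fun _ => (1 : ℂ)) - (fun _ => Complex.I) * Complex.ofReal ∘ fun x : Euc n =>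
        lam * (x j - z j)) * (Complex.ofReal ∘ (fun t : ℝ => (1 + ‖t‖ ^ 2) ^ (-1 : ℝ)) ∘
          fun x : Euc n => lam * (x j - z j)) by
    rw [e]; exact h1.mul h2
  funext x
  have hn := normSq_linFactor lam z j x
  rw [Complex.inv_def, Complex.normSq_eq_norm_sq, hn]
  simp [linFactor, Real.rpow_neg_one]
  left; ring

lemma hasTemperateGrowth_linProd (lam : ℝ) (z : Euc n) (J : List (Fin n)) :
    (linProd lam z J).HasTemperateGrowth := by
  induction J with
  | nil => exact Function.HasTemperateGrowth.const 1
  | cons j J ih =>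
    rw [funext (linProd_cons lam z j J)]
    exact (hasTemperateGrowth_linFactor lam z j).mul ih

lemma hasTemperateGrowth_linProd_inv (lam : ℝ) (z : Euc n) (J : List (Fin n)) :
    (fun x => (linProd lam z J x)⁻¹).HasTemperateGrowth := by
  induction J with
  | nil => simp [linProd, Function.HasTemperateGrowth.const]
  | cons j J ih =>
    simp only [linProd_cons, mul_inv]
    exact (hasTemperateGrowth_linFactor_inv lam z j).mul ih

lemma hasTemperateGrowth_of_compact {M : Euc n → ℂ} (hM : ContDiff ℝ ∞ M)
    (hMc : HasCompactSupport M) : M.HasTemperateGrowth := hMc.hasTemperateGrowth hM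

lemma hasCompactSupport_dirDeriv {M : Euc n → ℂ} (hMc : HasCompactSupport M) (j : Fin n) :
    HasCompactSupport (dirDeriv basisVec j M) :=
  hMc.of_isClosed_subset isClosed_closure (tsupport_dirDeriv_subset j)

lemma eLpNorm_fourierInv (f : 𝓢(Euc n, ℂ)) :
    eLpNorm (𝓕⁻ f : 𝓢(Euc n, ℂ)) 2 volume = eLpNorm f 2 volume := by
  have h := norm_fourier_toL2_eq (𝓕⁻ f)
  rw [FourierTransform.fourier_fourierInv_eq] at h
  rw [SchwartzMap.norm_toLp, SchwartzMap.norm_toLp] at h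
  have h1 : ∀ g : 𝓢(Euc n, ℂ), eLpNorm g 2 volume ≠ ⊤ := fun g => (g.memLp 2 volume).2.ne
  exact (ENNReal.toReal_eq_toReal_iff' (h1 _) (h1 _)).1 h.symm

lemma eLpNorm_fourier (f : 𝓢(Euc n, ℂ)) :
    eLpNorm (𝓕 f : 𝓢(Euc n, ℂ)) 2 volume = eLpNorm f 2 volume := by
  rw [← eLpNorm_fourierInv, FourierTransform.fourierInv_fourier_eq]

/-- `M(D) (x_j φ) = x_j M(D) φ + (2πi)⁻¹ (∂_j M)(D) φ`. -/
lemma fourierMultiplier_coord_mul {M : Euc n → ℂ} (hM : ContDiff ℝ ∞ M)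
    (hMc : HasCompactSupport M) (φ : 𝓢(Euc n, ℂ)) (j : Fin n) (x : Euc n) :
    fourierMultiplierCLM ℂ M (smulLeftCLM ℂ (fun x : Euc n => ((x j : ℝ) : ℂ)) φ) x =
      (x j : ℂ) * fourierMultiplierCLM ℂ M φ x +
      (2 * Real.pi * Complex.I)⁻¹ * fourierMultiplierCLM ℂ (dirDeriv basisVec j M) φ x := by
  have hMt := hasTemperateGrowth_of_compact hM hMc
  have hMt' := hasTemperateGrowth_of_compact (contDiff_dirDeriv (v := basisVec) hM j)
    (hasCompactSupport_dirDeriv hMc j)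
  have hin : ∀ y : Euc n, inner ℝ y (basisVec j) = y j := by
    intro y; simp [basisVec, EuclideanSpace.inner_single_right]
  have hint : (fun y : Euc n => (inner ℝ y (basisVec j) : ℝ)).HasTemperateGrowth := by
    simpa only [hin] using hasTemperateGrowth_coord j
  have hpi : (2 * Real.pi * Complex.I : ℂ) ≠ 0 := by simp [Real.pi_ne_zero]
  have e1 : smulLeftCLM ℂ (fun y : Euc n => (inner ℝ y (basisVec j) : ℝ)) φ =
      smulLeftCLM ℂ (fun x : Euc n => ((x j : ℝ) : ℂ)) φ := by
    ext y
    rw [smulLeftCLM_apply_apply hint, smulLeftCLM_apply_apply (hasTemperateGrowth_coord_ofReal j),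
      hin]
    simp
  have h1 : 𝓕 (smulLeftCLM ℂ (fun x : Euc n => ((x j : ℝ) : ℂ)) φ) =
      (-(2 * Real.pi * Complex.I)⁻¹) • ∂_{basisVec j} (𝓕 φ) := by
    rw [lineDerivOp_fourier_eq, e1, FourierTransform.fourier_smul, smul_smul,
      neg_mul_neg, inv_mul_cancel₀ hpi, one_smul]
  have h2 : smulLeftCLM ℂ M (∂_{basisVec j} (𝓕 φ)) =
      ∂_{basisVec j} (smulLeftCLM ℂ M (𝓕 φ)) - smulLeftCLM ℂ (dirDeriv basisVec j M) (𝓕 φ) := by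
    ext y
    simp only [sub_apply, smulLeftCLM_apply_apply hMt, smulLeftCLM_apply_apply hMt',
      lineDerivOp_apply_eq_fderiv, smul_eq_mul]
    rw [smulLeftCLM_apply hMt]
    simp only [smul_eq_mul]
    rw [fderiv_fun_mul (hM.differentiable (by simp) y) (𝓕 φ).differentiableAt]
    simp [dirDeriv]
    ring
  simp only [fourierMultiplierCLM_apply]
  rw [h1, map_smul, h2, smul_sub, sub_eq_add_neg, FourierTransform.fourierInv_add,
    FourierTransform.fourierInv_smul, fourierInv_lineDerivOp_eq]
  rw [← smul_neg, FourierTransform.fourierInv_smul, FourierTransform.fourierInv_neg]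
  simp only [add_apply, smul_apply, neg_apply, smulLeftCLM_apply_apply hint, smul_eq_mul,
    Complex.real_smul]
  simp only [hin]
  field_simp

/-- The constant and z-dependent parts commute with M(D); only λ x_j leaves a commutator. -/
lemma fourierMultiplier_linFactor_mul {M : Euc n → ℂ} (hM : ContDiff ℝ ∞ M)
    (hMc : HasCompactSupport M) (lam : ℝ) (z : Euc n) (φ : 𝓢(Euc n, ℂ)) (j : Fin n) (x : Euc n) :
    fourierMultiplierCLM ℂ M (smulLeftCLM ℂ (linFactor lam z j) φ) x =
      linFactor lam z j x * fourierMultiplierCLM ℂ M φ x +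
      ((lam / (2 * Real.pi) : ℝ) : ℂ) * fourierMultiplierCLM ℂ (dirDeriv basisVec j M) φ x := by
  have e : smulLeftCLM ℂ (linFactor lam z j) φ =
      (1 - Complex.I * ((lam * z j : ℝ) : ℂ)) • φ + (Complex.I * (lam : ℂ)) •
        smulLeftCLM ℂ (fun x : Euc n => ((x j : ℝ) : ℂ)) φ := by
    ext y
    simp only [add_apply, smul_apply, smulLeftCLM_apply_apply (hasTemperateGrowth_linFactor lam z j),
      smulLeftCLM_apply_apply (hasTemperateGrowth_coord_ofReal j), linFactor, smul_eq_mul]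
    push_cast
    ring
  have hpi : (Real.pi : ℂ) ≠ 0 := by simp [Real.pi_ne_zero]
  rw [e, map_add, map_smul, map_smul]
  simp only [add_apply, smul_apply, fourierMultiplier_coord_mul hM hMc, smul_eq_mul, linFactor]
  push_cast
  field_simp
  ring

lemma eLpNorm_fourierMultiplier_le {M : Euc n → ℂ} (hM : ContDiff ℝ ∞ M)
    (hMc : HasCompactSupport M) {A : ℝ≥0} (hA : ∀ ξ, ‖M ξ‖ ≤ A) (φ : 𝓢(Euc n, ℂ)) :
    eLpNorm (fourierMultiplierCLM ℂ M φ) 2 volume ≤ A * eLpNorm φ 2 volume := by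
  rw [fourierMultiplierCLM_apply, eLpNorm_fourierInv, ← eLpNorm_fourier φ]
  refine eLpNorm_le_nnreal_smul_eLpNorm_of_ae_le_mul (Filter.Eventually.of_forall fun ξ => ?_) 2
  rw [smulLeftCLM_apply_apply (hasTemperateGrowth_of_compact hM hMc), smul_eq_mul, nnnorm_mul]
  exact mul_le_mul_of_nonneg_right (hA ξ) (norm_nonneg _)

/-- This is the bound for M(D) conjugated by the weight. Commuting the factors out one at a time
leaves M(D) or (λ/2π)(∂_j M)(D); as ∂_j M is smaller by κ = 2π/λ, both have the same size and each
factor doubles the constant. The leftover inverse factors are at most 1 in modulus. -/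
lemma eLpNorm_weighted_fourierMultiplier_le {lam κ : ℝ} (hlam : 0 < lam) (hκ : lam * κ = 2 * Real.pi)
    (z : Euc n) (J : List (Fin n)) {M : Euc n → ℂ} (hM : ContDiff ℝ ∞ M)
    (hMc : HasCompactSupport M) {A : ℝ} (hA0 : 0 ≤ A)
    (hA : ∀ L : List (Fin n), L.length ≤ J.length →
      ∀ ξ, ‖dirDerivs basisVec L M ξ‖ ≤ A * κ ^ L.length) (h : 𝓢(Euc n, ℂ)) :
    eLpNorm (fun x => (linProd lam z J x)⁻¹ *
        fourierMultiplierCLM ℂ M (smulLeftCLM ℂ (linProd lam z J) h) x) 2 volume ≤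
      ENNReal.ofReal (2 ^ J.length * A) * eLpNorm h 2 volume := by
  have hκ0 : 0 < κ := by
    have := Real.pi_pos
    by_contra hc
    nlinarith
  induction J generalizing M A with
  | nil =>
    have e : smulLeftCLM ℂ (linProd lam z []) h = h := by
      ext x
      rw [smulLeftCLM_apply_apply (hasTemperateGrowth_linProd lam z [])]
      simp [linProd]
    rw [e]
    simp only [linProd, List.map_nil, List.prod_nil, inv_one, one_mul, List.length_nil, pow_zero]
    have := eLpNorm_fourierMultiplier_le hM hMc (A := A.toNNReal) (fun ξ => by
      simpa [hA0, dirDerivs_nil] using hA [] (by simp) ξ) h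
    exact this
  | cons j J ih =>
    set φ := smulLeftCLM ℂ (linProd lam z J) h
    have e : smulLeftCLM ℂ (linProd lam z (j :: J)) h = smulLeftCLM ℂ (linFactor lam z j) φ := by
      ext x
      rw [smulLeftCLM_apply_apply (hasTemperateGrowth_linProd lam z _),
        smulLeftCLM_apply_apply (hasTemperateGrowth_linFactor lam z j),
        smulLeftCLM_apply_apply (hasTemperateGrowth_linProd lam z _), linProd_cons]
      simp [mul_assoc]
    have h1 := ih hM hMc hA0 fun L hL ξ => hA L (hL.trans (by simp)) ξ
    have h2 := ih (contDiff_dirDeriv (v := basisVec) hM j) (hasCompactSupport_dirDeriv hMc j)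
      (A := A * κ) (by positivity) fun L hL ξ => by
        have := hA (j :: L) (by simpa using hL) ξ
        rw [dirDerivs_cons, List.length_cons] at this
        exact this.trans_eq (by ring)
    set u := fun x => (linProd lam z J x)⁻¹ * fourierMultiplierCLM ℂ M φ x with hu
    set w := fun x => (linProd lam z J x)⁻¹ *
      fourierMultiplierCLM ℂ (dirDeriv basisVec j M) φ x with hw
    have hmeas : ∀ ψ : 𝓢(Euc n, ℂ), Continuous fun x => (linProd lam z J x)⁻¹ * ψ x := fun ψ =>
      (hasTemperateGrowth_linProd_inv lam z J).1.continuous.mul ψ.continuous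
    have hid : (fun x => (linProd lam z (j :: J) x)⁻¹ *
        fourierMultiplierCLM ℂ M (smulLeftCLM ℂ (linProd lam z (j :: J)) h) x) =
        u + fun x => ((linFactor lam z j x)⁻¹ * ((lam / (2 * Real.pi) : ℝ) : ℂ)) * w x := by
      funext x
      have := linFactor_ne_zero lam z j x
      rw [e, fourierMultiplier_linFactor_mul hM hMc, linProd_cons]
      simp only [Pi.add_apply, hu, hw]
      field_simp
    have hc : Continuous fun x => ((linFactor lam z j x)⁻¹ * ((lam / (2 * Real.pi) : ℝ) : ℂ)) * w x :=
      ((hasTemperateGrowth_linFactor_inv lam z j).1.continuous.mul continuous_const).mul (hmeas _)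
    rw [hid]
    refine (eLpNorm_add_le (hmeas _).aestronglyMeasurable hc.aestronglyMeasurable (by norm_num)).trans
      ?_
    have h3 : eLpNorm (fun x => ((linFactor lam z j x)⁻¹ * ((lam / (2 * Real.pi) : ℝ) : ℂ)) * w x) 2
        volume ≤ ENNReal.ofReal (lam / (2 * Real.pi)) * eLpNorm w 2 volume := by
      refine eLpNorm_le_nnreal_smul_eLpNorm_of_ae_le_mul (c := (lam / (2 * Real.pi)).toNNReal)
        (Filter.Eventually.of_forall fun x => ?_) 2
      rw [nnnorm_mul]
      refine mul_le_mul_left ?_ _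
      have hl : 0 ≤ lam / (2 * Real.pi) := by positivity
      rw [← NNReal.coe_le_coe, coe_nnnorm, norm_mul, Complex.norm_real, Real.coe_toNNReal _ hl,
        Real.norm_of_nonneg hl, norm_inv]
      exact mul_le_of_le_one_left hl (inv_le_one_of_one_le₀ (one_le_norm_linFactor lam z j x))
    calc eLpNorm u 2 volume + _
        ≤ ENNReal.ofReal (2 ^ J.length * A) * eLpNorm h 2 volume +
          ENNReal.ofReal (lam / (2 * Real.pi)) *
            (ENNReal.ofReal (2 ^ J.length * (A * κ)) * eLpNorm h 2 volume) :=
          add_le_add h1 (h3.trans (mul_le_mul_right h2 _))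
      _ = ENNReal.ofReal (2 ^ (j :: J).length * A) * eLpNorm h 2 volume := by
          rw [← mul_assoc, ← ENNReal.ofReal_mul (by positivity), ← add_mul,
            ← ENNReal.ofReal_add (by positivity) (by positivity)]
          congr 2
          rw [List.length_cons, pow_succ]
          -- The scale of the weight matches the scale of M exactly, so the commutator term is as
          -- large as the main one.
          have : lam / (2 * Real.pi) * κ = 1 := by
            rw [div_mul_eq_mul_div, hκ, div_self (by positivity)]
          linear_combination (2 ^ J.length * A) * this

/-- Dilation of a Schwartz function by `2π`. -/
noncomputable def dilate (F : 𝓢(Euc n, ℂ)) : 𝓢(Euc n, ℂ) :=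
  compCLMOfContinuousLinearEquiv ℂ
    (ContinuousLinearEquiv.smulLeft (Units.mk0 (2 * Real.pi) (by positivity))) F

lemma dilate_apply (F : 𝓢(Euc n, ℂ)) (ξ : Euc n) : dilate F ξ = F ((2 * Real.pi) • ξ) := rfl

/-- Passage between the phase x·ξ of the statement and the phase 2πx·ξ of `𝓕⁻`, by the substitution
ξ ↦ 2πξ. -/
lemma integral_expI_eq (G : Euc n → ℂ) (x : Euc n) :
    ∫ ξ, G ξ * expI x ξ =
      (((2 * Real.pi) ^ n : ℝ) : ℂ) * 𝓕⁻ (fun ξ => G ((2 * Real.pi) • ξ)) x := by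
  have h := Measure.integral_comp_smul (volume : Measure (Euc n)) (fun ξ => G ξ * expI x ξ)
    (2 * Real.pi)
  rw [Real.fourierInv_eq']
  have e : ∀ v : Euc n, Complex.exp (((2 * Real.pi * inner ℝ v x : ℝ) : ℂ) * Complex.I) •
      G ((2 * Real.pi) • v) = G ((2 * Real.pi) • v) * expI x ((2 * Real.pi) • v) := by
    intro v
    rw [expI, smul_eq_mul, mul_comm, inner_smul_right, real_inner_comm, mul_comm Complex.I]
  simp only [e]
  rw [h, abs_of_pos (by positivity), finrank_euclideanSpace_fin, Complex.real_smul, ← mul_assoc,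
    ← Complex.ofReal_mul, mul_inv_cancel₀ (by positivity), Complex.ofReal_one, one_mul]

/-- The weighted `L²` bound for Fourier multipliers. -/
lemma eLpNorm_weighted_multiplier_le {lam : ℝ} (hlam : 0 < lam) (z : Euc n) (J : List (Fin n))
    {m : Euc n → ℂ} (hm : ContDiff ℝ ∞ m) (hmc : HasCompactSupport m) {A : ℝ} (hA0 : 0 ≤ A)
    (hA : ∀ L : List (Fin n), L.length ≤ J.length →
      ∀ ξ, ‖dirDerivs basisVec L m ξ‖ ≤ A * lam⁻¹ ^ L.length) (F : 𝓢(Euc n, ℂ)) :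
    eLpNorm (fun x => (linProd lam z J x)⁻¹ * ∫ ξ, m ξ * F ξ * expI x ξ) 2 volume ≤
      ENNReal.ofReal (2 ^ J.length * A) *
        eLpNorm (fun x => (linProd lam z J x)⁻¹ * ∫ ξ, F ξ * expI x ξ) 2 volume := by
  set S : Euc n →L[ℝ] Euc n := (2 * Real.pi) • ContinuousLinearMap.id ℝ (Euc n)
  set M : Euc n → ℂ := fun ξ => m (S ξ)
  set f := 𝓕⁻ (dilate F)
  have hS : ∀ ξ, S ξ = (2 * Real.pi) • ξ := fun ξ => rfl
  have hpi := Real.pi_pos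
  have hM : ContDiff ℝ ∞ M := hm.comp S.contDiff
  have hMc : HasCompactSupport M :=
    hmc.comp_homeomorph (Homeomorph.smulOfNeZero (2 * Real.pi) (by positivity))
  have hder : ∀ (L : List (Fin n)) {g : Euc n → ℂ}, ContDiff ℝ ∞ g → ∀ ξ,
      dirDerivs basisVec L (fun ξ => g (S ξ)) ξ =
        (((2 * Real.pi) ^ L.length : ℝ) : ℂ) * dirDerivs basisVec L g (S ξ) := by
    intro L
    induction L with
    | nil => intro g hg ξ; simp [dirDerivs_nil]
    | cons i L ih =>
      intro g hg ξ
      have h1 : dirDeriv basisVec i (fun ξ => g (S ξ)) =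
          fun ξ => ((2 * Real.pi : ℝ) : ℂ) * dirDeriv basisVec i g (S ξ) := by
        funext ξ
        have := congrFun (dirDerivs_comp_linear (v := basisVec) S hg [i]) ξ
        simp only [dirDerivs_cons, dirDerivs_nil] at this
        rw [this]
        simp [dirDeriv, hS]
      rw [dirDerivs_cons, h1, dirDerivs_const_mul (f := fun ξ => dirDeriv basisVec i g (S ξ))
        ((contDiff_dirDeriv hg i).comp S.contDiff)]
      simp only
      rw [ih (contDiff_dirDeriv hg i), dirDerivs_cons, List.length_cons]
      push_cast
      ring
  have hbd : ∀ L : List (Fin n), L.length ≤ J.length →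
      ∀ ξ, ‖dirDerivs basisVec L M ξ‖ ≤ A * (2 * Real.pi * lam⁻¹) ^ L.length := by
    intro L hL ξ
    rw [hder L hm ξ, norm_mul, Complex.norm_real, Real.norm_of_nonneg (by positivity), mul_pow (2 * Real.pi)]
    calc _ ≤ (2 * Real.pi) ^ L.length * (A * lam⁻¹ ^ L.length) :=
          mul_le_mul_of_nonneg_left (hA L hL (S ξ)) (by positivity)
      _ = _ := by ring
  have hMt := hasTemperateGrowth_of_compact hM hMc
  set h := smulLeftCLM ℂ (fun x => (linProd lam z J x)⁻¹) f
  -- Dividing f by the weight turns the weighted estimate for f into the conjugated estimate for h.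
  have hh : smulLeftCLM ℂ (linProd lam z J) h = f := by
    ext x
    rw [smulLeftCLM_apply_apply (hasTemperateGrowth_linProd lam z J),
      smulLeftCLM_apply_apply (hasTemperateGrowth_linProd_inv lam z J), smul_smul,
      mul_inv_cancel₀ (linProd_ne_zero lam z J x), one_smul]
  -- Dilating the multiplier by 2π multiplies each of its derivatives by 2π, hence this κ.
  have key := eLpNorm_weighted_fourierMultiplier_le hlam (κ := 2 * Real.pi * lam⁻¹)
    (by field_simp) z J hM hMc hA0 hbd h
  rw [hh] at key
  set c : ℂ := (((2 * Real.pi) ^ n : ℝ) : ℂ)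
  have e1 : (fun x => (linProd lam z J x)⁻¹ * ∫ ξ, m ξ * F ξ * expI x ξ) =
      c • fun x => (linProd lam z J x)⁻¹ * fourierMultiplierCLM ℂ M f x := by
    funext x
    rw [integral_expI_eq, fourierMultiplierCLM_apply, FourierTransform.fourier_fourierInv_eq,
      fourierInv_coe, smulLeftCLM_apply hMt]
    simp only [Pi.smul_apply, smul_eq_mul, dilate_apply, M, hS, c]
    ring
  have e2 : (fun x => (linProd lam z J x)⁻¹ * ∫ ξ, F ξ * expI x ξ) = c • (h : Euc n → ℂ) := by
    funext x
    rw [integral_expI_eq, Pi.smul_apply,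
      smulLeftCLM_apply_apply (hasTemperateGrowth_linProd_inv lam z J)]
    have : f x = 𝓕⁻ (fun ξ => F ((2 * Real.pi) • ξ)) x := by
      simp only [f, fourierInv_coe]
      rfl
    rw [this]
    simp only [smul_eq_mul, c]
    ring
  rw [e1, e2, eLpNorm_const_smul, eLpNorm_const_smul, mul_left_comm]
  exact mul_le_mul_right key _

end WeightedMultiplier

end BilinearPDO

namespace BilinearPDO

/-! ### Functions as exponential averages of their derivatives -/

section ExponentialAverages

open Filter Topology

/-- The exponential distribution on the half line. -/
noncomputable def expMeas : Measure ℝ :=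
  (volume.restrict (Set.Ioi 0)).withDensity fun t => ENNReal.ofReal (Real.exp (-t))

lemma measurable_expDensity : Measurable fun t : ℝ => ENNReal.ofReal (Real.exp (-t)) := by
  fun_prop

instance : IsProbabilityMeasure expMeas := by
  refine ⟨?_⟩
  rw [expMeas, withDensity_apply _ MeasurableSet.univ, Measure.restrict_univ,
    ← ofReal_integral_eq_lintegral_ofReal]
  · rw [integral_exp_neg_Ioi]; simp
  · exact integrableOn_exp_neg_Ioi 0
  · exact Eventually.of_forall fun t => (Real.exp_pos _).le

lemma integral_expMeas (φ : ℝ → ℂ) :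
    ∫ t, φ t ∂expMeas = ∫ t in Set.Ioi 0, (Real.exp (-t) : ℂ) * φ t := by
  rw [expMeas, integral_withDensity_eq_integral_toReal_smul measurable_expDensity
    (Eventually.of_forall fun _ => ENNReal.ofReal_lt_top)]
  refine integral_congr_ae (Eventually.of_forall fun t => ?_)
  simp only
  rw [ENNReal.toReal_ofReal (Real.exp_pos _).le, Complex.real_smul]

/-- For t ≥ 0 one has e^t ≥ 1 + t + t²/2, so e^(-t) ≤ 2/(1 + t²). The one-sided law is thus
dominated by a two-sided weight of the form |1 + it|⁻², to which the weighted multiplier bound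
applies. -/
lemma lintegral_expMeas_le {φ : ℝ → ℝ≥0∞} (hφ : Measurable φ) :
    ∫⁻ t, φ t ∂expMeas ≤ ∫⁻ t, φ t * (2 * ENNReal.ofReal ((1 + t ^ 2)⁻¹)) := by
  rw [expMeas, lintegral_withDensity_eq_lintegral_mul _ measurable_expDensity hφ]
  refine (lintegral_mono_ae ?_).trans (setLIntegral_le_lintegral (Set.Ioi 0) _)
  filter_upwards [ae_restrict_mem measurableSet_Ioi] with t ht
  rw [Pi.mul_apply, mul_comm]
  refine mul_le_mul_right ?_ _
  have h2 : (2 : ℝ≥0∞) = ENNReal.ofReal 2 := by simp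
  rw [h2, ← ENNReal.ofReal_mul (by norm_num)]
  refine ENNReal.ofReal_le_ofReal ?_
  have ht : 0 < t := ht
  have h := Real.quadratic_le_exp_of_nonneg ht.le
  rw [Real.exp_neg, ← div_eq_mul_inv, inv_eq_one_div, div_le_div_iff₀ (Real.exp_pos _) (by positivity)]
  nlinarith

/-- The integrand e^(-t) (φ - φ') is the derivative of -e^(-t) φ, which vanishes at infinity because
φ is bounded. -/
lemma eq_integral_expMeas {φ φ' : ℝ → ℂ} (hφ : ∀ t, HasDerivAt φ (φ' t) t) (hφ' : Continuous φ')
    {B : ℝ} (hB : ∀ t, ‖φ t‖ ≤ B) (hB' : ∀ t, ‖φ' t‖ ≤ B) :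
    φ 0 = ∫ t, (φ t - φ' t) ∂expMeas := by
  have hc : Continuous φ := continuous_iff_continuousAt.2 fun t => (hφ t).continuousAt
  have hd : ∀ t : ℝ, HasDerivAt (fun t : ℝ => -((Real.exp (-t) : ℂ) * φ t))
      ((Real.exp (-t) : ℂ) * (φ t - φ' t)) t := by
    intro t
    have h1 : HasDerivAt (fun t : ℝ => (Real.exp (-t) : ℂ)) (-(Real.exp (-t) : ℂ)) t := by
      have := ((Real.hasDerivAt_exp (-t)).comp t (hasDerivAt_neg t)).ofReal_comp
      simpa using this
    refine ((h1.fun_mul (hφ t)).fun_neg).congr_deriv ?_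
    ring
  have hint : IntegrableOn (fun t : ℝ => (Real.exp (-t) : ℂ) * (φ t - φ' t)) (Set.Ioi 0) := by
    refine Integrable.mono' ((integrableOn_exp_neg_Ioi 0).mul_const (2 * B)) ?_
      (Eventually.of_forall fun t => ?_)
    · exact Continuous.aestronglyMeasurable (by fun_prop)
    · rw [norm_mul, Complex.norm_real, Real.norm_of_nonneg (Real.exp_pos _).le]
      refine mul_le_mul_of_nonneg_left ?_ (Real.exp_pos _).le
      exact (norm_sub_le _ _).trans (by linarith [hB t, hB' t])
  have hlim : Tendsto (fun t : ℝ => -((Real.exp (-t) : ℂ) * φ t)) atTop (𝓝 0) := by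
    rw [← neg_zero]
    refine Tendsto.neg (squeeze_zero_norm (a := fun t => Real.exp (-t) * B) (fun t => ?_) ?_)
    · rw [norm_mul, Complex.norm_real, Real.norm_of_nonneg (Real.exp_pos _).le]
      exact mul_le_mul_of_nonneg_left (hB t) (Real.exp_pos _).le
    · simpa using (Real.tendsto_exp_neg_atTop_nhds_zero).mul_const B
  rw [integral_expMeas, integral_Ioi_of_hasDerivAt_of_tendsto' (fun t _ => hd t) hint hlim]
  simp

variable {n : ℕ}

/-- The product of exponential distributions in all coordinates. -/
noncomputable def expPi (n : ℕ) : Measure (Fin n → ℝ) := Measure.pi fun _ => expMeas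

instance : IsProbabilityMeasure (expPi n) := by unfold expPi; infer_instance

lemma measurable_update_pair (j : Fin n) :
    Measurable fun p : (Fin n → ℝ) × ℝ => Function.update p.1 j p.2 := by
  refine measurable_pi_iff.2 fun i => ?_
  by_cases h : i = j
  · subst h; simpa using measurable_snd
  · simp only [Function.update_of_ne h]
    exact (measurable_pi_apply i).comp measurable_fst

/-- Replacing one coordinate of an independent family by a fresh copy with the same law does not
change the joint law. It merges the average over one new coordinate with the average over the
others. -/
lemma map_update_expPi (j : Fin n) :
    ((expPi n).prod expMeas).map (fun p => Function.update p.1 j p.2) = expPi n := by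
  symm
  refine Measure.pi_eq fun s hs => ?_
  rw [Measure.map_apply (measurable_update_pair j) (MeasurableSet.univ_pi hs)]
  have : (fun p : (Fin n → ℝ) × ℝ => Function.update p.1 j p.2) ⁻¹' Set.univ.pi s =
      (Set.univ.pi (Function.update s j Set.univ)) ×ˢ s j := by
    ext ⟨t, u⟩
    simp only [Set.mem_preimage, Set.mem_univ_pi, Set.mem_prod]
    constructor
    · intro h
      refine ⟨fun i => ?_, by simpa using h j⟩
      by_cases hi : i = j
      · subst hi; simp
      · simpa [Function.update_of_ne hi] using h i
    · rintro ⟨h1, h2⟩ i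
      by_cases hi : i = j
      · subst hi; simpa using h2
      · simpa [Function.update_of_ne hi] using h1 i
  rw [this, Measure.prod_prod, expPi, Measure.pi_pi,
    ← Finset.mul_prod_erase Finset.univ _ (Finset.mem_univ j),
    ← Finset.mul_prod_erase Finset.univ (fun i => expMeas (s i)) (Finset.mem_univ j)]
  simp only [Function.update_self, measure_univ, one_mul]
  rw [mul_comm]
  congr 1
  refine Finset.prod_congr rfl fun i hi => ?_
  rw [Function.update_of_ne (Finset.ne_of_mem_erase hi)]

/-- The integrable weight `∏ (1 + t_j²)⁻¹`. -/
noncomputable def cauchyWeight (t : Fin n → ℝ) : ℝ := ∏ j, (1 + t j ^ 2)⁻¹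

lemma continuous_cauchyWeight : Continuous (cauchyWeight (n := n)) := by
  refine continuous_finsetProd _ fun j _ => Continuous.inv₀ (by fun_prop) fun t => ?_
  positivity

lemma integrable_cauchyWeight : Integrable (cauchyWeight (n := n)) :=
  Integrable.fintype_prod (f := fun _ (t : ℝ) => (1 + t ^ 2)⁻¹) fun _ => integrable_inv_one_add_sq

/-- The one-dimensional domination is applied in one coordinate at a time through marginal
integrals; each coordinate contributes a factor 2. -/
lemma lintegral_expPi_le {φ : (Fin n → ℝ) → ℝ≥0∞} (hφ : Measurable φ) :
    ∫⁻ t, φ t ∂expPi n ≤ 2 ^ n * ∫⁻ t, φ t * ENNReal.ofReal (cauchyWeight t) := by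
  set d : ℝ → ℝ≥0∞ := fun t => 2 * ENNReal.ofReal ((1 + t ^ 2)⁻¹)
  have hd : Measurable d := by fun_prop
  have key : ∀ (S : Finset (Fin n)) {φ : (Fin n → ℝ) → ℝ≥0∞}, Measurable φ → ∀ x,
      lmarginal (fun _ => expMeas) S φ x ≤
        lmarginal (fun _ => (volume : Measure ℝ)) S (fun t => φ t * ∏ i ∈ S, d (t i)) x := by
    intro S
    induction S using Finset.induction_on with
    | empty => intro φ hφ x; simp
    | insert j S hj ih =>
      intro φ hφ x
      have hm : ∀ S : Finset (Fin n), Measurable fun t : Fin n → ℝ => ∏ i ∈ S, d (t i) := fun S =>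
        Finset.measurable_prod _ fun i _ => hd.comp (measurable_pi_apply i)
      rw [lmarginal_insert' _ hφ hj, lmarginal_insert' (fun t => φ t * ∏ i ∈ insert j S, d (t i)) (hφ.mul (hm _)) hj]
      have h1 : Measurable fun x : Fin n → ℝ => ∫⁻ t, φ (Function.update x j t) ∂expMeas :=
        (hφ.comp (measurable_update_pair j)).lintegral_prod_right'
      refine (ih h1 x).trans (lmarginal_mono (fun y => ?_) x)
      simp only [Finset.prod_insert hj, Function.update_self]
      have h2 : ∀ t, ∏ i ∈ S, d (Function.update y j t i) = ∏ i ∈ S, d (y i) := fun t =>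
        Finset.prod_congr rfl fun i hi => by
          rw [Function.update_of_ne (by rintro rfl; exact hj hi)]
      have h3 : Measurable fun t => φ (Function.update y j t) :=
        hφ.comp (measurable_update y)
      calc (∫⁻ t, φ (Function.update y j t) ∂expMeas) * ∏ i ∈ S, d (y i)
          ≤ (∫⁻ t, φ (Function.update y j t) * d t) * ∏ i ∈ S, d (y i) :=
            mul_le_mul_left (lintegral_expMeas_le h3) _
        _ = ∫⁻ t, φ (Function.update y j t) * (d t * ∏ i ∈ S, d (Function.update y j t i)) := by
            rw [← lintegral_mul_const (f := fun t => φ (Function.update y j t) * d t) _ (h3.mul hd)]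
            exact lintegral_congr fun t => by rw [h2]; ring
  have := key Finset.univ hφ 0
  rw [← lintegral_eq_lmarginal_univ, ← lintegral_eq_lmarginal_univ] at this
  refine this.trans_eq ?_
  rw [← lintegral_const_mul']
  · refine lintegral_congr fun t => ?_
    simp only [d, Finset.prod_mul_distrib, Finset.prod_const, Finset.card_univ, Fintype.card_fin]
    rw [cauchyWeight, ENNReal.ofReal_prod_of_nonneg fun i _ => by positivity]
    ring
  · simp

/-! ### The operators ∏ (1 - a ∂_i) -/

section ShiftOperators

variable {ι W : Type*} [NormedAddCommGroup W] [NormedSpace ℝ W]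

/-- The operator `∏ (1 - a ∂_i)` over a list of directions. -/
noncomputable def shiftOps (v : ι → W) (a : ℝ) : List ι → (W → ℂ) → W → ℂ
  | [], f => f
  | i :: L, f => shiftOps v a L fun p => f p - a * dirDeriv v i f p

variable {v : ι → W} {f : W → ℂ} {a : ℝ}

lemma contDiff_sub_dirDeriv (hf : ContDiff ℝ ∞ f) (i : ι) :
    ContDiff ℝ ∞ fun p => f p - a * dirDeriv v i f p :=
  hf.sub (contDiff_const.mul (contDiff_dirDeriv hf i))

lemma contDiff_shiftOps (hf : ContDiff ℝ ∞ f) (J : List ι) : ContDiff ℝ ∞ (shiftOps v a J f) := by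
  induction J generalizing f with
  | nil => exact hf
  | cons i J ih => exact ih (contDiff_sub_dirDeriv hf i)

lemma dirDerivs_sub_dirDeriv (hf : ContDiff ℝ ∞ f) (i : ι) (L : List ι) :
    dirDerivs v L (fun p => f p - a * dirDeriv v i f p) =
      fun p => dirDerivs v L f p - a * dirDerivs v (i :: L) f p := by
  have e : (fun p => f p - a * dirDeriv v i f p) =
      fun p => f p + (-(a : ℂ)) * dirDeriv v i f p := by funext p; ring
  rw [e, dirDerivs_add hf (contDiff_const.mul (contDiff_dirDeriv hf i)),
    dirDerivs_const_mul (contDiff_dirDeriv hf i)]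
  funext p
  rw [dirDerivs_cons]
  ring

lemma tsupport_shiftOps_subset (hf : ContDiff ℝ ∞ f) (J : List ι) :
    tsupport (shiftOps v a J f) ⊆ tsupport f := by
  induction J generalizing f with
  | nil => exact subset_rfl
  | cons i J ih =>
    refine (ih (contDiff_sub_dirDeriv hf i)).trans
      (closure_minimal (fun p hp => ?_) isClosed_closure)
    by_contra h
    apply hp
    have h2 : dirDeriv v i f p = 0 :=
      image_eq_zero_of_notMem_tsupport fun h' => h (tsupport_dirDeriv_subset i h')
    simp only [h2, image_eq_zero_of_notMem_tsupport h]
    simp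

/-- The analogue of `dirDerivs_slice`: the shift operators may be computed with the remaining
variables frozen. -/
lemma shiftOps_slice {W' ι' : Type*} [NormedAddCommGroup W'] [NormedSpace ℝ W']
    (T : W →L[ℝ] W') (c : W') {v' : ι' → W'} (φ : ι → ι') (hφ : ∀ i, T (v i) = v' (φ i))
    {f : W' → ℂ} (hf : ContDiff ℝ ∞ f) (L : List ι) :
    shiftOps v a L (fun p => f (c + T p)) = fun p => shiftOps v' a (L.map φ) f (c + T p) := by
  induction L generalizing f with
  | nil => rfl
  | cons i L ih =>
    have := dirDerivs_slice T c φ hφ hf [i]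
    simp only [dirDerivs_cons, dirDerivs_nil, List.map_cons, List.map_nil] at this
    change shiftOps v a L (fun p => f (c + T p) - a * dirDeriv v i (fun p => f (c + T p)) p) = _
    rw [this]
    exact ih (f := fun q => f q - a * dirDeriv v' (φ i) f q) (contDiff_sub_dirDeriv hf _)

lemma bounded_sub_dirDeriv {N : ℕ} {B : ℝ} (ha : 0 ≤ a) (hf : ContDiff ℝ ∞ f)
    (hB : ∀ L : List ι, L.length ≤ N + 1 → ∀ p, ‖dirDerivs v L f p‖ ≤ B) (i : ι) (L : List ι)
    (hL : L.length ≤ N) (p : W) :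
    ‖dirDerivs v L (fun p => f p - a * dirDeriv v i f p) p‖ ≤ (1 + a) * B := by
  rw [dirDerivs_sub_dirDeriv hf]
  refine (norm_sub_le _ _).trans ?_
  rw [norm_mul, Complex.norm_real, Real.norm_of_nonneg ha]
  have h1 := hB L (by omega) p
  have h2 := mul_le_mul_of_nonneg_left (hB (i :: L) (by simpa using hL) p) ha
  linarith

lemma eq_integral_shift {B : ℝ} (hf : ContDiff ℝ ∞ f) (i : ι)
    (hB : ∀ p, ‖f p‖ ≤ B) (hB' : ∀ p, ‖(a : ℂ) * dirDeriv v i f p‖ ≤ B) (p : W) :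
    f p = ∫ s, (f (p + (a * s) • v i) - a * dirDeriv v i f (p + (a * s) • v i)) ∂expMeas := by
  have h1 : ∀ s : ℝ, HasDerivAt (fun s : ℝ => f (p + (a * s) • v i))
      (a * dirDeriv v i f (p + (a * s) • v i)) s := by
    intro s
    have h := hasDerivAt_line hf p (a • v i) s
    simp only [smul_smul, map_smul, Complex.real_smul] at h
    simp only [mul_comm a]
    exact h
  have h2 : Continuous fun s : ℝ => (a : ℂ) * dirDeriv v i f (p + (a * s) • v i) :=
    continuous_const.mul ((contDiff_dirDeriv hf i).continuous.comp (by fun_prop))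
  have := eq_integral_expMeas h1 h2 (fun s => hB _) (fun s => hB' _)
  simpa using this

/-- A bounded function is the average of its image under `∏ (1 - a ∂_i)` along the directions of
the list. -/
lemma eq_integral_shiftOps {v : Fin n → W} (ha : 0 ≤ a) (hf : ContDiff ℝ ∞ f) (J : List (Fin n))
    (hJ : J.Nodup) {B : ℝ}
    (hB : ∀ L : List (Fin n), L.length ≤ J.length → ∀ p, ‖dirDerivs v L f p‖ ≤ B) (p : W) :
    f p = ∫ t, shiftOps v a J f (p + (J.map fun i => (a * t i) • v i).sum) ∂expPi n := by
  induction J generalizing f B p with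
  | nil => simp [shiftOps]
  | cons j J ih =>
    have hB0 : 0 ≤ B := (norm_nonneg _).trans (hB [] (by simp) 0)
    have hf1 := contDiff_sub_dirDeriv (v := v) (a := a) hf j
    obtain ⟨hj, hJ⟩ := List.nodup_cons.1 hJ
    set F := shiftOps v a (j :: J) f with hF
    have hFc : Continuous F := (contDiff_shiftOps hf _).continuous
    have hFb : ∃ D, ∀ q, ‖F q‖ ≤ D := by
      have : ∀ (J : List (Fin n)) {f : W → ℂ} {B : ℝ}, ContDiff ℝ ∞ f →
          (∀ L : List (Fin n), L.length ≤ J.length → ∀ p, ‖dirDerivs v L f p‖ ≤ B) →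
          ∃ D, ∀ q, ‖shiftOps v a J f q‖ ≤ D := by
        intro J
        induction J with
        | nil => intro f B _ h; exact ⟨B, h [] (by simp)⟩
        | cons i J ih =>
          intro f B hf h
          exact ih (contDiff_sub_dirDeriv hf i) fun L hL => bounded_sub_dirDeriv ha hf h i L hL
      exact this (j :: J) hf hB
    obtain ⟨D, hD⟩ := hFb
    have h1 : ∀ q, f q - a * dirDeriv v j f q =
        ∫ t, F (q + (J.map fun i => (a * t i) • v i).sum) ∂expPi n := fun q =>
      ih hf1 hJ (fun L hL => bounded_sub_dirDeriv ha hf hB j L hL) q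
    have hb0 : ∀ q, ‖f q‖ ≤ (1 + a) * B := fun q =>
      (hB [] (by simp) q).trans (by nlinarith)
    have hb1 : ∀ q, ‖(a : ℂ) * dirDeriv v j f q‖ ≤ (1 + a) * B := by
      intro q
      rw [norm_mul, Complex.norm_real, Real.norm_of_nonneg ha]
      have := mul_le_mul_of_nonneg_left (hB [j] (by simp) q) ha
      rw [dirDerivs_cons, dirDerivs_nil] at this
      linarith
    rw [eq_integral_shift hf j hb0 hb1 p]
    simp only [h1]
    -- Since j does not occur in J, the coordinate t_j is idle and can carry the new variable s.
    have hlin : ∀ (t : Fin n → ℝ) (s : ℝ), p + (a * s) • v j + (J.map fun i => (a * t i) • v i).sum =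
        p + ((j :: J).map fun i => (a * Function.update t j s i) • v i).sum := by
      intro t s
      rw [List.map_cons, List.sum_cons, Function.update_self, add_assoc]
      congr 3
      refine List.map_congr_left fun i hi => ?_
      rw [Function.update_of_ne (by rintro rfl; exact hj hi)]
    have hcont : Continuous fun t : Fin n → ℝ =>
        F (p + ((j :: J).map fun i => (a * t i) • v i).sum) := by
      refine hFc.comp (continuous_const.add (continuous_list_sum _ fun i _ => ?_))
      fun_prop
    have hint : Integrable (fun q : (Fin n → ℝ) × ℝ =>
        F (p + ((j :: J).map fun i => (a * Function.update q.1 j q.2 i) • v i).sum))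
        ((expPi n).prod expMeas) := by
      refine (integrable_const D).mono' ?_ (Eventually.of_forall fun q => hD _)
      exact (hcont.measurable.comp (measurable_update_pair j)).aestronglyMeasurable
    simp only [hlin]
    rw [← integral_prod_symm _ hint]
    conv_rhs => rw [← map_update_expPi j]
    rw [integral_map (measurable_update_pair j).aemeasurable hcont.aestronglyMeasurable]

end ShiftOperators

/-! ### Decay of oscillatory integrals -/

section FourierDecay

/-- Integration by parts in an oscillatory integral. -/
lemma linProd_mul_integral_expI {f : Euc n → ℂ} (hf : ContDiff ℝ ∞ f) (J : List (Fin n))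
    (hint : ∀ L : List (Fin n), L.length ≤ J.length → Integrable (dirDerivs basisVec L f))
    (w : Euc n) :
    linProd 1 0 J w * ∫ η, f η * expI w η = ∫ η, shiftOps basisVec 1 J f η * expI w η := by
  induction J generalizing f with
  | nil => simp [linProd, shiftOps]
  | cons j J ih =>
    have hE : ∀ w : Euc n, ContDiff ℝ ∞ (expI w) := fun w => by
      unfold expI
      exact Complex.contDiff_exp.comp (contDiff_const.mul
        (Complex.ofRealCLM.contDiff.comp (contDiff_const.inner ℝ contDiff_id)))
    have hn : ∀ η, ‖expI w η‖ = 1 := fun η => by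
      rw [expI, mul_comm, Complex.norm_exp_ofReal_mul_I]
    have hd : ∀ η, fderiv ℝ (expI w) η (basisVec j) = Complex.I * (w j : ℂ) * expI w η := by
      intro η
      have h1 : HasFDerivAt (fun η : Euc n => Complex.I * ((inner ℝ w η : ℝ) : ℂ))
          (Complex.I • (Complex.ofRealCLM.comp (innerSL ℝ w))) η :=
        (Complex.ofRealCLM.hasFDerivAt.comp η (innerSL ℝ w).hasFDerivAt).const_mul Complex.I
      have h2 := h1.cexp
      rw [show expI w = fun η => Complex.exp (Complex.I * ((inner ℝ w η : ℝ) : ℂ)) from rfl,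
        h2.fderiv]
      simp [basisVec, EuclideanSpace.inner_single_right]
      ring
    have hbd : ∀ {g : Euc n → ℂ}, Integrable g → Integrable fun η => g η * expI w η := by
      intro g hg
      refine hg.mul_bdd (c := 1) (hE w).continuous.aestronglyMeasurable
        (Eventually.of_forall fun η => (hn η).le)
    have i0 : Integrable f := hint [] (by simp)
    have i1 : Integrable (dirDeriv basisVec j f) := hint [j] (by simp)
    have hI0 := hbd i0
    have hI1 := hbd i1
    have hparts : ∫ η, f η * fderiv ℝ (expI w) η (basisVec j) =
        -∫ η, fderiv ℝ f η (basisVec j) * expI w η := by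
      refine integral_mul_fderiv_eq_neg_fderiv_mul_of_integrable hI1 ?_ hI0
        (fun η _ => hf.differentiable (by simp) η) fun η _ => (hE w).differentiable (by simp) η
      simp only [hd]
      refine (hI0.const_mul (Complex.I * (w j : ℂ))).congr (Eventually.of_forall fun η => ?_)
      simp only
      ring
    have h1 : linFactor 1 0 j w * ∫ η, f η * expI w η =
        ∫ η, (f η - ((1 : ℝ) : ℂ) * dirDeriv basisVec j f η) * expI w η := by
      have e : ∀ η, (f η - ((1 : ℝ) : ℂ) * dirDeriv basisVec j f η) * expI w η =
          f η * expI w η - dirDeriv basisVec j f η * expI w η := fun η => by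
        push_cast; ring
      simp only [e]
      rw [integral_sub hI0 hI1]
      have : ∫ η, dirDeriv basisVec j f η * expI w η =
          -(Complex.I * (w j : ℂ) * ∫ η, f η * expI w η) := by
        rw [← integral_const_mul, eq_neg_iff_add_eq_zero, ← eq_neg_iff_add_eq_zero.1 hparts.symm.symm,
          add_comm]
        congr 1
        refine integral_congr_ae (Eventually.of_forall fun η => ?_)
        simp only [hd]
        ring
      rw [this, linFactor]
      simp
      ring
    rw [linProd_cons, mul_comm (linFactor 1 0 j w), mul_assoc, h1]
    refine ih (contDiff_sub_dirDeriv hf j) fun L hL => ?_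
    rw [dirDerivs_sub_dirDeriv hf]
    exact (hint L (hL.trans (by simp))).sub ((hint (j :: L) (by simpa using hL)).const_mul _)

end FourierDecay

end ExponentialAverages

end BilinearPDO

namespace BilinearPDO

/-! ### Averaging over the freezing point -/

section FrozenCoefficients

open SchwartzMap FourierTransform
open scoped SchwartzMap

variable {n : ℕ}

lemma eLpNorm_two_sq {X E : Type*} [MeasurableSpace X] [NormedAddCommGroup E] (μ : Measure X)
    (f : X → E) : eLpNorm f 2 μ ^ 2 = ∫⁻ x, ‖f x‖ₑ ^ 2 ∂μ := by
  have := eLpNorm_nnreal_pow_eq_lintegral (f := f) (μ := μ) (p := 2) (by norm_num)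
  simpa using this

/-- Substitution x = z - t/λ. The weight is even in each coordinate, so the reflection leaves it
unchanged. -/
lemma lintegral_scaled_cauchyWeight {lam : ℝ} (hlam : 0 < lam) (z : Euc n) {φ : Euc n → ℝ≥0∞} :
    ∫⁻ t : Fin n → ℝ, φ (z - lam⁻¹ • WithLp.toLp 2 t) * ENNReal.ofReal (cauchyWeight t) =
      ENNReal.ofReal (lam ^ n) *
        ∫⁻ x, φ x * ENNReal.ofReal (cauchyWeight fun j => lam * (x j - z j)) := by
  set ψ : Euc n → ℝ≥0∞ := fun x =>
    φ x * ENNReal.ofReal (cauchyWeight fun j => lam * (x j - z j)) with hψ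
  have h1 : ∀ t : Fin n → ℝ, φ (z - lam⁻¹ • WithLp.toLp 2 t) * ENNReal.ofReal (cauchyWeight t) =
      (fun y : Euc n => ψ (z - lam⁻¹ • y)) (WithLp.toLp 2 t) := by
    intro t
    simp only [hψ]
    congr 2
    refine Finset.prod_congr rfl fun j _ => ?_
    have : lam * ((z - lam⁻¹ • WithLp.toLp 2 t : Euc n) j - z j) = - t j := by
      simp only [PiLp.sub_apply, PiLp.smul_apply, smul_eq_mul]
      field_simp
      ring
    change (1 + (t j) ^ 2)⁻¹ = (1 + (lam * ((z - lam⁻¹ • WithLp.toLp 2 t : Euc n) j - z j)) ^ 2)⁻¹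
    rw [this, neg_sq]
  simp only [h1]
  rw [(PiLp.volume_preserving_toLp (Fin n)).lintegral_comp_emb
    (MeasurableEquiv.toLp 2 (Fin n → ℝ)).measurableEmbedding (fun y : Euc n => ψ (z - lam⁻¹ • y))]
  have h2 := Measure.map_addHaar_smul (volume : Measure (Euc n)) (inv_ne_zero hlam.ne')
  have h3 : ∫⁻ y : Euc n, ψ (z - lam⁻¹ • y) =
      ∫⁻ y, ψ (z - y) ∂(Measure.map (lam⁻¹ • ·) (volume : Measure (Euc n))) := by
    exact ((Homeomorph.smulOfNeZero lam⁻¹ (inv_ne_zero hlam.ne')).measurableEmbedding.lintegral_map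
      (μ := (volume : Measure (Euc n))) fun y => ψ (z - y)).symm
  rw [h3, h2, lintegral_smul_measure, lintegral_sub_left_eq_self ψ z, smul_eq_mul]
  congr 2
  rw [finrank_euclideanSpace_fin, inv_pow, inv_inv, abs_of_pos (by positivity)]

lemma norm_linProd_inv_sq (lam : ℝ) (z x : Euc n) :
    ‖(linProd lam z (List.finRange n) x)⁻¹‖ ^ 2 = cauchyWeight fun j => lam * (x j - z j) := by
  rw [norm_inv, inv_pow, linProd, cauchyWeight, ← Fin.prod_univ_def, norm_prod,
    ← Finset.prod_pow, Finset.prod_inv_distrib]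
  simp only [normSq_linFactor]

/-- The constant in Plancherel's theorem for `F ↦ ∫ F(ξ) e^{ixξ} dξ`. -/
noncomputable def plancherelConst (n : ℕ) : ℝ≥0∞ :=
  ENNReal.ofReal ((2 * Real.pi) ^ n) *
    (ENNReal.ofReal ((2 * Real.pi) ^ n)⁻¹) ^ (1 / 2 : ℝ)

lemma plancherelConst_ne_top : plancherelConst n ≠ ⊤ := by
  refine ENNReal.mul_ne_top ENNReal.ofReal_ne_top ?_
  exact ENNReal.rpow_ne_top_of_nonneg (by norm_num) ENNReal.ofReal_ne_top

lemma plancherelConst_ne_zero : plancherelConst n ≠ 0 := by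
  have := Real.pi_pos
  refine mul_ne_zero (by simp; positivity) ?_
  rw [Ne, ENNReal.rpow_eq_zero_iff]
  have : ENNReal.ofReal ((2 * Real.pi) ^ n)⁻¹ ≠ 0 := by simp; positivity
  simp [this]

lemma eLpNorm_integral_expI (F : 𝓢(Euc n, ℂ)) :
    eLpNorm (fun x => ∫ ξ, F ξ * expI x ξ) 2 volume = plancherelConst n * eLpNorm F 2 volume := by
  have e : (fun x => ∫ ξ, F ξ * expI x ξ) =
      ((((2 * Real.pi) ^ n : ℝ) : ℂ)) • ((𝓕⁻ (dilate F) : 𝓢(Euc n, ℂ)) : Euc n → ℂ) := by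
    funext x
    rw [integral_expI_eq, Pi.smul_apply, fourierInv_coe, smul_eq_mul]
    rfl
  have hpi : (0 : ℝ) < 2 * Real.pi := by positivity
  have h2 := Measure.map_addHaar_smul (volume : Measure (Euc n)) hpi.ne'
  have hd : eLpNorm (dilate F) 2 volume =
      (ENNReal.ofReal ((2 * Real.pi) ^ n)⁻¹) ^ (1 / 2 : ℝ) * eLpNorm F 2 volume := by
    have h3 : eLpNorm (dilate F) 2 volume =
        eLpNorm F 2 (Measure.map ((2 * Real.pi) • ·) (volume : Measure (Euc n))) := by
      rw [eLpNorm_map_measure F.continuous.aestronglyMeasurable (by fun_prop)]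
      rfl
    rw [h3, h2, eLpNorm_smul_measure_of_ne_top (by norm_num), finrank_euclideanSpace_fin,
      abs_of_pos (by positivity)]
    simp
  rw [e, eLpNorm_const_smul, eLpNorm_fourierInv, hd, plancherelConst, mul_assoc]
  congr 1
  rw [enorm_eq_nnnorm, ← ENNReal.ofReal_coe_nnreal, coe_nnnorm, Complex.norm_real,
    Real.norm_of_nonneg (by positivity)]

/-- The weight is the square of |linProd|⁻¹ with each coordinate used once, so this is the weighted
multiplier bound in the variable t. The Jacobian λ^n occurs on both sides. -/
lemma lintegral_frozen_multiplier_le {lam : ℝ} (hlam : 0 < lam) (z : Euc n) {c : Euc n → ℂ}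
    (hc : ContDiff ℝ ∞ c) (hcc : HasCompactSupport c) {A : ℝ} (hA0 : 0 ≤ A)
    (hA : ∀ L : List (Fin n), L.length ≤ n →
      ∀ ξ, ‖dirDerivs basisVec L c ξ‖ ≤ A * lam⁻¹ ^ L.length) (F : 𝓢(Euc n, ℂ)) :
    ∫⁻ t : Fin n → ℝ, ‖∫ ξ, c ξ * F ξ * expI (z - lam⁻¹ • WithLp.toLp 2 t) ξ‖ₑ ^ 2 *
        ENNReal.ofReal (cauchyWeight t) ≤
      ENNReal.ofReal (2 ^ n * A) ^ 2 *
        ∫⁻ t : Fin n → ℝ, ‖∫ ξ, F ξ * expI (z - lam⁻¹ • WithLp.toLp 2 t) ξ‖ₑ ^ 2 *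
          ENNReal.ofReal (cauchyWeight t) := by
  have e1 := lintegral_scaled_cauchyWeight hlam z
    (φ := fun x => ‖∫ ξ, c ξ * F ξ * expI x ξ‖ₑ ^ 2)
  have e2 := lintegral_scaled_cauchyWeight hlam z (φ := fun x => ‖∫ ξ, F ξ * expI x ξ‖ₑ ^ 2)
  refine e1.trans_le ((mul_le_mul_right ?_ _).trans_eq
    ((mul_left_comm _ _ _).trans (congrArg _ e2.symm)))
  have hw := eLpNorm_weighted_multiplier_le hlam z (List.finRange n) hc hcc hA0
    (by simpa using hA) F
  have hw2 := pow_le_pow_left₀ zero_le hw 2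
  rw [mul_pow, eLpNorm_two_sq, eLpNorm_two_sq, List.length_finRange] at hw2
  have hconv : ∀ (x : Euc n) (y : ℂ), ‖(linProd lam z (List.finRange n) x)⁻¹ * y‖ₑ ^ 2 =
      ‖y‖ₑ ^ 2 * ENNReal.ofReal (cauchyWeight fun j => lam * (x j - z j)) := by
    intro x y
    rw [enorm_mul, mul_pow, mul_comm, ← norm_linProd_inv_sq,
      ENNReal.ofReal_pow (norm_nonneg _), ofReal_norm]
  simp only [hconv] at hw2
  exact hw2

lemma measurable_smul_toLp (c : ℝ) :
    Measurable fun t : Fin n → ℝ => (c • WithLp.toLp 2 t : Euc n) :=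
  Measurable.const_smul (MeasurableEquiv.toLp 2 (Fin n → ℝ)).measurable c

/-- Tonelli and translation invariance: for fixed t, the freezing point z = x + ct replaces x as
integration variable. -/
lemma lintegral_expPi_shear {c : ℝ} {Ψ : Euc n → Euc n → ℝ≥0∞}
    (hΨ : Measurable fun q : Euc n × Euc n => Ψ q.1 q.2) :
    ∫⁻ x, ∫⁻ t, Ψ (x + c • WithLp.toLp 2 t) x ∂expPi n =
      ∫⁻ z, ∫⁻ t, Ψ z (z - c • WithLp.toLp 2 t) ∂expPi n := by
  have ht := measurable_smul_toLp (n := n) c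
  have h1 : Measurable fun q : Euc n × (Fin n → ℝ) => (q.1 + c • WithLp.toLp 2 q.2, q.1) :=
    (measurable_fst.add (ht.comp measurable_snd)).prodMk measurable_fst
  have h2 : Measurable fun q : (Fin n → ℝ) × Euc n => (q.2, q.2 - c • WithLp.toLp 2 q.1) :=
    measurable_snd.prodMk (measurable_snd.sub (ht.comp measurable_fst))
  calc ∫⁻ x, ∫⁻ t, Ψ (x + c • WithLp.toLp 2 t) x ∂expPi n
      = ∫⁻ t, ∫⁻ x, Ψ (x + c • WithLp.toLp 2 t) x ∂volume ∂expPi n :=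
        lintegral_lintegral_swap (f := fun x t => Ψ (x + c • WithLp.toLp 2 t) x)
          (hΨ.comp h1).aemeasurable
    _ = ∫⁻ t, ∫⁻ z, Ψ z (z - c • WithLp.toLp 2 t) ∂volume ∂expPi n := by
        refine lintegral_congr fun t => ?_
        rw [← lintegral_add_right_eq_self (fun z => Ψ z (z - c • WithLp.toLp 2 t))
          (c • WithLp.toLp 2 t)]
        simp only [add_sub_cancel_right]
    _ = ∫⁻ z, ∫⁻ t, Ψ z (z - c • WithLp.toLp 2 t) ∂expPi n :=
        lintegral_lintegral_swap (f := fun t z => Ψ z (z - c • WithLp.toLp 2 t))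
          (hΨ.comp h2).aemeasurable

/-- Integrating over the centre of the weight removes the weight, up to its total mass. -/
lemma lintegral_lintegral_sub_mul {c : ℝ} {φ : Euc n → ℝ≥0∞} (hφ : Measurable φ)
    {κ : (Fin n → ℝ) → ℝ≥0∞} (hκ : Measurable κ) (hκt : ∀ t, κ t ≠ ⊤) :
    ∫⁻ z, ∫⁻ t, φ (z - c • WithLp.toLp 2 t) * κ t = (∫⁻ t, κ t) * ∫⁻ z, φ z := by
  have ht := measurable_smul_toLp (n := n) c
  have h1 : Measurable fun q : Euc n × (Fin n → ℝ) => q.1 - c • WithLp.toLp 2 q.2 :=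
    measurable_fst.sub (ht.comp measurable_snd)
  rw [lintegral_lintegral_swap (f := fun z t => φ (z - c • WithLp.toLp 2 t) * κ t)
    ((hφ.comp h1).mul (hκ.comp measurable_snd)).aemeasurable, ← lintegral_mul_const _ hκ]
  refine lintegral_congr fun t => ?_
  rw [lintegral_mul_const' _ _ (hκt t), lintegral_sub_right_eq_self φ, mul_comm]

/-- The `L²` bound for pseudodifferential operators with frozen coefficients: an average over
the freezing point. -/
lemma lintegral_frozen_le {lam : ℝ} (hlam : 0 < lam) {c : Euc n → Euc n → ℂ}
    (hc : ∀ z, ContDiff ℝ ∞ (c z)) (hcc : ∀ z, HasCompactSupport (c z)) {A : ℝ} (hA0 : 0 ≤ A)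
    (hA : ∀ z, ∀ L : List (Fin n), L.length ≤ n →
      ∀ ξ, ‖dirDerivs basisVec L (c z) ξ‖ ≤ A * lam⁻¹ ^ L.length) (F : 𝓢(Euc n, ℂ))
    (hU : Measurable fun q : Euc n × Euc n => ∫ ξ, c q.1 ξ * F ξ * expI q.2 ξ) :
    ∫⁻ x, ∫⁻ t, ‖∫ ξ, c (x + lam⁻¹ • WithLp.toLp 2 t) ξ * F ξ * expI x ξ‖ₑ ^ 2 ∂expPi n ≤
      2 ^ n * ENNReal.ofReal (2 ^ n * A) ^ 2 *
        (∫⁻ t : Fin n → ℝ, ENNReal.ofReal (cauchyWeight t)) *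
        (plancherelConst n * eLpNorm F 2 volume) ^ 2 := by
  obtain ⟨U, hUdef⟩ : ∃ U : Euc n → Euc n → ℂ, ∀ z x, ∫ ξ, c z ξ * F ξ * expI x ξ = U z x :=
    ⟨_, fun _ _ => rfl⟩
  obtain ⟨f, hf⟩ : ∃ f : Euc n → ℂ, ∀ x, ∫ ξ, F ξ * expI x ξ = f x := ⟨_, fun _ => rfl⟩
  simp only [hUdef] at hU ⊢
  have hUm : Measurable fun q : Euc n × Euc n => U q.1 q.2 := hU
  have hfm : Measurable f := by
    have e : f = ((((2 * Real.pi) ^ n : ℝ) : ℂ)) • ((𝓕⁻ (dilate F) : 𝓢(Euc n, ℂ)) : Euc n → ℂ) := by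
      funext x
      rw [← hf, integral_expI_eq, Pi.smul_apply, fourierInv_coe, smul_eq_mul]
      rfl
    rw [e]
    exact ((𝓕⁻ (dilate F) : 𝓢(Euc n, ℂ)).continuous.const_smul _).measurable
  have hfn : eLpNorm f 2 volume = plancherelConst n * eLpNorm F 2 volume := by
    rw [← eLpNorm_integral_expI, ← funext hf]
  have hκ : Measurable fun t : Fin n → ℝ => ENNReal.ofReal (cauchyWeight t) :=
    continuous_cauchyWeight.measurable.ennreal_ofReal
  have hUe : Measurable fun q : Euc n × Euc n => ‖U q.1 q.2‖ₑ ^ 2 := hUm.enorm.pow_const 2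
  have step1 : ∀ z, ∫⁻ t, ‖U z (z - lam⁻¹ • WithLp.toLp 2 t)‖ₑ ^ 2 ∂expPi n ≤
      2 ^ n * (ENNReal.ofReal (2 ^ n * A) ^ 2 *
        ∫⁻ t : Fin n → ℝ, ‖f (z - lam⁻¹ • WithLp.toLp 2 t)‖ₑ ^ 2 *
          ENNReal.ofReal (cauchyWeight t)) := by
    intro z
    have hm : Measurable fun t : Fin n → ℝ => (z, z - lam⁻¹ • WithLp.toLp 2 t) :=
      measurable_const.prodMk (measurable_const.sub (measurable_smul_toLp _))
    refine (lintegral_expPi_le (hUe.comp hm)).trans (mul_le_mul_right ?_ _)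
    have := lintegral_frozen_multiplier_le hlam z (hc z) (hcc z) hA0 (hA z) F
    simpa only [hUdef, hf, Function.comp_def] using this
  -- With z as outer variable the symbol no longer depends on the inner variable, so the inner
  -- integral concerns a genuine Fourier multiplier.
  rw [lintegral_expPi_shear (Ψ := fun z x => ‖U z x‖ₑ ^ 2) hUe]
  refine (lintegral_mono step1).trans_eq ?_
  simp only [← mul_assoc]
  rw [lintegral_const_mul' _ _ (ENNReal.mul_ne_top (by simp)
      (ENNReal.pow_ne_top ENNReal.ofReal_ne_top)),
    lintegral_lintegral_sub_mul (φ := fun z => ‖f z‖ₑ ^ 2) (hfm.enorm.pow_const 2) hκ (by simp),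
    ← eLpNorm_two_sq, hfn, mul_assoc]
  ring

end FrozenCoefficients

end BilinearPDO

namespace BilinearPDO

/-! ### Linear operators at a single scale -/

section PieceEstimate

open SchwartzMap FourierTransform
open scoped SchwartzMap

variable {n : ℕ}

/-- The factor gained by a derivative: `λ` in `x`, `λ⁻¹` in `ξ` and `1` in `η`. -/
noncomputable def dilScale (lam : ℝ) : Idx n → ℝ
  | .inl _ => lam
  | .inr (.inl _) => lam⁻¹
  | .inr (.inr _) => 1

/-- The number of derivatives in `x`. -/
def countX (L : List (Idx n)) : ℕ := L.countP Sum.isLeft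

/-- Bounds for the derivatives of order at most `N`, of which at most `X` in `x`. -/
def DilBound (lam : ℝ) (wt : Euc n → ℝ) (X N : ℕ) (A : ℝ) (a : Phase n → ℂ) : Prop :=
  ∀ L : List (Idx n), countX L ≤ X → L.length ≤ N → ∀ p,
    ‖dirDerivs axis L a p‖ ≤ A * (L.map (dilScale lam)).prod * wt p.2.2

variable {lam : ℝ} {wt : Euc n → ℝ} {X N : ℕ} {A : ℝ} {a : Phase n → ℂ}

lemma DilBound.mono (h : DilBound lam wt X N A a) {X' N' : ℕ} (hX : X' ≤ X) (hN : N' ≤ N) :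
    DilBound lam wt X' N' A a := fun L h1 h2 => h L (h1.trans hX) (h2.trans hN)

/-- The factor λ⁻¹ cancels the loss λ of an x-derivative, so both terms are equally large and the
constant doubles. -/
lemma DilBound.sub_x (hlam : 0 < lam) (ha : ContDiff ℝ ∞ a) (h : DilBound lam wt (X + 1) (N + 1) A a)
    (i : Fin n) :
    DilBound lam wt X N (2 * A) fun p => a p - (lam⁻¹ : ℝ) * dirDeriv axis (xIdx i) a p := by
  intro L hX hN p
  rw [dirDerivs_sub_dirDeriv ha]
  refine (norm_sub_le _ _).trans ?_
  have h1 := h L (by omega) (by omega) p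
  have h2 := h (xIdx i :: L) (by simpa [countX, List.countP_cons] using hX) (by simpa using hN) p
  rw [norm_mul, Complex.norm_real, Real.norm_of_nonneg (inv_pos.2 hlam).le]
  have h3 := mul_le_mul_of_nonneg_left h2 (inv_pos.2 hlam).le
  have e : lam⁻¹ * (A * ((xIdx i :: L).map (dilScale lam)).prod * wt p.2.2) =
      A * (L.map (dilScale lam)).prod * wt p.2.2 := by
    rw [List.map_cons, List.prod_cons, show dilScale lam (xIdx i) = lam from rfl]
    field_simp
  linarith

lemma DilBound.sub_η (ha : ContDiff ℝ ∞ a) (h : DilBound lam wt X (N + 1) A a) (i : Fin n) :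
    DilBound lam wt X N (2 * A) fun p => a p - (1 : ℝ) * dirDeriv axis (ηIdx i) a p := by
  intro L hX hN p
  rw [dirDerivs_sub_dirDeriv ha]
  refine (norm_sub_le _ _).trans ?_
  have h1 := h L (by omega) (by omega) p
  have h2 := h (ηIdx i :: L) (by simpa [countX, List.countP_cons] using hX) (by simpa using hN) p
  have e : A * ((ηIdx i :: L).map (dilScale lam)).prod * wt p.2.2 =
      A * (L.map (dilScale lam)).prod * wt p.2.2 := by
    rw [List.map_cons, List.prod_cons, show dilScale lam (ηIdx i) = 1 from rfl, one_mul]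
  rw [norm_mul, Complex.norm_real, norm_one, one_mul]
  linarith

lemma DilBound.shiftOps_x (hlam : 0 < lam) (ha : ContDiff ℝ ∞ a) (J : List (Fin n))
    (h : DilBound lam wt (X + J.length) (N + J.length) A a) :
    DilBound lam wt X N (2 ^ J.length * A) (shiftOps axis lam⁻¹ (J.map xIdx) a) := by
  induction J generalizing a A with
  | nil => simpa [shiftOps] using h
  | cons i J ih =>
    have := ih (contDiff_sub_dirDeriv (v := axis) (a := lam⁻¹) ha (xIdx i)) (h.sub_x hlam ha i)
    rw [List.length_cons, pow_succ, mul_assoc]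
    exact this

lemma DilBound.shiftOps_η (ha : ContDiff ℝ ∞ a) (J : List (Fin n))
    (h : DilBound lam wt X (N + J.length) A a) :
    DilBound lam wt X N (2 ^ J.length * A) (shiftOps axis 1 (J.map ηIdx) a) := by
  induction J generalizing a A with
  | nil => simpa [shiftOps] using h
  | cons i J ih =>
    have := ih (contDiff_sub_dirDeriv (v := axis) (a := 1) ha (ηIdx i)) (h.sub_η ha i)
    rw [List.length_cons, pow_succ, mul_assoc]
    exact this

lemma DilBound.norm_le (h : DilBound lam wt X N A a) (p : Phase n) : ‖a p‖ ≤ A * wt p.2.2 := by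
  simpa [dirDerivs_nil] using h [] (by simp [countX]) (by simp) p

lemma sum_map_finRange_smul (c : ℝ) (t : Fin n → ℝ) :
    ((List.finRange n).map fun i => (c * t i) • basisVec i).sum = c • (WithLp.toLp 2 t : Euc n) := by
  rw [← Fin.sum_univ_def]
  ext j
  simp [basisVec, Finset.sum_apply, Pi.single_apply]

lemma lintegral_mul_sq_le {X : Type*} [MeasurableSpace X] (μ : Measure X) {f g : X → ℝ≥0∞}
    (hf : AEMeasurable f μ) (hg : AEMeasurable g μ) :
    (∫⁻ x, f x * g x ∂μ) ^ 2 ≤ (∫⁻ x, f x ^ 2 ∂μ) * ∫⁻ x, g x ^ 2 ∂μ := by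
  have h := ENNReal.lintegral_mul_le_Lp_mul_Lq μ (p := 2) (q := 2) ⟨by norm_num, by norm_num, by norm_num⟩ hf hg
  have h2 := pow_le_pow_left₀ zero_le h 2
  have e : ∀ a : ℝ≥0∞, (a ^ (1 / 2 : ℝ)) ^ 2 = a := fun a => by
    rw [← ENNReal.rpow_natCast, ← ENNReal.rpow_mul]; simp
  rw [mul_pow, e, e] at h2
  simpa using h2

/-- Cauchy–Schwarz against the constant 1, which has norm 1 for a probability measure. -/
lemma enorm_integral_sq_le {X : Type*} [MeasurableSpace X] (μ : Measure X) [IsProbabilityMeasure μ]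
    {f : X → ℂ} (hf : AEStronglyMeasurable f μ) : ‖∫ x, f x ∂μ‖ₑ ^ 2 ≤ ∫⁻ x, ‖f x‖ₑ ^ 2 ∂μ := by
  refine (pow_le_pow_left₀ zero_le (enorm_integral_le_lintegral_enorm f) 2).trans ?_
  simpa using lintegral_mul_sq_le μ (f := fun _ => 1) aemeasurable_const hf.enorm

lemma norm_expI (x ξ : Euc n) : ‖expI x ξ‖ = 1 := by
  rw [expI, mul_comm, Complex.norm_exp_ofReal_mul_I]

lemma continuous_expI : Continuous fun q : Euc n × Euc n => expI q.1 q.2 := by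
  unfold expI
  fun_prop

lemma dirDerivs_slice_ξ {f : Phase n → ℂ} (hf : ContDiff ℝ ∞ f) (x ξ η : Euc n) (L : List (Fin n)) :
    dirDerivs basisVec L (fun ξ => f (x, ξ, η)) ξ = dirDerivs axis (L.map ξIdx) f (x, ξ, η) := by
  have := dirDerivs_slice ((ContinuousLinearMap.inr ℝ (Euc n) (Euc n × Euc n)).comp
    (ContinuousLinearMap.inl ℝ (Euc n) (Euc n))) (x, 0, η) (v := basisVec) (v' := axis)
    ξIdx (fun i => rfl) hf L
  simpa using congrFun this ξ

lemma dirDerivs_slice_x {f : Phase n → ℂ} (hf : ContDiff ℝ ∞ f) (x ξ η : Euc n) (L : List (Fin n)) :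
    dirDerivs basisVec L (fun x => f (x, ξ, η)) x = dirDerivs axis (L.map xIdx) f (x, ξ, η) := by
  have := dirDerivs_slice (ContinuousLinearMap.inl ℝ (Euc n) (Euc n × Euc n)) (0, ξ, η)
    (v := basisVec) (v' := axis) xIdx (fun i => rfl) hf L
  simpa using congrFun this x

lemma dirDerivs_slice_η {f : Phase n → ℂ} (hf : ContDiff ℝ ∞ f) (x ξ η : Euc n) (L : List (Fin n)) :
    dirDerivs basisVec L (fun η => f (x, ξ, η)) η = dirDerivs axis (L.map ηIdx) f (x, ξ, η) := by
  have := dirDerivs_slice ((ContinuousLinearMap.inr ℝ (Euc n) (Euc n × Euc n)).comp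
    (ContinuousLinearMap.inr ℝ (Euc n) (Euc n))) (x, ξ, 0) (v := basisVec) (v' := axis)
    ηIdx (fun i => rfl) hf L
  simpa using congrFun this η

lemma shiftOps_slice_x {f : Phase n → ℂ} (hf : ContDiff ℝ ∞ f) (a : ℝ) (x ξ η : Euc n)
    (L : List (Fin n)) :
    shiftOps basisVec a L (fun x => f (x, ξ, η)) x = shiftOps axis a (L.map xIdx) f (x, ξ, η) := by
  have := shiftOps_slice (a := a) (ContinuousLinearMap.inl ℝ (Euc n) (Euc n × Euc n)) (0, ξ, η)
    (v := basisVec) (v' := axis) xIdx (fun i => rfl) hf L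
  simpa using congrFun this x

lemma shiftOps_slice_η {f : Phase n → ℂ} (hf : ContDiff ℝ ∞ f) (a : ℝ) (x ξ η : Euc n)
    (L : List (Fin n)) :
    shiftOps basisVec a L (fun η => f (x, ξ, η)) η = shiftOps axis a (L.map ηIdx) f (x, ξ, η) := by
  have := shiftOps_slice (a := a) ((ContinuousLinearMap.inr ℝ (Euc n) (Euc n × Euc n)).comp
    (ContinuousLinearMap.inr ℝ (Euc n) (Euc n))) (x, ξ, 0) (v := basisVec) (v' := axis)
    ηIdx (fun i => rfl) hf L
  simpa using congrFun this η

lemma DilBound.norm_dirDerivs_ξ (ha : ContDiff ℝ ∞ a) (h : DilBound lam wt X N A a) (x ξ η : Euc n)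
    {L : List (Fin n)} (hL : L.length ≤ N) :
    ‖dirDerivs basisVec L (fun ξ => a (x, ξ, η)) ξ‖ ≤ A * wt η * lam⁻¹ ^ L.length := by
  rw [dirDerivs_slice_ξ ha]
  have hcount : countX (L.map ξIdx) = 0 := by simp [countX, List.countP_eq_zero]
  refine (h (L.map ξIdx) (by simp [hcount]) (by simpa using hL) _).trans_eq ?_
  rw [List.map_map, show (dilScale lam ∘ ξIdx) = fun _ : Fin n => lam⁻¹ from rfl]
  simp only [List.map_const', List.prod_replicate]
  ring

lemma DilBound.norm_dirDerivs_x (ha : ContDiff ℝ ∞ a) (h : DilBound lam wt X N A a) (x ξ η : Euc n)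
    {L : List (Fin n)} (hX : L.length ≤ X) (hL : L.length ≤ N) :
    ‖dirDerivs basisVec L (fun x => a (x, ξ, η)) x‖ ≤ A * wt η * lam ^ L.length := by
  rw [dirDerivs_slice_x ha]
  have hcount : countX (L.map xIdx) ≤ X := List.countP_le_length.trans (by simpa using hX)
  refine (h (L.map xIdx) hcount (by simpa using hL) _).trans_eq ?_
  rw [List.map_map, show (dilScale lam ∘ xIdx) = fun _ : Fin n => lam from rfl]
  simp only [List.map_const', List.prod_replicate]
  ring

lemma DilBound.norm_dirDerivs_η (ha : ContDiff ℝ ∞ a) (h : DilBound lam wt X N A a) (x ξ η : Euc n)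
    {L : List (Fin n)} (hL : L.length ≤ N) :
    ‖dirDerivs basisVec L (fun η => a (x, ξ, η)) η‖ ≤ A * wt η := by
  rw [dirDerivs_slice_η ha]
  have hcount : countX (L.map ηIdx) = 0 := by simp [countX, List.countP_eq_zero]
  refine (h (L.map ηIdx) (by simp [hcount]) (by simpa using hL) _).trans_eq ?_
  rw [List.map_map, show (dilScale lam ∘ ηIdx) = fun _ : Fin n => (1 : ℝ) from rfl]
  simp

lemma DilBound.eq_integral (hlam : 1 ≤ lam) (hA : 0 ≤ A) (hwt : ∀ η, 0 ≤ wt η)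
    (ha : ContDiff ℝ ∞ a) (h : DilBound lam wt n n A a) (x ξ η : Euc n) :
    a (x, ξ, η) = ∫ t, shiftOps axis lam⁻¹ ((List.finRange n).map xIdx) a
      (x + lam⁻¹ • WithLp.toLp 2 t, ξ, η) ∂expPi n := by
  have hlam0 : 0 < lam := zero_lt_one.trans_le hlam
  have hax : ContDiff ℝ ∞ fun x => a (x, ξ, η) := ha.comp (contDiff_id.prodMk contDiff_const)
  have hl : (List.finRange n).length = n := List.length_finRange
  have := eq_integral_shiftOps (v := basisVec) (inv_pos.2 hlam0).le hax (List.finRange n)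
    (List.nodup_finRange n) (B := A * wt η * lam ^ n) (fun L hL p => ?_) x
  · simp only [shiftOps_slice_x ha, sum_map_finRange_smul] at this
    exact this
  · rw [hl] at hL
    refine (h.norm_dirDerivs_x ha p ξ η hL hL).trans ?_
    exact mul_le_mul_of_nonneg_left (pow_le_pow_right₀ hlam hL) (mul_nonneg hA (hwt η))

lemma measurable_integral_expI {b : Euc n × Euc n → ℂ} (hb : Continuous b) (F : 𝓢(Euc n, ℂ)) :
    Measurable fun q : Euc n × Euc n => ∫ ξ, b (q.1, ξ) * F ξ * expI q.2 ξ := by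
  have hcont : Continuous fun q : (Euc n × Euc n) × Euc n =>
      b (q.1.1, q.2) * F q.2 * expI q.1.2 q.2 :=
    ((hb.comp ((continuous_fst.comp continuous_fst).prodMk continuous_snd)).mul
      (F.continuous.comp continuous_snd)).mul
      (continuous_expI.comp ((continuous_snd.comp continuous_fst).prodMk continuous_snd))
  exact hcont.stronglyMeasurable.integral_prod_right.measurable

/-- `L²` bound for linear pseudodifferential operators with parameter `η`. -/
lemma lintegral_linear_le {b : Phase n → ℂ} {S : Set (Euc n)} (hlam : 1 ≤ lam) (hA : 0 ≤ A)
    (hwt : ∀ η, 0 ≤ wt η) (hb : ContDiff ℝ ∞ b) (hS : IsCompact S)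
    (hbS : tsupport b ⊆ {p | p.2.1 ∈ S}) (h : DilBound lam wt n (2 * n) A b) (F : 𝓢(Euc n, ℂ))
    (η : Euc n) :
    ∫⁻ x, ‖∫ ξ, b (x, ξ, η) * F ξ * expI x ξ‖ₑ ^ 2 ≤
      2 ^ n * ENNReal.ofReal (2 ^ n * (2 ^ n * A * wt η)) ^ 2 *
        (∫⁻ t : Fin n → ℝ, ENNReal.ofReal (cauchyWeight t)) *
        (plancherelConst n * eLpNorm F 2 volume) ^ 2 := by
  have hlam0 : 0 < lam := zero_lt_one.trans_le hlam
  have hJl : (List.finRange n).length = n := List.length_finRange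
  obtain ⟨β, hβ⟩ : ∃ β, β = shiftOps axis lam⁻¹ ((List.finRange n).map xIdx) b := ⟨_, rfl⟩
  have hβs : ContDiff ℝ ∞ β := hβ ▸ contDiff_shiftOps hb _
  have hβb : DilBound lam wt 0 n (2 ^ n * A) β := by
    have := DilBound.shiftOps_x (X := 0) (N := n) (A := A) (wt := wt) hlam0 hb (List.finRange n)
      (by rw [hJl]; exact h.mono (by omega) (by omega))
    rwa [hJl, ← hβ] at this
  have hcc : ∀ z, HasCompactSupport fun ξ => β (z, ξ, η) := fun z => by
    refine HasCompactSupport.intro hS fun ξ hξ => image_eq_zero_of_notMem_tsupport fun h' => ?_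
    rw [hβ] at h'
    have : (z, ξ, η) ∈ {p : Phase n | p.2.1 ∈ S} := hbS (tsupport_shiftOps_subset hb _ h')
    exact hξ this
  have hslice : Continuous fun q : Euc n × Euc n => β (q.1, q.2, η) :=
    hβs.continuous.comp (by fun_prop)
  have hU := measurable_integral_expI hslice F
  have key := lintegral_frozen_le hlam0 (c := fun z ξ => β (z, ξ, η))
    (fun z => hβs.comp (contDiff_const.prodMk (contDiff_id.prodMk contDiff_const))) hcc
    (A := 2 ^ n * A * wt η) (mul_nonneg (by positivity) (hwt η))
    (fun z L hL ξ => hβb.norm_dirDerivs_ξ hβs z ξ η hL) F hU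
  refine le_trans (lintegral_mono fun x => ?_) key
  have htl : Continuous fun t : Fin n → ℝ => (WithLp.toLp 2 t : Euc n) := PiLp.continuous_toLp 2 _
  have htc : Continuous fun t : Fin n → ℝ => x + lam⁻¹ • (WithLp.toLp 2 t : Euc n) :=
    continuous_const.add (htl.const_smul lam⁻¹)
  have hcont2 : Continuous fun q : Euc n × (Fin n → ℝ) =>
      β (x + lam⁻¹ • WithLp.toLp 2 q.2, q.1, η) * F q.1 * expI x q.1 :=
    ((hβs.continuous.comp ((htc.comp continuous_snd).prodMk
      (continuous_fst.prodMk continuous_const))).mul (F.continuous.comp continuous_fst)).mul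
      (continuous_expI.comp (continuous_const.prodMk continuous_fst))
  -- Only the symbol is averaged over the shifts; the exponential keeps the point x, as the frozen
  -- estimate requires.
  have hV : ∫ ξ, b (x, ξ, η) * F ξ * expI x ξ =
      ∫ t, ∫ ξ, β (x + lam⁻¹ • WithLp.toLp 2 t, ξ, η) * F ξ * expI x ξ ∂volume ∂expPi n := by
    rw [← integral_integral_swap
      (f := fun ξ t => β (x + lam⁻¹ • WithLp.toLp 2 t, ξ, η) * F ξ * expI x ξ)]
    · refine integral_congr_ae (Filter.Eventually.of_forall fun ξ => ?_)
      simp only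
      rw [(h.mono le_rfl (by omega)).eq_integral hlam hA hwt hb x ξ η, ← hβ,
        ← integral_mul_const, ← integral_mul_const]
    · have hg : Integrable (fun q : Euc n × (Fin n → ℝ) => ‖F q.1‖ * (2 ^ n * A * wt η))
          ((volume : Measure (Euc n)).prod (expPi n)) :=
        F.integrable.norm.mul_prod (integrable_const _)
      refine hg.mono' hcont2.aestronglyMeasurable (Filter.Eventually.of_forall fun q => ?_)
      simp only [Function.uncurry]
      rw [norm_mul, norm_mul, norm_expI, mul_one, mul_comm]
      exact mul_le_mul_of_nonneg_left (hβb.norm_le _) (norm_nonneg _)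
  rw [hV]
  refine enorm_integral_sq_le _ ?_
  have : StronglyMeasurable fun t : Fin n → ℝ =>
      ∫ ξ, β (x + lam⁻¹ • WithLp.toLp 2 t, ξ, η) * F ξ * expI x ξ :=
    hcont2.stronglyMeasurable.integral_prod_left'
  exact this.aestronglyMeasurable

end PieceEstimate

end BilinearPDO

namespace BilinearPDO

/-! ### Reduction of a bilinear piece to linear operators with parameter η -/

section BilinearPiece

open SchwartzMap FourierTransform
open scoped SchwartzMap

variable {n : ℕ}

/-- The bilinear operator with symbol `a`, as a function of the Fourier transforms. -/
noncomputable def bilin (a : Phase n → ℂ) (F H : Euc n → ℂ) (x : Euc n) : ℂ :=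
  ∫ q : Euc n × Euc n, a (x, q.1, q.2) * F q.1 * H q.2 * expI x (q.1 + q.2)

lemma expI_add (x ξ η : Euc n) : expI x (ξ + η) = expI x ξ * expI x η := by
  simp only [expI, ← Complex.exp_add, inner_add_right, Complex.ofReal_add, mul_add]

lemma expI_sub_mul (x y η : Euc n) : expI (-y) η * expI x η = expI (x - y) η := by
  simp only [expI, ← Complex.exp_add, inner_sub_left, inner_neg_left, Complex.ofReal_sub,
    Complex.ofReal_neg]
  ring_nf

lemma norm_fourier_le (G : Euc n → ℂ) (η : Euc n) : ‖fourier G η‖ ≤ ∫ y, ‖G y‖ := by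
  refine (norm_integral_le_integral_norm _).trans_eq ?_
  simp [norm_expI]

variable {lam : ℝ} {wt : Euc n → ℝ} {X N : ℕ} {A : ℝ} {a : Phase n → ℂ}

/-- The list in which each coordinate occurs twice. -/
def doubleList (n : ℕ) : List (Fin n) := List.finRange n ++ List.finRange n

lemma length_doubleList : (doubleList n).length = 2 * n := by
  simp [doubleList]; omega

/-- Each coordinate is used twice so that the inverse product decays like ∏ (1 + w_j²)⁻¹, which is
integrable; a single use would give only the square root. -/
lemma norm_linProd_doubleList_inv (w : Euc n) :
    ‖(linProd 1 0 (doubleList n) w)⁻¹‖ = cauchyWeight w := by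
  have : linProd 1 0 (doubleList n) w = linProd 1 0 (List.finRange n) w ^ 2 := by
    simp [linProd, doubleList, sq]
  rw [this, ← inv_pow, norm_pow, norm_linProd_inv_sq]
  simp

lemma integrable_cauchyWeight_euc : Integrable fun w : Euc n => cauchyWeight (w : Fin n → ℝ) :=
  ((PiLp.volume_preserving_ofLp (Fin n)).integrable_comp_emb
    (MeasurableEquiv.toLp 2 (Fin n → ℝ)).symm.measurableEmbedding).2 integrable_cauchyWeight

lemma continuous_cauchyWeight_euc : Continuous fun w : Euc n => cauchyWeight (w : Fin n → ℝ) :=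
  continuous_cauchyWeight.comp (PiLp.continuous_ofLp 2 _)

lemma integral_mul_expI_eq (hwti : Integrable wt)
    (ha : ContDiff ℝ ∞ a) (h : DilBound lam wt 0 (2 * n) A a) (x ξ w : Euc n) :
    ∫ η, a (x, ξ, η) * expI w η = (linProd 1 0 (doubleList n) w)⁻¹ *
      ∫ η, shiftOps axis 1 ((doubleList n).map ηIdx) a (x, ξ, η) * expI w η := by
  have hax : ContDiff ℝ ∞ fun η => a (x, ξ, η) :=
    ha.comp (contDiff_const.prodMk (contDiff_const.prodMk contDiff_id))
  have := linProd_mul_integral_expI hax (doubleList n) (fun L hL => ?_) w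
  · simp only [shiftOps_slice_η ha] at this
    rw [← this, inv_mul_cancel_left₀ (linProd_ne_zero _ _ _ _)]
  · rw [length_doubleList] at hL
    exact (hwti.const_mul A).mono' (contDiff_dirDerivs L hax).continuous.aestronglyMeasurable
      (Filter.Eventually.of_forall fun η => h.norm_dirDerivs_η ha x ξ η hL)

lemma norm_mul_expI (z : ℂ) (x ξ : Euc n) : ‖z * expI x ξ‖ = ‖z‖ := by
  rw [norm_mul, norm_expI, mul_one]

lemma integrable_bilin_slice {c : Phase n → ℂ} (hc : Continuous c) {D : ℝ}
    (hcD : ∀ p, ‖c p‖ ≤ D * wt p.2.2) (hwti : Integrable wt) (F : 𝓢(Euc n, ℂ)) (x w : Euc n) :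
    Integrable fun q : Euc n × Euc n => c (x, q.1, q.2) * (F q.1 * expI x q.1) * expI w q.2 := by
  have hFw : Integrable (fun q : Euc n × Euc n => ‖F q.1‖ * wt q.2) :=
    F.integrable.norm.mul_prod hwti
  have h1 : Continuous fun q : Euc n × Euc n => c (x, q.1, q.2) :=
    hc.comp (continuous_const.prodMk continuous_id)
  have h2 : Continuous fun q : Euc n × Euc n => F q.1 * expI x q.1 :=
    (F.continuous.comp continuous_fst).mul
      (continuous_expI.comp (continuous_const.prodMk continuous_fst))
  have h3 : Continuous fun q : Euc n × Euc n => expI w q.2 :=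
    continuous_expI.comp (continuous_const.prodMk continuous_snd)
  refine (hFw.const_mul D).mono' ((h1.mul h2).mul h3).aestronglyMeasurable
    (Filter.Eventually.of_forall fun q => ?_)
  rw [norm_mul_expI, norm_mul, norm_mul_expI]
  refine (mul_le_mul_of_nonneg_right (hcD _) (norm_nonneg _)).trans_eq ?_
  ring

/-- Integration by parts in η only: the decaying factor depends on w alone and can be pulled out of
the ξ-integral as well. -/
lemma integral_bilin_slice (hwti : Integrable wt) (ha : ContDiff ℝ ∞ a)
    (h : DilBound lam wt 0 (2 * n) A a) {b : Phase n → ℂ}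
    (hb : b = shiftOps axis 1 ((doubleList n).map ηIdx) a) (F : 𝓢(Euc n, ℂ)) (x w : Euc n) :
    ∫ q : Euc n × Euc n, a (x, q.1, q.2) * (F q.1 * expI x q.1) * expI w q.2 =
      (linProd 1 0 (doubleList n) w)⁻¹ *
        ∫ η, (∫ ξ, b (x, ξ, η) * F ξ * expI x ξ) * expI w η := by
  have hbs : ContDiff ℝ ∞ b := hb ▸ contDiff_shiftOps ha _
  have hbB : DilBound lam wt 0 0 (2 ^ (2 * n) * A) b := by
    have := DilBound.shiftOps_η (X := 0) (N := 0) (A := A) (lam := lam) (wt := wt) ha (doubleList n)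
      (by rw [length_doubleList]; exact h.mono (by omega) (by omega))
    rwa [length_doubleList, ← hb] at this
  have ia := integrable_bilin_slice ha.continuous (fun p => h.norm_le p) hwti F x w
  have ib := integrable_bilin_slice hbs.continuous (fun p => hbB.norm_le p) hwti F x w
  have e0 : ∀ (c : Phase n → ℂ) (ξ : Euc n),
      ∫ η, c (x, ξ, η) * (F ξ * expI x ξ) * expI w η =
        (F ξ * expI x ξ) * ∫ η, c (x, ξ, η) * expI w η := by
    intro c ξ
    rw [← integral_const_mul]
    exact integral_congr_ae (Filter.Eventually.of_forall fun η => by simp only; ring)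
  have e1 : ∫ q : Euc n × Euc n, a (x, q.1, q.2) * (F q.1 * expI x q.1) * expI w q.2 =
      (linProd 1 0 (doubleList n) w)⁻¹ *
        ∫ q : Euc n × Euc n, b (x, q.1, q.2) * (F q.1 * expI x q.1) * expI w q.2 := by
    rw [Measure.volume_eq_prod, integral_prod _ ia, integral_prod _ ib, ← integral_const_mul]
    refine integral_congr_ae (Filter.Eventually.of_forall fun ξ => ?_)
    simp only [e0]
    rw [integral_mul_expI_eq hwti ha h x ξ w, ← hb]
    ring
  rw [e1, Measure.volume_eq_prod, integral_prod_symm _ ib]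
  congr 1
  refine integral_congr_ae (Filter.Eventually.of_forall fun η => ?_)
  simp only
  rw [← integral_mul_const]
  exact integral_congr_ae (Filter.Eventually.of_forall fun ξ => by simp only; ring)

/-- Fubini turns the operator into an integral against a kernel in x - y; absolute convergence uses
the integrable weight in η. -/
lemma bilin_fourier_swap (hwti : Integrable wt) {c : Phase n → ℂ} (hc : Continuous c)
    (hcD : ∀ p, ‖c p‖ ≤ A * wt p.2.2) (F : 𝓢(Euc n, ℂ))
    {G : Euc n → ℂ} (hGc : Continuous G) (hGi : Integrable G) (x : Euc n) :
    bilin c F (fourier G) x = ∫ y, G y *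
      ∫ q : Euc n × Euc n, c (x, q.1, q.2) * (F q.1 * expI x q.1) * expI (x - y) q.2 := by
  have hFw : Integrable (fun q : Euc n × Euc n => ‖F q.1‖ * wt q.2) :=
    F.integrable.norm.mul_prod hwti
  have hint : Integrable (fun r : Euc n × Euc n × Euc n =>
      G r.1 * (c (x, r.2.1, r.2.2) * (F r.2.1 * expI x r.2.1) * expI (x - r.1) r.2.2))
      ((volume : Measure (Euc n)).prod volume) := by
    have hg : Integrable (fun r : Euc n × Euc n × Euc n => ‖G r.1‖ * (A * (‖F r.2.1‖ * wt r.2.2)))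
        ((volume : Measure (Euc n)).prod volume) :=
      hGi.norm.mul_prod (hFw.const_mul A)
    have p1 : Continuous fun r : Euc n × Euc n × Euc n => r.2.1 := continuous_fst.comp continuous_snd
    have p2 : Continuous fun r : Euc n × Euc n × Euc n => r.2.2 := continuous_snd.comp continuous_snd
    have h0 : Continuous fun r : Euc n × Euc n × Euc n => G r.1 := hGc.comp continuous_fst
    have h1 : Continuous fun r : Euc n × Euc n × Euc n => c (x, r.2.1, r.2.2) :=
      hc.comp (continuous_const.prodMk continuous_snd)
    have h2 : Continuous fun r : Euc n × Euc n × Euc n => F r.2.1 * expI x r.2.1 :=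
      (F.continuous.comp p1).mul (continuous_expI.comp (continuous_const.prodMk p1))
    have h3 : Continuous fun r : Euc n × Euc n × Euc n => expI (x - r.1) r.2.2 :=
      continuous_expI.comp ((continuous_const.sub continuous_fst).prodMk p2)
    refine hg.mono' (h0.mul ((h1.mul h2).mul h3)).aestronglyMeasurable
      (Filter.Eventually.of_forall fun r => ?_)
    rw [norm_mul, norm_mul_expI, norm_mul, norm_mul_expI]
    refine mul_le_mul_of_nonneg_left ?_ (norm_nonneg _)
    refine (mul_le_mul_of_nonneg_right (hcD _) (norm_nonneg _)).trans_eq ?_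
    ring
  simp only [← integral_const_mul]
  rw [integral_integral_swap (f := fun (y : Euc n) (q : Euc n × Euc n) =>
    G y * (c (x, q.1, q.2) * (F q.1 * expI x q.1) * expI (x - y) q.2)) hint]
  refine integral_congr_ae (Filter.Eventually.of_forall fun q => ?_)
  simp only [fourier]
  rw [← integral_const_mul, ← integral_mul_const]
  refine integral_congr_ae (Filter.Eventually.of_forall fun y => ?_)
  simp only
  rw [expI_add, ← expI_sub_mul]
  ring

/-- The kernel is at most an integrable function of x - y times a quantity independent of y. Hence G
enters only through its supremum, and what remains is the L¹ norm in η of linear operators. -/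
lemma enorm_bilin_fourier_le (hwti : Integrable wt)
    (ha : ContDiff ℝ ∞ a) (h : DilBound lam wt 0 (2 * n) A a) (F : 𝓢(Euc n, ℂ))
    {G : Euc n → ℂ} (hGc : Continuous G) (hGi : Integrable G) {B : ℝ≥0∞} (hB : ∀ y, ‖G y‖ₑ ≤ B)
    (x : Euc n) :
    ‖bilin a F (fourier G) x‖ₑ ≤ B * (∫⁻ w : Euc n, ENNReal.ofReal (cauchyWeight w)) *
      ∫⁻ η, ‖∫ ξ, shiftOps axis 1 ((doubleList n).map ηIdx) a (x, ξ, η) * F ξ * expI x ξ‖ₑ := by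
  rw [bilin_fourier_swap hwti ha.continuous (fun p => h.norm_le p) F hGc hGi]
  obtain ⟨b, hb⟩ : ∃ b, b = shiftOps axis 1 ((doubleList n).map ηIdx) a := ⟨_, rfl⟩
  simp only [integral_bilin_slice hwti ha h hb]
  rw [← hb]
  obtain ⟨V, hV⟩ : ∃ V : Euc n → ℂ, ∀ η, ∫ ξ, b (x, ξ, η) * F ξ * expI x ξ = V η :=
    ⟨_, fun _ => rfl⟩
  simp only [hV]
  obtain ⟨κ, hκ⟩ : ∃ κ : Euc n → ℝ≥0∞, ∀ w : Euc n, ENNReal.ofReal (cauchyWeight w) = κ w :=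
    ⟨_, fun _ => rfl⟩
  have hc : Measurable κ := by
    rw [← funext hκ]
    exact continuous_cauchyWeight_euc.measurable.ennreal_ofReal
  have h1 : ∀ w : Euc n, ‖(linProd 1 0 (doubleList n) w)⁻¹‖ₑ = κ w := fun w => by
    rw [← hκ, ← ofReal_norm, norm_linProd_doubleList_inv]
  have h2 : ∀ w, ‖∫ η, V η * expI w η‖ₑ ≤ ∫⁻ η, ‖V η‖ₑ := fun w => by
    refine (enorm_integral_le_lintegral_enorm _).trans_eq (lintegral_congr fun η => ?_)
    rw [← ofReal_norm, norm_mul_expI, ofReal_norm]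
  simp only [hκ]
  calc _ ≤ ∫⁻ y, B * (κ (x - y) * ∫⁻ η, ‖V η‖ₑ) := by
        refine (enorm_integral_le_lintegral_enorm _).trans (lintegral_mono fun y => ?_)
        rw [enorm_mul, enorm_mul, h1]
        exact mul_le_mul' (hB y) (mul_le_mul' le_rfl (h2 _))
    _ = _ := by
        have hm : Measurable fun y : Euc n => κ (x - y) :=
          hc.comp (measurable_const.sub measurable_id)
        rw [lintegral_const_mul _ (hm.mul_const _), lintegral_mul_const _ hm,
          lintegral_sub_left_eq_self κ, mul_assoc]

/-- The basic `L²` bound for bilinear operators whose symbol is integrable in `η`. -/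
lemma exists_eLpNorm_bilin_le (wt : Euc n → ℝ) (hwt : ∀ η, 0 < wt η) (hwtc : Continuous wt)
    (hwti : Integrable wt) : ∃ C : ℝ≥0∞, C ≠ ⊤ ∧
    ∀ {lam A : ℝ} {a : Phase n → ℂ} {S : Set (Euc n)}, 1 ≤ lam → 0 ≤ A → ContDiff ℝ ∞ a →
    IsCompact S → tsupport a ⊆ {p | p.2.1 ∈ S} → DilBound lam wt n (4 * n) A a →
    ∀ (F : 𝓢(Euc n, ℂ)) {G : Euc n → ℂ}, Continuous G → Integrable G → ∀ {B : ℝ≥0∞},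
    (∀ y, ‖G y‖ₑ ≤ B) → eLpNorm (bilin a F (fourier G)) 2 volume ≤
      C * ENNReal.ofReal A * B * eLpNorm F 2 volume := by
  obtain ⟨c1, hc1⟩ : ∃ c, c = ∫⁻ w : Euc n, ENNReal.ofReal (cauchyWeight w) := ⟨_, rfl⟩
  obtain ⟨c2, hc2⟩ : ∃ c, c = ∫⁻ η, ENNReal.ofReal (wt η) := ⟨_, rfl⟩
  obtain ⟨c3, hc3⟩ : ∃ c, c = ∫⁻ t : Fin n → ℝ, ENNReal.ofReal (cauchyWeight t) := ⟨_, rfl⟩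
  -- The square of the final constant: c1 comes from the y-integral, c2² from Cauchy–Schwarz in η
  -- and from integrating the resulting bound, and the last factor from the linear estimate applied
  -- after 2n shifts in η.
  obtain ⟨D, hD⟩ : ∃ D, D = c1 ^ 2 * c2 ^ 2 * (2 ^ n * ENNReal.ofReal (2 ^ n * 2 ^ n * 2 ^ (2 * n)) ^ 2 *
    c3 * plancherelConst n ^ 2) := ⟨_, rfl⟩
  have h1 : c1 ≠ ⊤ := hc1 ▸ (integrable_cauchyWeight_euc (n := n)).lintegral_lt_top.ne
  have h2 : c2 ≠ ⊤ := hc2 ▸ hwti.lintegral_lt_top.ne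
  have h3 : c3 ≠ ⊤ := hc3 ▸ (integrable_cauchyWeight (n := n)).lintegral_lt_top.ne
  have hDt : D ≠ ⊤ := by
    rw [hD]
    refine ENNReal.mul_ne_top (ENNReal.mul_ne_top (ENNReal.pow_ne_top h1) (ENNReal.pow_ne_top h2)) ?_
    exact ENNReal.mul_ne_top (ENNReal.mul_ne_top (ENNReal.mul_ne_top (by simp)
      (ENNReal.pow_ne_top ENNReal.ofReal_ne_top)) h3) (ENNReal.pow_ne_top plancherelConst_ne_top)
  refine ⟨D ^ (1 / 2 : ℝ), ENNReal.rpow_ne_top_of_nonneg (by norm_num) hDt, ?_⟩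
  intro lam A a S hlam hA ha hS haS h F G hGc hGi B hB
  have hDs : (D ^ (1 / 2 : ℝ)) ^ 2 = D := by
    rw [← ENNReal.rpow_natCast, ← ENNReal.rpow_mul]; simp
  refine (ENNReal.pow_le_pow_left_iff two_ne_zero).1 ?_
  rw [mul_pow, mul_pow, mul_pow, hDs, eLpNorm_two_sq]
  obtain ⟨b, hb⟩ : ∃ b, b = shiftOps axis 1 ((doubleList n).map ηIdx) a := ⟨_, rfl⟩
  have hbs : ContDiff ℝ ∞ b := hb ▸ contDiff_shiftOps ha _
  -- Of the 4n available derivatives 2n are spent in η; the linear estimate needs the others, n in x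
  -- and n in ξ.
  have hbB : DilBound lam wt n (2 * n) (2 ^ (2 * n) * A) b := by
    have := DilBound.shiftOps_η (X := n) (N := 2 * n) (A := A) (lam := lam) (wt := wt) ha (doubleList n)
      (by rw [length_doubleList]; exact h.mono (by omega) (by omega))
    rwa [length_doubleList, ← hb] at this
  have hbS : tsupport b ⊆ {p | p.2.1 ∈ S} := hb ▸ (tsupport_shiftOps_subset ha _).trans haS
  obtain ⟨V, hV⟩ : ∃ V : Euc n → Euc n → ℂ, ∀ x η, ∫ ξ, b (x, ξ, η) * F ξ * expI x ξ = V x η :=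
    ⟨_, fun _ _ => rfl⟩
  have hVm : Measurable fun q : Euc n × Euc n => V q.1 q.2 := by
    have hcont : Continuous fun q : (Euc n × Euc n) × Euc n =>
        b (q.1.1, q.2, q.1.2) * F q.2 * expI q.1.1 q.2 := by
      refine ((hbs.continuous.comp ?_).mul (F.continuous.comp continuous_snd)).mul
        (continuous_expI.comp ((continuous_fst.comp continuous_fst).prodMk continuous_snd))
      exact (continuous_fst.comp continuous_fst).prodMk
        (continuous_snd.prodMk (continuous_snd.comp continuous_fst))
    have : StronglyMeasurable fun q : Euc n × Euc n => ∫ ξ, b (q.1, ξ, q.2) * F ξ * expI q.1 ξ :=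
      hcont.stronglyMeasurable.integral_prod_right
    simpa only [hV] using this.measurable
  have hlin : ∀ η, ∫⁻ x, ‖V x η‖ₑ ^ 2 ≤ 2 ^ n * ENNReal.ofReal (2 ^ n * 2 ^ n * 2 ^ (2 * n)) ^ 2 *
      c3 * plancherelConst n ^ 2 * (ENNReal.ofReal A ^ 2 * eLpNorm F 2 volume ^ 2) *
      ENNReal.ofReal (wt η) ^ 2 := by
    intro η
    have := lintegral_linear_le hlam (by positivity) (fun η => (hwt η).le) hbs hS hbS hbB F η
    simp only [hV, ← hc3] at this
    refine this.trans_eq ?_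
    rw [show (2 : ℝ) ^ n * (2 ^ n * (2 ^ (2 * n) * A) * wt η) =
      (2 ^ n * 2 ^ n * 2 ^ (2 * n)) * (A * wt η) by ring, ENNReal.ofReal_mul (by positivity),
      ENNReal.ofReal_mul hA]
    ring
  have hwtm : Measurable fun η => ENNReal.ofReal (wt η) := hwtc.measurable.ennreal_ofReal
  -- Cauchy–Schwarz with the factors √wt and 1/√wt. The linear bound is proportional to wt², so an
  -- integrable wt survives the division.
  have hcs : ∀ x, (∫⁻ η, ‖V x η‖ₑ) ^ 2 ≤ c2 * ∫⁻ η, (ENNReal.ofReal (wt η))⁻¹ * ‖V x η‖ₑ ^ 2 := by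
    intro x
    have hVx : Measurable fun η => ‖V x η‖ₑ := (hVm.comp measurable_prodMk_left).enorm
    have hs : Measurable fun η => ENNReal.ofReal (Real.sqrt (wt η)) :=
      (Real.continuous_sqrt.comp hwtc).measurable.ennreal_ofReal
    have := lintegral_mul_sq_le volume (f := fun η => ENNReal.ofReal (Real.sqrt (wt η)))
      (g := fun η => (ENNReal.ofReal (Real.sqrt (wt η)))⁻¹ * ‖V x η‖ₑ) hs.aemeasurable
      (hs.inv.mul hVx).aemeasurable
    have e1 : ∀ η, ENNReal.ofReal (Real.sqrt (wt η)) *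
        ((ENNReal.ofReal (Real.sqrt (wt η)))⁻¹ * ‖V x η‖ₑ) = ‖V x η‖ₑ := fun η => by
      rw [← mul_assoc, ENNReal.mul_inv_cancel _ ENNReal.ofReal_ne_top, one_mul]
      simpa using hwt η
    have e2 : ∀ η, ENNReal.ofReal (Real.sqrt (wt η)) ^ 2 = ENNReal.ofReal (wt η) := fun η => by
      rw [← ENNReal.ofReal_pow (Real.sqrt_nonneg _), Real.sq_sqrt (hwt η).le]
    have e3 : ∀ η, (ENNReal.ofReal (Real.sqrt (wt η)))⁻¹ ^ 2 = (ENNReal.ofReal (wt η))⁻¹ := fun η => by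
      rw [← e2, ENNReal.inv_pow]
    simp only [e1, mul_pow, e2, e3] at this
    rwa [← hc2] at this
  have hΨ : Measurable fun q : Euc n × Euc n => (ENNReal.ofReal (wt q.2))⁻¹ * ‖V q.1 q.2‖ₑ ^ 2 := by
    have hwi : Measurable fun η => (ENNReal.ofReal (wt η))⁻¹ := hwtm.inv
    exact (hwi.comp measurable_snd).mul (hVm.enorm.pow_const 2)
  calc ∫⁻ x, ‖bilin a F (fourier G) x‖ₑ ^ 2
      ≤ ∫⁻ x, (B * c1) ^ 2 * (c2 * ∫⁻ η, (ENNReal.ofReal (wt η))⁻¹ * ‖V x η‖ₑ ^ 2) := by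
        refine lintegral_mono fun x => ?_
        have := enorm_bilin_fourier_le hwti ha
          (h.mono (by omega) (by omega)) F hGc hGi hB x
        rw [← hb, ← hc1] at this
        simp only [hV] at this
        refine (pow_le_pow_left₀ zero_le this 2).trans ?_
        rw [mul_pow]
        exact mul_le_mul_right (hcs x) _
    _ = (B * c1) ^ 2 * c2 * ∫⁻ x, ∫⁻ η, (ENNReal.ofReal (wt η))⁻¹ * ‖V x η‖ₑ ^ 2 := by
        have hm : Measurable fun x => ∫⁻ η, (ENNReal.ofReal (wt η))⁻¹ * ‖V x η‖ₑ ^ 2 :=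
          hΨ.lintegral_prod_right'
        rw [lintegral_const_mul _ (hm.const_mul _), lintegral_const_mul _ hm, mul_assoc]
    _ = (B * c1) ^ 2 * c2 * ∫⁻ η, (ENNReal.ofReal (wt η))⁻¹ * ∫⁻ x, ‖V x η‖ₑ ^ 2 := by
        rw [lintegral_lintegral_swap (f := fun x η => (ENNReal.ofReal (wt η))⁻¹ * ‖V x η‖ₑ ^ 2) hΨ.aemeasurable]
        congr 1
        refine lintegral_congr fun η => ?_
        have hm : Measurable fun x => ‖V x η‖ₑ ^ 2 :=
          (hVm.comp measurable_prodMk_right).enorm.pow_const 2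
        rw [lintegral_const_mul _ hm]
    _ ≤ (B * c1) ^ 2 * c2 * ∫⁻ η, 2 ^ n * ENNReal.ofReal (2 ^ n * 2 ^ n * 2 ^ (2 * n)) ^ 2 *
      c3 * plancherelConst n ^ 2 * (ENNReal.ofReal A ^ 2 * eLpNorm F 2 volume ^ 2) *
      ENNReal.ofReal (wt η) := by
        refine mul_le_mul_right (lintegral_mono fun η => ?_) _
        refine (mul_le_mul_right (hlin η) _).trans_eq ?_
        rw [mul_left_comm]
        congr 1
        rw [sq, ← mul_assoc, ENNReal.inv_mul_cancel (by simpa using hwt η) ENNReal.ofReal_ne_top,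
          one_mul]
    _ = _ := by
        rw [lintegral_const_mul _ hwtm, ← hc2, hD]
        ring

end BilinearPiece

end BilinearPDO

namespace BilinearPDO

/-! ### Symbols dominated by the first frequency -/

section LinearScale

variable {n : ℕ} {δ : ℝ}

/-- The only nonzero first derivative is constant, and 1 ≤ ⟨ξ⟩^(1-δ) because δ ≤ 1. -/
lemma sym_ξ_coord (hδ1 : δ ≤ 1) (j : Fin n) :
    Sym (axis (n := n)) (linearScale δ) (fun (_ : Unit) p => japξ p ^ (1 / 2 : ℝ))
      (fun _ p => ((p.2.1 j : ℝ) : ℂ)) := by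
  have hpos : ∀ p : Phase n, 0 ≤ japξ p ^ (1 / 2 : ℝ) := fun p =>
    (Real.rpow_pos_of_pos (japξ_pos p) _).le
  refine sym_clm ((EuclideanSpace.proj j).comp ((ContinuousLinearMap.fst ℝ (Euc n) (Euc n)).comp
    (ContinuousLinearMap.snd ℝ (Euc n) (Euc n × Euc n)))) (fun _ => hpos) (linearScale_nonneg δ)
    (fun _ p => ?_) fun i => ?_
  · rw [← Real.sqrt_eq_rpow]
    refine Real.le_sqrt_of_sq_le ?_
    have h : ‖p.2.1 j‖ ≤ ‖p.2.1‖ := PiLp.norm_apply_le _ _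
    have h2 : ‖p.2.1 j‖ ^ 2 ≤ ‖p.2.1‖ ^ 2 := by gcongr
    rw [japξ]
    change |p.2.1 j| ^ 2 ≤ _
    rw [← Real.norm_eq_abs]
    linarith
  · rcases i with i | i | i
    · refine ⟨0, le_rfl, fun _ p => ?_⟩
      simp [axis]
    · refine ⟨1, zero_le_one, fun _ p => ?_⟩
      have h1 : |(basisVec i : Euc n) j| ≤ 1 := by
        simp only [basisVec, EuclideanSpace.single, PiLp.single_apply]
        split_ifs <;> simp
      refine (show |(basisVec i : Euc n) j| ≤ _ from h1.trans ?_)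
      rw [one_mul, show linearScale δ (ξIdx i) p = japξ p ^ (-(δ / 2)) from rfl,
        ← Real.rpow_add (japξ_pos p)]
      exact Real.one_le_rpow (one_le_japξ p) (by linarith)
    · refine ⟨0, le_rfl, fun _ p => ?_⟩
      simp [axis]

lemma sym_η_coord (j : Fin n) :
    Sym (axis (n := n)) (linearScale δ) (fun (_ : Unit) p => japη p ^ (1 / 2 : ℝ))
      (fun _ p => ((p.2.2 j : ℝ) : ℂ)) := by
  have hpos : ∀ p : Phase n, 0 ≤ japη p ^ (1 / 2 : ℝ) := fun p =>
    (Real.rpow_pos_of_pos (japη_pos p) _).le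
  refine sym_clm ((EuclideanSpace.proj j).comp ((ContinuousLinearMap.snd ℝ (Euc n) (Euc n)).comp
    (ContinuousLinearMap.snd ℝ (Euc n) (Euc n × Euc n)))) (fun _ => hpos) (linearScale_nonneg δ)
    (fun _ p => ?_) fun i => ?_
  · rw [← Real.sqrt_eq_rpow]
    refine Real.le_sqrt_of_sq_le ?_
    have h : ‖p.2.2 j‖ ≤ ‖p.2.2‖ := PiLp.norm_apply_le _ _
    have h2 : ‖p.2.2 j‖ ^ 2 ≤ ‖p.2.2‖ ^ 2 := by gcongr
    rw [japη]
    change |p.2.2 j| ^ 2 ≤ _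
    rw [← Real.norm_eq_abs]
    linarith
  · rcases i with i | i | i
    · refine ⟨0, le_rfl, fun _ p => ?_⟩
      simp [axis]
    · refine ⟨0, le_rfl, fun _ p => ?_⟩
      simp [axis]
    · refine ⟨1, zero_le_one, fun _ p => ?_⟩
      have h1 : |(basisVec i : Euc n) j| ≤ 1 := by
        simp only [basisVec, EuclideanSpace.single, PiLp.single_apply]
        split_ifs <;> simp
      refine (show |(basisVec i : Euc n) j| ≤ _ from h1.trans ?_)
      rw [one_mul, show linearScale δ (ηIdx i) p = 1 from rfl, mul_one]
      exact Real.one_le_rpow (one_le_japη p) (by norm_num)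

lemma sym_japξ (hδ1 : δ ≤ 1) : Sym (axis (n := n)) (linearScale δ) (fun (_ : Unit) => japξ)
    (fun _ p => ((japξ p : ℝ) : ℂ)) := by
  have hw : ∀ (_ : Unit) (p : Phase n), 0 ≤ japξ p := fun _ p => (japξ_pos p).le
  have h1 := sym_const (κ := Unit) (v := axis (n := n)) 1 hw (linearScale_nonneg δ)
    ⟨1, zero_le_one, fun _ p => by simpa using one_le_japξ p⟩
  have h2 := sym_sum (κ := Unit) (v := axis (n := n)) Finset.univ hw (linearScale_nonneg δ)
    (T := fun j _ p => ((p.2.1 j : ℝ) : ℂ) * ((p.2.1 j : ℝ) : ℂ)) fun j _ =>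
    ((sym_ξ_coord hδ1 j).mul (sym_ξ_coord hδ1 j)).mono (linearScale_nonneg δ)
      (fun _ _ => le_rfl) hw ⟨1, zero_le_one, fun _ p => by
        rw [← Real.rpow_add (japξ_pos p)]; norm_num⟩
  have e : ∀ p : Phase n, ((japξ p : ℝ) : ℂ) =
      1 + ∑ j, ((p.2.1 j : ℝ) : ℂ) * ((p.2.1 j : ℝ) : ℂ) := fun p => by
    rw [japξ, EuclideanSpace.real_norm_sq_eq]
    push_cast
    simp only [sq]
  simp only [e]
  exact h1.add h2

lemma sym_japη : Sym (axis (n := n)) (linearScale δ) (fun (_ : Unit) => japη)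
    (fun _ p => ((japη p : ℝ) : ℂ)) := by
  have hw : ∀ (_ : Unit) (p : Phase n), 0 ≤ japη p := fun _ p => (japη_pos p).le
  have h1 := sym_const (κ := Unit) (v := axis (n := n)) 1 hw (linearScale_nonneg δ)
    ⟨1, zero_le_one, fun _ p => by simpa using one_le_japη p⟩
  have h2 := sym_sum (κ := Unit) (v := axis (n := n)) Finset.univ hw (linearScale_nonneg δ)
    (T := fun j _ p => ((p.2.2 j : ℝ) : ℂ) * ((p.2.2 j : ℝ) : ℂ)) fun j _ =>
    ((sym_η_coord j).mul (sym_η_coord j)).mono (linearScale_nonneg δ)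
      (fun _ _ => le_rfl) hw ⟨1, zero_le_one, fun _ p => by
        rw [← Real.rpow_add (japη_pos p)]; norm_num⟩
  have e : ∀ p : Phase n, ((japη p : ℝ) : ℂ) =
      1 + ∑ j, ((p.2.2 j : ℝ) : ℂ) * ((p.2.2 j : ℝ) : ℂ) := fun p => by
    rw [japη, EuclideanSpace.real_norm_sq_eq]
    push_cast
    simp only [sq]
  simp only [e]
  exact h1.add h2

lemma sym_jap (hδ1 : δ ≤ 1) : Sym (axis (n := n)) (linearScale δ) (fun (_ : Unit) => jap)
    (fun _ p => ((jap p : ℝ) : ℂ)) := by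
  have hw : ∀ (_ : Unit) (p : Phase n), 0 ≤ jap p := fun _ p => (jap_pos p).le
  have h1 := (sym_japξ (n := n) hδ1).mono (linearScale_nonneg δ) (fun _ _ => le_rfl) hw
    ⟨1, zero_le_one, fun _ p => by simpa using japξ_le_jap p⟩
  have h2 := (sym_japη (n := n) (δ := δ)).mono (linearScale_nonneg δ) (fun _ _ => le_rfl) hw
    ⟨1, zero_le_one, fun _ p => by simpa using japη_le_jap p⟩
  simpa [jap] using h1.add h2

/-- Symbols which are controlled by the frequency `ξ`, with order `e`, when at most `X` derivatives
in `x` are taken. -/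
def FirstDominant (δ : ℝ) (X : ℕ) (e : ℝ) (τ : Phase n → ℂ) : Prop :=
  ∃ w : Phase n → ℝ, (∀ p, 0 ≤ w p) ∧ Sym axis (linearScale δ) (fun (_ : Unit) => w) (fun _ => τ) ∧
    ∃ C, 0 ≤ C ∧ ∀ p, w p * jap p ^ (δ / 2 * X) ≤ C * japξ p ^ (e / 2 + δ / 2 * X)

variable {X : ℕ} {e : ℝ} {τ : Phase n → ℂ}

lemma FirstDominant.contDiff (h : FirstDominant δ X e τ) : ContDiff ℝ ∞ τ := by
  obtain ⟨w, hw, hτ, -⟩ := h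
  exact hτ.contDiff ()

/-- Dropping x-derivatives divides the left side by a power of `jap` and the right side by the same
power of the smaller quantity `japξ`. -/
lemma jap_rpow_mul_le (hδ : 0 ≤ δ) {X X' : ℕ} (hX : X' ≤ X) {w C : ℝ} (hw : 0 ≤ w) {p : Phase n}
    (h : w * jap p ^ (δ / 2 * X) ≤ C * japξ p ^ (e / 2 + δ / 2 * X)) :
    w * jap p ^ (δ / 2 * X') ≤ C * japξ p ^ (e / 2 + δ / 2 * X') := by
  have h0 : (X' : ℝ) ≤ X := by exact_mod_cast hX
  set d := δ / 2 * X - δ / 2 * X' with hd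
  have hd0 : 0 ≤ d := by
    rw [hd, ← mul_sub]; exact mul_nonneg (by linarith) (by linarith)
  have h1 : jap p ^ (δ / 2 * X') = jap p ^ (δ / 2 * X) * jap p ^ (-d) := by
    rw [← Real.rpow_add (jap_pos p)]; congr 1; rw [hd]; ring
  have h2 : japξ p ^ (e / 2 + δ / 2 * X') = japξ p ^ (e / 2 + δ / 2 * X) * japξ p ^ (-d) := by
    rw [← Real.rpow_add (japξ_pos p)]; congr 1; rw [hd]; ring
  rw [h1, h2, ← mul_assoc, ← mul_assoc]
  refine mul_le_mul h ?_ (Real.rpow_pos_of_pos (jap_pos p) _).le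
    ((mul_nonneg hw (Real.rpow_pos_of_pos (jap_pos p) _).le).trans h)
  exact Real.rpow_le_rpow_of_nonpos (japξ_pos p) (japξ_le_jap p) (by linarith)

lemma FirstDominant.of_le (hδ : 0 ≤ δ) (h : FirstDominant δ X e τ) {X' : ℕ} (hX : X' ≤ X) :
    FirstDominant δ X' e τ := by
  obtain ⟨w, hw, hτ, C, hC, h⟩ := h
  exact ⟨w, hw, hτ, C, hC, fun p => jap_rpow_mul_le hδ hX (hw p) (h p)⟩

/-- One of the admissible x-derivatives is used up; it raises the order by δ. -/
lemma FirstDominant.dirDeriv_x (h : FirstDominant δ (X + 1) e τ) (l : Fin n) :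
    FirstDominant δ X (e + δ) (dirDeriv axis (xIdx l) τ) := by
  obtain ⟨w, hw, hτ, C, hC, h⟩ := h
  refine ⟨_, fun p => mul_nonneg (hw p) (linearScale_nonneg δ (xIdx l) p), hτ.dirDeriv (xIdx l), C, hC,
    fun p => ?_⟩
  have := h p
  rw [show linearScale δ (xIdx l) p = jap p ^ (δ / 2) from rfl, mul_assoc,
    ← Real.rpow_add (jap_pos p)]
  push_cast at this
  convert this using 3 <;> ring

/-- `japξ` is quadratic in |ξ|, so its power d changes the order by 2d. -/
lemma FirstDominant.mul_sym (h : FirstDominant δ X e τ) {d : ℝ} {ρ : Phase n → ℂ}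
    (hρ : Sym axis (linearScale δ) (fun (_ : Unit) p => japξ p ^ d) (fun _ => ρ)) :
    FirstDominant δ X (e + 2 * d) fun p => τ p * ρ p := by
  obtain ⟨w, hw, hτ, C, hC, h⟩ := h
  refine ⟨_, fun p => mul_nonneg (hw p) (Real.rpow_pos_of_pos (japξ_pos p) _).le, hτ.mul hρ, C, hC,
    fun p => ?_⟩
  have h1 : japξ p ^ ((e + 2 * d) / 2 + δ / 2 * X) = japξ p ^ (e / 2 + δ / 2 * X) * japξ p ^ d := by
    rw [← Real.rpow_add (japξ_pos p)]; congr 1; ring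
  rw [h1, ← mul_assoc, mul_right_comm]
  exact mul_le_mul_of_nonneg_right (h p) (Real.rpow_pos_of_pos (japξ_pos p) _).le

lemma FirstDominant.norm_le (hδ : 0 ≤ δ) (h : FirstDominant δ X e τ) :
    ∃ C, 0 ≤ C ∧ ∀ p, ‖τ p‖ ≤ C * japξ p ^ (e / 2) := by
  obtain ⟨w, hw, hτ, C, hC, h⟩ := h.of_le hδ (Nat.zero_le X)
  obtain ⟨-, D, hD, hb⟩ := hτ 0
  refine ⟨D * C, by positivity, fun p => (hb.zero () p).trans ?_⟩
  have := h p
  simp only [Nat.cast_zero, mul_zero, Real.rpow_zero, mul_one, add_zero] at this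
  rw [mul_assoc]
  exact mul_le_mul_of_nonneg_left this hD

lemma FirstDominant.mono_order (h : FirstDominant δ X e τ) {e' : ℝ} (he : e ≤ e') :
    FirstDominant δ X e' τ := by
  obtain ⟨w, hw, hτ, C, hC, h⟩ := h
  refine ⟨w, hw, hτ, C, hC, fun p => (h p).trans (mul_le_mul_of_nonneg_left ?_ hC)⟩
  exact Real.rpow_le_rpow_of_exponent_le (one_le_japξ p) (by linarith)

lemma FirstDominant.const_mul (h : FirstDominant δ X e τ) (c : ℂ) :
    FirstDominant δ X e fun p => τ p * c := by
  have hc : Sym (axis (n := n)) (linearScale δ) (fun (_ : Unit) p => japξ p ^ (0 : ℝ))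
      (fun _ _ => c) :=
    sym_const c (fun _ p => (Real.rpow_pos_of_pos (japξ_pos p) _).le) (linearScale_nonneg δ)
      ⟨‖c‖, norm_nonneg c, fun _ p => by simp⟩
  simpa using h.mul_sym hc

end LinearScale

/-! ### Dyadic decomposition in the first frequency -/

section Dyadic

variable {n : ℕ}

/-- A smooth cutoff, equal to `1` for `t ≤ 1` and to `0` for `t ≥ 2`. -/
noncomputable def chi (t : ℝ) : ℝ := 1 - Real.smoothTransition (t - 1)

lemma contDiff_chi : ContDiff ℝ ∞ chi :=
  contDiff_const.sub (Real.smoothTransition.contDiff.comp (contDiff_id.sub contDiff_const))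

lemma chi_of_le {t : ℝ} (ht : t ≤ 1) : chi t = 1 := by
  rw [chi, Real.smoothTransition.zero_of_nonpos (by linarith), sub_zero]

lemma chi_of_ge {t : ℝ} (ht : 2 ≤ t) : chi t = 0 := by
  rw [chi, Real.smoothTransition.one_of_one_le (by linarith), sub_self]

lemma chi_nonneg (t : ℝ) : 0 ≤ chi t := sub_nonneg.2 (Real.smoothTransition.le_one _)

lemma chi_le_one (t : ℝ) : chi t ≤ 1 := by
  have := Real.smoothTransition.nonneg (t - 1); rw [chi]; linarith

lemma antitone_chi : Antitone chi := fun s t h => by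
  have := Real.smoothTransition.monotone (show s - 1 ≤ t - 1 by linarith)
  simp only [chi]; linarith

/-- The smooth localization to `|ξ| ≲ 2^k`. -/
noncomputable def lowCut (k : ℕ) (ξ : Euc n) : ℝ := chi ((4 ^ k)⁻¹ * (1 + ‖ξ‖ ^ 2))

/-- The smooth localization to `|ξ| ∼ 2^k`. -/
noncomputable def dyad (k : ℕ) (ξ : Euc n) : ℝ :=
  chi ((4 ^ k)⁻¹ * (1 + ‖ξ‖ ^ 2)) - chi (4 * ((4 ^ k)⁻¹ * (1 + ‖ξ‖ ^ 2)))

/-- The profile of a localization which is `1` on the support of `dyad`. -/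
noncomputable def fatProfile (t : ℝ) : ℝ := chi (t / 4) - chi (16 * t)

/-- The sum telescopes; the lower end vanishes because 4(1 + |ξ|²) ≥ 2. -/
lemma sum_dyad (K : ℕ) (ξ : Euc n) : ∑ k ∈ Finset.range (K + 1), dyad k ξ = lowCut K ξ := by
  induction K with
  | zero =>
    have : chi (4 * (1 + ‖ξ‖ ^ 2)) = 0 := chi_of_ge (by nlinarith [sq_nonneg ‖ξ‖])
    simp [dyad, lowCut, this]
  | succ K ih =>
    rw [Finset.sum_range_succ, ih, dyad, lowCut, lowCut]
    have : 4 * (((4 : ℝ) ^ (K + 1))⁻¹ * (1 + ‖ξ‖ ^ 2)) = (4 ^ K)⁻¹ * (1 + ‖ξ‖ ^ 2) := by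
      rw [pow_succ]; field_simp
    rw [this]; ring

lemma dyad_nonneg (k : ℕ) (ξ : Euc n) : 0 ≤ dyad k ξ := by
  have : 0 ≤ ((4 : ℝ) ^ k)⁻¹ * (1 + ‖ξ‖ ^ 2) := by positivity
  exact sub_nonneg.2 (antitone_chi (by linarith))

lemma dyad_support {k : ℕ} {ξ : Euc n} (h : dyad k ξ ≠ 0) :
    1 / 4 ≤ ((4 : ℝ) ^ k)⁻¹ * (1 + ‖ξ‖ ^ 2) ∧ ((4 : ℝ) ^ k)⁻¹ * (1 + ‖ξ‖ ^ 2) ≤ 2 := by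
  constructor
  · by_contra! hlt
    exact h (by rw [dyad, chi_of_le (by linarith), chi_of_le (by linarith), sub_self])
  · by_contra! hlt
    exact h (by rw [dyad, chi_of_ge (by linarith), chi_of_ge (by linarith), sub_self])

lemma fatProfile_of_mem {t : ℝ} (h1 : 1 / 4 ≤ t) (h2 : t ≤ 2) : fatProfile t = 1 := by
  rw [fatProfile, chi_of_le (by linarith), chi_of_ge (by linarith), sub_zero]

lemma fatProfile_support {t : ℝ} (h : fatProfile t ≠ 0) : t ∈ Set.Icc (1 / 16 : ℝ) 16 := by
  constructor
  · by_contra! hlt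
    exact h (by rw [fatProfile, chi_of_le (by linarith), chi_of_le (by linarith), sub_self])
  · by_contra! hlt
    exact h (by rw [fatProfile, chi_of_ge (by linarith), chi_of_ge (by linarith), sub_self])

lemma tsupport_fatProfile : tsupport fatProfile ⊆ Set.Icc (1 / 16) 16 :=
  closure_minimal (fun _ h => fatProfile_support h) isClosed_Icc

lemma contDiff_fatProfile : ContDiff ℝ ∞ fatProfile :=
  (contDiff_chi.comp (contDiff_id.div_const 4)).sub (contDiff_chi.comp (contDiff_const.mul contDiff_id))

lemma contDiff_scaled_japξ (k : ℕ) : ContDiff ℝ ∞ fun ξ : Euc n => ((4 : ℝ) ^ k)⁻¹ * (1 + ‖ξ‖ ^ 2) :=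
  contDiff_const.mul (contDiff_const.add (contDiff_id.norm_sq ℝ))

lemma contDiff_lowCut (k : ℕ) : ContDiff ℝ ∞ (lowCut (n := n) k) :=
  contDiff_chi.comp (contDiff_scaled_japξ k)

lemma contDiff_dyad (k : ℕ) : ContDiff ℝ ∞ (dyad (n := n) k) :=
  (contDiff_chi.comp (contDiff_scaled_japξ k)).sub
    (contDiff_chi.comp (contDiff_const.mul (contDiff_scaled_japξ k)))

lemma hasCompactSupport_dyad (k : ℕ) : HasCompactSupport (dyad (n := n) k) := by
  refine HasCompactSupport.intro (isCompact_closedBall (0 : Euc n) (2 * 2 ^ k)) fun ξ hξ => ?_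
  by_contra h
  apply hξ
  rw [mem_closedBall_zero_iff]
  have h2 := (dyad_support h).2
  rw [inv_mul_le_iff₀ (by positivity)] at h2
  refine abs_le_of_sq_le_sq' ?_ (by positivity) |>.2
  have : (2 * (2 : ℝ) ^ k) ^ 2 = 4 * 4 ^ k := by
    rw [mul_pow, ← pow_mul, mul_comm k 2, pow_mul]; norm_num
  rw [this]
  have : (0 : ℝ) < 4 ^ k := by positivity
  linarith

end Dyadic

end BilinearPDO

namespace BilinearPDO

/-! ### The L² bound for one dyadic piece -/

section DyadicPiece

open SchwartzMap
open scoped SchwartzMap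

variable {n : ℕ} {δ e : ℝ} {τ : Phase n → ℂ}

lemma rpow_le_of_mem_Icc {c u : ℝ} (hc : 1 ≤ c) (h1 : c⁻¹ ≤ u) (h2 : u ≤ c) (q : ℝ) :
    u ^ q ≤ c ^ |q| := by
  have hc0 : 0 < c := by linarith
  have hu : 0 < u := (inv_pos.2 hc0).trans_le h1
  rcases le_total 0 q with hq | hq
  · rw [abs_of_nonneg hq]
    exact Real.rpow_le_rpow hu.le h2 hq
  · rw [abs_of_nonpos hq, Real.rpow_neg hc0.le, ← Real.inv_rpow hc0.le]
    exact Real.rpow_le_rpow_of_nonpos (inv_pos.2 hc0) h1 hq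

/-- On |ξ| ∼ 2^k a ξ-derivative gains λ⁻¹ with λ = 2^(δk). An x-derivative loses `jap`^(δ/2), which
may far exceed λ when η is large; the excess ratio is kept explicit, to be absorbed by the weight of
a ξ-dominated symbol. -/
lemma prod_linearScale_le (hδ : 0 ≤ δ) (hδ1 : δ ≤ 1) {k : ℕ} {p : Phase n}
    (hp : ((4 : ℝ) ^ k)⁻¹ * japξ p ∈ Set.Icc (1 / 16 : ℝ) 16) (L : List (Idx n)) :
    (L.map fun i => linearScale δ i p).prod ≤
      16 ^ L.length * (jap p ^ (δ / 2) * ((2 : ℝ) ^ (δ * k))⁻¹) ^ countX L *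
        (L.map (dilScale ((2 : ℝ) ^ (δ * k)))).prod := by
  set lam : ℝ := (2 : ℝ) ^ (δ * k) with hlam
  have hlam0 : 0 < lam := by positivity
  have hD0 : ∀ L : List (Idx n), 0 ≤ (L.map (dilScale lam)).prod := fun L =>
    List.prod_nonneg fun a ha => by
      obtain ⟨i, -, rfl⟩ := List.mem_map.1 ha
      rcases i with i | i | i
      · exact hlam0.le
      · exact (inv_pos.2 hlam0).le
      · exact zero_le_one
  have hR := Real.rpow_pos_of_pos (jap_pos p) (δ / 2)
  -- The ratio `japξ`/4^k lies between 1/16 and 16, and δ/2 ≤ 1.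
  have hξ : japξ p ^ (-(δ / 2)) ≤ 16 * lam⁻¹ := by
    have h4 : (0 : ℝ) < 4 ^ k := by positivity
    have e1 : japξ p = 4 ^ k * ((4 ^ k)⁻¹ * japξ p) := by field_simp
    have h0 : (0 : ℝ) < (4 ^ k)⁻¹ * japξ p := lt_of_lt_of_le (by norm_num) hp.1
    rw [e1, Real.mul_rpow h4.le h0.le, mul_comm]
    refine mul_le_mul ?_ (le_of_eq ?_) (by positivity) (by norm_num)
    · refine (rpow_le_of_mem_Icc (c := 16) (by norm_num) (by simpa using hp.1) hp.2 _).trans ?_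
      refine (Real.rpow_le_rpow_of_exponent_le (y := |-(δ / 2)|) (z := 1) (by norm_num) ?_).trans_eq
        (Real.rpow_one _)
      rw [abs_neg, abs_of_nonneg (by linarith)]; linarith
    · rw [hlam, ← Real.rpow_neg (by norm_num), ← Real.rpow_natCast, ← Real.rpow_mul (by norm_num),
        show (4 : ℝ) = 2 ^ (2 : ℝ) by norm_num, ← Real.rpow_mul (by norm_num)]
      congr 1; ring
  induction L with
  | nil => simp [countX]
  | cons i L ih =>
    rw [List.map_cons, List.prod_cons, List.map_cons, List.prod_cons, List.length_cons, pow_succ]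
    have hB : 0 ≤ 16 ^ L.length * (jap p ^ (δ / 2) * lam⁻¹) ^ countX L * (L.map (dilScale lam)).prod :=
      mul_nonneg (by positivity) (hD0 L)
    have hS := linearScale_nonneg δ i p
    rcases i with i | i | i
    · have hc : countX (Sum.inl i :: L) = countX L + 1 := by simp [countX, List.countP_cons]
      rw [hc, pow_succ]
      rw [show linearScale δ (Sum.inl i) p = jap p ^ (δ / 2) from rfl,
        show dilScale lam (Sum.inl i : Idx n) = lam from rfl]
      calc _ ≤ jap p ^ (δ / 2) * (16 ^ L.length * (jap p ^ (δ / 2) * lam⁻¹) ^ countX L *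
            (L.map (dilScale lam)).prod) := mul_le_mul_of_nonneg_left ih hR.le
        _ ≤ 16 * (jap p ^ (δ / 2) * (16 ^ L.length * (jap p ^ (δ / 2) * lam⁻¹) ^ countX L *
            (L.map (dilScale lam)).prod)) := by
            have := mul_nonneg hR.le hB
            linarith
        _ = _ := by field_simp
    · have hc : countX (Sum.inr (Sum.inl i) :: L) = countX L := by simp [countX]
      rw [hc, show linearScale δ (Sum.inr (Sum.inl i)) p = japξ p ^ (-(δ / 2)) from rfl,
        show dilScale lam (Sum.inr (Sum.inl i) : Idx n) = lam⁻¹ from rfl]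
      refine (mul_le_mul hξ ih ?_ (by positivity)).trans_eq (by ring)
      exact List.prod_nonneg fun a ha => by
        obtain ⟨i, -, rfl⟩ := List.mem_map.1 ha
        exact linearScale_nonneg δ i p
    · have hc : countX (Sum.inr (Sum.inr i) :: L) = countX L := by simp [countX]
      rw [hc, show linearScale δ (Sum.inr (Sum.inr i)) p = 1 from rfl,
        show dilScale lam (Sum.inr (Sum.inr i) : Idx n) = 1 from rfl, one_mul, one_mul]
      linarith

/-- Admissible weights in the frequency variable `η`. -/
structure FreqWeight (δ : ℝ) (wt : Euc n → ℝ) : Prop where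
  pos : ∀ η, 0 < wt η
  cont : Continuous wt
  integrable : Integrable wt
  sym : Sym (axis (n := n)) (linearScale δ) (fun (_ : Unit) p => wt p.2.2)
    (fun _ p => ((wt p.2.2 : ℝ) : ℂ))

/-- Domination by ξ is designed for this: it bounds the weight times the large powers of `jap` lost
in x by powers of ⟨ξ⟩ ∼ 2^k, so that the localized symbol has the single scale λ = 2^(δk), uniformly
in η. -/
lemma FirstDominant.exists_dilBound (hδ : 0 ≤ δ) (hδ1 : δ ≤ 1) (h : FirstDominant δ n e τ)
    {wt : Euc n → ℝ} (hwt : FreqWeight δ wt) (N : ℕ) : ∃ C, 0 ≤ C ∧ ∀ k : ℕ,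
    ContDiff ℝ ∞ (fun p => τ p * ((fatProfile ((4 ^ k)⁻¹ * japξ p) : ℝ) : ℂ) * ((wt p.2.2 : ℝ) : ℂ)) ∧
    DilBound ((2 : ℝ) ^ (δ * k)) wt n N (C * (2 : ℝ) ^ (e * k)) fun p =>
      τ p * ((fatProfile ((4 ^ k)⁻¹ * japξ p) : ℝ) : ℂ) * ((wt p.2.2 : ℝ) : ℂ) := by
  obtain ⟨w, hw, hτ, C, hC, hwC⟩ := h
  have hcut := Sym.cutoff (κ := ℕ) (linearScale_nonneg δ) japξ_pos contDiff_japξ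
    ((sym_japξ (n := n) hδ1).comp fun _ => ()) (fun k => ((4 : ℝ) ^ k)⁻¹) contDiff_fatProfile
    tsupport_fatProfile
  have hS := ((hτ.comp fun _ : ℕ => ()).mul hcut).mul (hwt.sym.comp fun _ => ())
  obtain ⟨hsm, D, hD, hb⟩ := hS N
  -- Bound for powers of the ratio `japξ`/4^k with exponent e/2 + (δ/2) · (number of x-derivatives),
  -- for at most n such derivatives.
  set E : ℝ := 16 ^ (|e| / 2 + δ / 2 * n) with hE
  refine ⟨D * (16 ^ N * (C * E)), by positivity, fun k => ⟨hsm k, fun L hX hN p => ?_⟩⟩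
  refine (hb.dirDerivs L hN k p).trans ?_
  set lam : ℝ := (2 : ℝ) ^ (δ * k) with hlam
  have hlam0 : 0 < lam := by positivity
  have hD0 : 0 ≤ (L.map (dilScale lam)).prod :=
    List.prod_nonneg fun a ha => by
      obtain ⟨i, -, rfl⟩ := List.mem_map.1 ha
      rcases i with i | i | i
      · exact hlam0.le
      · exact (inv_pos.2 hlam0).le
      · exact zero_le_one
  by_cases hp : ((4 : ℝ) ^ k)⁻¹ * japξ p ∈ Set.Icc (1 / 16 : ℝ) 16
  swap
  · rw [Set.indicator_of_notMem hp]
    have : 0 ≤ wt p.2.2 := (hwt.pos _).le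
    simp only [mul_zero, zero_mul]
    positivity
  rw [Set.indicator_of_mem hp, Pi.one_apply, mul_one]
  have hprod := prod_linearScale_le hδ hδ1 hp L
  rw [← hlam] at hprod
  have key : w p * (jap p ^ (δ / 2) * lam⁻¹) ^ countX L ≤ C * E * (2 : ℝ) ^ (e * k) := by
    have h1 := jap_rpow_mul_le hδ hX (hw p) (hwC p)
    rw [mul_pow, ← mul_assoc, ← Real.rpow_natCast (_ ^ _), ← Real.rpow_mul (jap_pos p).le]
    refine (mul_le_mul_of_nonneg_right h1 (by positivity)).trans ?_
    rw [mul_assoc, mul_assoc]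
    refine mul_le_mul_of_nonneg_left ?_ hC
    have h4 : (0 : ℝ) < 4 ^ k := by positivity
    have e1 : japξ p = 4 ^ k * ((4 ^ k)⁻¹ * japξ p) := by field_simp
    have h0 : (0 : ℝ) < (4 ^ k)⁻¹ * japξ p := lt_of_lt_of_le (by norm_num) hp.1
    set q := e / 2 + δ / 2 * countX L with hq
    have h2 : ((4 : ℝ) ^ k) ^ q * lam⁻¹ ^ countX L = (2 : ℝ) ^ (e * k) := by
      rw [hlam, ← Real.rpow_neg (by norm_num), ← Real.rpow_natCast 4, ← Real.rpow_mul (by norm_num),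
        show (4 : ℝ) = 2 ^ (2 : ℝ) by norm_num, ← Real.rpow_mul (by norm_num),
        ← Real.rpow_natCast (_ ^ _), ← Real.rpow_mul (by norm_num), ← Real.rpow_add (by norm_num)]
      congr 1
      rw [hq]; ring
    have h3 : ((4 ^ k)⁻¹ * japξ p) ^ q ≤ E := by
      refine (rpow_le_of_mem_Icc (c := 16) (by norm_num) (by simpa using hp.1) hp.2 _).trans ?_
      refine Real.rpow_le_rpow_of_exponent_le (by norm_num) ?_
      have hx : (countX L : ℝ) ≤ n := by exact_mod_cast hX
      have h5 : 0 ≤ δ / 2 * countX L := by positivity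
      have h6 : δ / 2 * countX L ≤ δ / 2 * n := mul_le_mul_of_nonneg_left hx (by linarith)
      have h7 := le_abs_self e
      have h8 := neg_abs_le e
      rw [abs_le]
      constructor <;> linarith
    rw [e1, Real.mul_rpow h4.le h0.le, mul_right_comm, h2, mul_comm]
    exact mul_le_mul_of_nonneg_right h3 (by positivity)
  have h16 : (16 : ℝ) ^ L.length ≤ 16 ^ N := pow_le_pow_right₀ (by norm_num) hN
  calc D * (w p * wt p.2.2) * (L.map fun i => linearScale δ i p).prod
      ≤ D * (w p * wt p.2.2) * (16 ^ L.length * (jap p ^ (δ / 2) * lam⁻¹) ^ countX L *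
        (L.map (dilScale lam)).prod) :=
        mul_le_mul_of_nonneg_left hprod (mul_nonneg hD (mul_nonneg (hw p) (hwt.pos _).le))
    _ = D * wt p.2.2 * (L.map (dilScale lam)).prod *
        (16 ^ L.length * (w p * (jap p ^ (δ / 2) * lam⁻¹) ^ countX L)) := by ring
    _ ≤ D * wt p.2.2 * (L.map (dilScale lam)).prod *
        (16 ^ N * (C * E * (2 : ℝ) ^ (e * k))) := by
        refine mul_le_mul_of_nonneg_left ?_
          (mul_nonneg (mul_nonneg hD (hwt.pos _).le) hD0)
        refine mul_le_mul h16 key ?_ (by positivity)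
        exact mul_nonneg (hw p) (pow_nonneg (mul_nonneg (Real.rpow_pos_of_pos (jap_pos p) _).le
          (inv_pos.2 hlam0).le) _)
    _ = _ := by ring

/-- The Fourier transforms of functions of size `B`, multiplied by the weight `wt`. -/
def WeightedTransform (wt : Euc n → ℝ) (B : ℝ≥0∞) (H : Euc n → ℂ) : Prop :=
  ∃ G : Euc n → ℂ, Continuous G ∧ Integrable G ∧ (∀ y, ‖G y‖ₑ ≤ B) ∧
    H = fun η => ((wt η : ℝ) : ℂ) * fourier G η

/-- The `L²` bound for a dyadic piece of a symbol of order `e`. -/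
lemma FirstDominant.exists_eLpNorm_piece_le (hδ : 0 ≤ δ) (hδ1 : δ ≤ 1) (h : FirstDominant δ n e τ)
    {wt : Euc n → ℝ} (hwt : FreqWeight δ wt) : ∃ C : ℝ≥0, ∀ (k : ℕ) (F : 𝓢(Euc n, ℂ)),
    (∀ ξ, F ξ ≠ 0 → dyad k ξ ≠ 0) → ∀ {B : ℝ≥0∞} {H : Euc n → ℂ}, WeightedTransform wt B H →
    eLpNorm (bilin τ F H) 2 volume ≤ C * ENNReal.ofReal ((2 : ℝ) ^ (e * k)) * B * eLpNorm F 2 volume := by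
  obtain ⟨C, hC, hb⟩ := h.exists_dilBound hδ hδ1 hwt (4 * n)
  obtain ⟨D, hD, hpiece⟩ := exists_eLpNorm_bilin_le wt hwt.pos hwt.cont hwt.integrable
  refine ⟨D.toNNReal * C.toNNReal, fun k F hF B H hH => ?_⟩
  obtain ⟨G, hGc, hGi, hGB, rfl⟩ := hH
  obtain ⟨hsm, hdil⟩ := hb k
  have hsupp : tsupport (fun p => τ p * ((fatProfile ((4 ^ k)⁻¹ * japξ p) : ℝ) : ℂ) *
      ((wt p.2.2 : ℝ) : ℂ)) ⊆ {p : Phase n | p.2.1 ∈ Metric.closedBall (0 : Euc n) (4 * 2 ^ k)} := by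
    refine closure_minimal (fun p hp => ?_)
      (Metric.isClosed_closedBall.preimage (continuous_fst.comp continuous_snd))
    have h1 : fatProfile ((4 ^ k)⁻¹ * japξ p) ≠ 0 := fun h0 => hp (by simp [h0])
    have h2 := (fatProfile_support h1).2
    rw [inv_mul_le_iff₀ (by positivity), japξ] at h2
    rw [Set.mem_ofPred_eq, mem_closedBall_zero_iff]
    refine (abs_le_of_sq_le_sq' ?_ (by positivity)).2
    have : (4 * (2 : ℝ) ^ k) ^ 2 = 4 ^ k * 16 := by
      rw [mul_pow, ← pow_mul, mul_comm k 2, pow_mul]; norm_num; ring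
    rw [this]
    linarith
  have := hpiece (Real.one_le_rpow one_le_two (by positivity)) (by positivity) hsm
    (isCompact_closedBall _ _) hsupp hdil F hGc hGi hGB
  -- The fattened cutoff equals 1 wherever F is nonzero, so it can be inserted at no cost; the
  -- weight moves from the second argument into the symbol.
  have e1 : bilin τ F (fun η => ((wt η : ℝ) : ℂ) * fourier G η) =
      bilin (fun p => τ p * ((fatProfile ((4 ^ k)⁻¹ * japξ p) : ℝ) : ℂ) * ((wt p.2.2 : ℝ) : ℂ)) F
        (fourier G) := by
    funext x
    refine integral_congr_ae (Filter.Eventually.of_forall fun q => ?_)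
    simp only
    by_cases h0 : F q.1 = 0
    · simp [h0]
    · have h1 := dyad_support (hF _ h0)
      rw [show fatProfile ((4 ^ k)⁻¹ * japξ ((x, q.1, q.2) : Phase n)) = 1 from
        fatProfile_of_mem h1.1 h1.2]
      push_cast
      ring
  rw [e1]
  refine this.trans_eq ?_
  rw [ENNReal.ofReal_mul hC, ENNReal.coe_mul, ENNReal.coe_toNNReal hD]
  simp only [ENNReal.ofReal]
  ring

end DyadicPiece

end BilinearPDO

namespace BilinearPDO

/-! ### Convergence and x-derivatives of the bilinear operator -/

section Derivatives

open SchwartzMap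
open scoped SchwartzMap

variable {n : ℕ} {δ e : ℝ} {X : ℕ} {τ a : Phase n → ℂ}

lemma Continuous.expI {Y : Type*} [TopologicalSpace Y] {f g : Y → Euc n} (hf : Continuous f)
    (hg : Continuous g) : Continuous fun y => BilinearPDO.expI (f y) (g y) := by
  unfold BilinearPDO.expI
  exact Complex.continuous_exp.comp (continuous_const.mul
    (Complex.continuous_ofReal.comp (hf.inner hg)))

lemma continuous_fourier {G : Euc n → ℂ} (hGc : Continuous G) (hG : Integrable G) :
    Continuous (fourier G) := by
  have hE1 : ∀ η : Euc n, Continuous fun y : Euc n => expI (-y) η := fun η =>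
    Continuous.expI continuous_neg continuous_const
  have hE2 : ∀ y : Euc n, Continuous fun η : Euc n => expI (-y) η := fun y =>
    Continuous.expI continuous_const continuous_id
  refine continuous_of_dominated (F := fun η y => expI (-y) η * G y) (bound := fun y => ‖G y‖)
    (fun η => ?_) (fun η => Filter.Eventually.of_forall fun y => ?_) hG.norm
    (Filter.Eventually.of_forall fun y => ?_)
  · exact ((hE1 η).mul hGc).aestronglyMeasurable
  · rw [norm_mul, norm_expI, one_mul]
  · exact (hE2 y).mul continuous_const

lemma WeightedTransform.continuous {wt : Euc n → ℝ} (hwt : FreqWeight δ wt) {B : ℝ≥0∞}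
    {H : Euc n → ℂ} (h : WeightedTransform wt B H) : Continuous H := by
  obtain ⟨G, hGc, hG, -, rfl⟩ := h
  exact (Complex.continuous_ofReal.comp hwt.cont).mul (continuous_fourier hGc hG)

lemma WeightedTransform.integrable {wt : Euc n → ℝ} (hwt : FreqWeight δ wt) {B : ℝ≥0∞}
    {H : Euc n → ℂ} (h : WeightedTransform wt B H) : Integrable H := by
  have hc := h.continuous hwt
  obtain ⟨G, hGc, hG, -, rfl⟩ := h
  refine (hwt.integrable.mul_const (∫ y, ‖G y‖)).mono' hc.aestronglyMeasurable
    (Filter.Eventually.of_forall fun η => ?_)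
  rw [norm_mul, Complex.norm_real, Real.norm_of_nonneg (hwt.pos η).le]
  exact mul_le_mul_of_nonneg_left (norm_fourier_le G η) (hwt.pos η).le

lemma integrable_japξ_rpow_mul (F : 𝓢(Euc n, ℂ)) (M : ℝ) :
    Integrable fun ξ => (1 + ‖ξ‖ ^ 2) ^ M * ‖F ξ‖ := by
  have ht := Function.hasTemperateGrowth_one_add_norm_sq_rpow (H := Euc n) M
  refine (SchwartzMap.integrable (smulLeftCLM ℂ (fun ξ : Euc n => (1 + ‖ξ‖ ^ 2) ^ M) F)).norm.congr
    (Filter.Eventually.of_forall fun ξ => ?_)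
  simp only
  rw [smulLeftCLM_apply_apply ht, norm_smul, Real.norm_of_nonneg (by positivity)]

/-- The integrand of `bilin`. -/
noncomputable def bilinKernel (a : Phase n → ℂ) (F H : Euc n → ℂ) (x : Euc n) (q : Euc n × Euc n) : ℂ :=
  a (x, q.1, q.2) * F q.1 * H q.2 * expI x (q.1 + q.2)

lemma continuous_bilinKernel (ha : Continuous a) {F H : Euc n → ℂ} (hF : Continuous F)
    (hH : Continuous H) :
    Continuous fun r : Euc n × (Euc n × Euc n) => bilinKernel a F H r.1 r.2 := by
  have p1 : Continuous fun r : Euc n × (Euc n × Euc n) => r.2.1 := continuous_fst.comp continuous_snd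
  have p2 : Continuous fun r : Euc n × (Euc n × Euc n) => r.2.2 := continuous_snd.comp continuous_snd
  have h0 : Continuous fun r : Euc n × (Euc n × Euc n) => a (r.1, r.2.1, r.2.2) := ha
  have h1 : Continuous fun r : Euc n × (Euc n × Euc n) => F r.2.1 := hF.comp p1
  have h2 : Continuous fun r : Euc n × (Euc n × Euc n) => H r.2.2 := hH.comp p2
  have h3 : Continuous fun r : Euc n × (Euc n × Euc n) => expI r.1 (r.2.1 + r.2.2) :=
    Continuous.expI continuous_fst (p1.add p2)
  exact ((h0.mul h1).mul h2).mul h3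

/-- Growth of the symbol in ξ is absorbed by the Schwartz function F, and integrability in η is left
to H. The majorant is independent of x, as needed for dominated convergence and for differentiating
under the integral. -/
lemma FirstDominant.exists_bound (hδ : 0 ≤ δ) (ha : FirstDominant δ X e a) (F : 𝓢(Euc n, ℂ))
    {H : Euc n → ℂ} (hH : Integrable H) : ∃ b : Euc n × Euc n → ℝ, Integrable b ∧
    ∀ x q, ‖bilinKernel a F H x q‖ ≤ b q := by
  obtain ⟨D, hD, hb⟩ := ha.norm_le hδ
  refine ⟨fun q => (D * ((1 + ‖q.1‖ ^ 2) ^ (e / 2) * ‖F q.1‖)) * ‖H q.2‖,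
    ((integrable_japξ_rpow_mul F (e / 2)).const_mul D).mul_prod hH.norm, fun x q => ?_⟩
  simp only
  rw [bilinKernel, norm_mul_expI, norm_mul, norm_mul, ← mul_assoc]
  exact mul_le_mul_of_nonneg_right (mul_le_mul_of_nonneg_right (hb _) (norm_nonneg _)) (norm_nonneg _)

lemma FirstDominant.integrable_bilinKernel (hδ : 0 ≤ δ) (ha : FirstDominant δ X e a)
    (F : 𝓢(Euc n, ℂ)) {H : Euc n → ℂ} (hHc : Continuous H) (hH : Integrable H) (x : Euc n) :
    Integrable (bilinKernel a F H x) := by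
  obtain ⟨b, hb, hab⟩ := ha.exists_bound hδ F hH
  exact hb.mono' ((continuous_bilinKernel ha.contDiff.continuous F.continuous hHc).comp
    (continuous_const.prodMk continuous_id)).aestronglyMeasurable
    (Filter.Eventually.of_forall fun q => hab x q)

lemma FirstDominant.continuous_bilin (hδ : 0 ≤ δ) (ha : FirstDominant δ X e a)
    (F : 𝓢(Euc n, ℂ)) {H : Euc n → ℂ} (hHc : Continuous H) (hH : Integrable H) :
    Continuous (bilin a F H) := by
  obtain ⟨b, hb, hab⟩ := ha.exists_bound hδ F hH
  have hc := continuous_bilinKernel ha.contDiff.continuous F.continuous hHc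
  refine continuous_of_dominated (F := bilinKernel a F H) (bound := b)
    (fun x => (hc.comp (continuous_const.prodMk continuous_id)).aestronglyMeasurable)
    (fun x => Filter.Eventually.of_forall fun q => hab x q) hb
    (Filter.Eventually.of_forall fun q => hc.comp (continuous_id.prodMk continuous_const))

lemma FirstDominant.bilin_add (hδ : 0 ≤ δ) {X' : ℕ} {e' : ℝ} {a' : Phase n → ℂ}
    (ha : FirstDominant δ X e a) (ha' : FirstDominant δ X' e' a') (F : 𝓢(Euc n, ℂ)) {H : Euc n → ℂ}
    (hHc : Continuous H) (hH : Integrable H) (x : Euc n) :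
    bilin (fun p => a p + a' p) F H x = bilin a F H x + bilin a' F H x := by
  have := integral_add (ha.integrable_bilinKernel hδ F hHc hH x)
    (ha'.integrable_bilinKernel hδ F hHc hH x)
  refine Eq.trans (integral_congr_ae (Filter.Eventually.of_forall fun q => ?_)) this
  simp only [bilinKernel]
  ring

lemma hasDerivAt_expI (x ξ : Euc n) (l : Fin n) (t : ℝ) :
    HasDerivAt (fun t : ℝ => expI (x + t • basisVec l) ξ)
      (Complex.I * ((ξ l : ℝ) : ℂ) * expI (x + t • basisVec l) ξ) t := by
  have h0 : ∀ t : ℝ, inner ℝ (x + t • basisVec l) ξ = inner ℝ x ξ + t * ξ l := fun t => by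
    rw [inner_add_left, inner_smul_left, basisVec, EuclideanSpace.inner_single_left]
    simp
  have h1 : HasDerivAt (fun t : ℝ => (inner ℝ x ξ + t * ξ l : ℝ)) (ξ l) t := by
    simpa using ((hasDerivAt_id t).mul_const (ξ l)).const_add (inner ℝ x ξ)
  have h2 := ((h1.ofReal_comp).const_mul Complex.I).cexp
  simp only [expI, h0]
  convert h2 using 1
  ring

/-- Multiplication of a symbol by `iξ_l`. -/
noncomputable def mulξ (l : Fin n) (a : Phase n → ℂ) (p : Phase n) : ℂ :=
  a p * (Complex.I * ((p.2.1 l : ℝ) : ℂ))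

/-- Multiplication by `iη_l`. -/
noncomputable def mulη (l : Fin n) (H : Euc n → ℂ) (η : Euc n) : ℂ := Complex.I * ((η l : ℝ) : ℂ) * H η

lemma FirstDominant.mulξ (hδ1 : δ ≤ 1) (ha : FirstDominant δ X e a) (l : Fin n) :
    FirstDominant δ X (e + 1) (BilinearPDO.mulξ l a) := by
  have := (ha.mul_sym (sym_ξ_coord hδ1 l)).const_mul Complex.I
  have e1 : (BilinearPDO.mulξ l a) = fun p => a p * ((p.2.1 l : ℝ) : ℂ) * Complex.I := by
    funext p; simp only [BilinearPDO.mulξ]; ring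
  rw [e1]
  convert this using 1
  ring

lemma continuous_mulη (l : Fin n) {H : Euc n → ℂ} (hH : Continuous H) : Continuous (mulη l H) := by
  refine (continuous_const.mul (Complex.continuous_ofReal.comp ?_)).mul hH
  exact (EuclideanSpace.proj (𝕜 := ℝ) l).continuous

/-- The three terms come from the x-dependence of the symbol and from the factors iξ_l and iη_l of
the exponential. -/
lemma FirstDominant.hasLineDerivAt_bilin (hδ : 0 ≤ δ) (hδ1 : δ ≤ 1) (ha : FirstDominant δ (X + 1) e a)
    (F : 𝓢(Euc n, ℂ)) {H : Euc n → ℂ} (hHc : Continuous H) (hH : Integrable H) (l : Fin n)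
    (hHl : Integrable (mulη l H)) (x : Euc n) :
    HasLineDerivAt ℝ (bilin a F H) (bilin (dirDeriv axis (xIdx l) a) F H x +
      bilin (BilinearPDO.mulξ l a) F H x + bilin a F (mulη l H) x) x (basisVec l) := by
  have ha1 := ha.dirDeriv_x l
  have ha2 := ha.mulξ hδ1 l
  have hHlc := continuous_mulη l hHc
  obtain ⟨b1, hb1, hab1⟩ := ha1.exists_bound hδ F hH
  obtain ⟨b2, hb2, hab2⟩ := ha2.exists_bound hδ F hH
  obtain ⟨b3, hb3, hab3⟩ := ha.exists_bound hδ F hHl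
  have i1 := ha1.integrable_bilinKernel hδ F hHc hH
  have i2 := ha2.integrable_bilinKernel hδ F hHc hH
  have i3 := ha.integrable_bilinKernel hδ F hHlc hHl
  have i0 := ha.integrable_bilinKernel hδ F hHc hH
  have hd : ∀ (q : Euc n × Euc n) (t : ℝ), HasDerivAt (fun t : ℝ => bilinKernel a F H (x + t • basisVec l) q)
      (bilinKernel (dirDeriv axis (xIdx l) a) F H (x + t • basisVec l) q +
        bilinKernel (BilinearPDO.mulξ l a) F H (x + t • basisVec l) q +
        bilinKernel a F (mulη l H) (x + t • basisVec l) q) t := by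
    intro q t
    have h1 := hasDerivAt_line ha.contDiff (x, q.1, q.2) (axis (xIdx l)) t
    have e0 : ∀ t : ℝ, ((x, q.1, q.2) : Phase n) + t • axis (xIdx l) = (x + t • basisVec l, q.1, q.2) :=
      fun t => by simp [axis]
    simp only [e0] at h1
    have h2 := ((h1.mul_const (F q.1)).mul_const (H q.2)).mul (hasDerivAt_expI x (q.1 + q.2) l t)
    refine h2.congr_deriv ?_
    simp only [bilinKernel, dirDeriv, BilinearPDO.mulξ, mulη, PiLp.add_apply, Complex.ofReal_add]
    ring
  have key := hasDerivAt_integral_of_dominated_loc_of_deriv_le (μ := (volume : Measure (Euc n × Euc n)))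
    (F := fun (t : ℝ) q => bilinKernel a F H (x + t • basisVec l) q)
    (F' := fun (t : ℝ) q => bilinKernel (dirDeriv axis (xIdx l) a) F H (x + t • basisVec l) q +
        bilinKernel (BilinearPDO.mulξ l a) F H (x + t • basisVec l) q +
        bilinKernel a F (mulη l H) (x + t • basisVec l) q) (x₀ := 0) (s := Set.univ)
    (bound := fun q => b1 q + b2 q + b3 q) Filter.univ_mem
    (Filter.Eventually.of_forall fun t => (i0 _).aestronglyMeasurable) (i0 _)
    (((i1 _).add (i2 _)).add (i3 _)).aestronglyMeasurable
    (Filter.Eventually.of_forall fun q t _ => norm_add₃_le.trans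
      (add_le_add (add_le_add (hab1 _ q) (hab2 _ q)) (hab3 _ q)))
    ((hb1.add hb2).add hb3) (Filter.Eventually.of_forall fun q t _ => hd q t)
  have h2 := key.2
  simp only [zero_smul, add_zero] at h2
  have e1 : ∫ q, (bilinKernel (dirDeriv axis (xIdx l) a) F H x q +
      bilinKernel (BilinearPDO.mulξ l a) F H x q + bilinKernel a F (mulη l H) x q) =
      bilin (dirDeriv axis (xIdx l) a) F H x + bilin (BilinearPDO.mulξ l a) F H x +
        bilin a F (mulη l H) x :=
    (integral_add ((i1 x).add (i2 x)) (i3 x)).trans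
      (congrArg (· + bilin a F (mulη l H) x) (integral_add (i1 x) (i2 x)))
  rw [e1] at h2
  exact h2

end Derivatives

/-! ### The real L² pairing and integration by parts -/

section Pairing

variable {n : ℕ}

/-- The real pairing of two functions. -/
noncomputable def pairing (u v : Euc n → ℂ) : ℝ := ∫ x, inner ℝ (u x) (v x)

lemma integrable_pairing {u v : Euc n → ℂ} (hu : MemLp u 2 volume) (hv : MemLp v 2 volume) :
    Integrable fun x => inner ℝ (u x) (v x) := by
  have h := MemLp.integrable_mul hu.norm hv.norm
  refine h.mono' (hu.aestronglyMeasurable.inner hv.aestronglyMeasurable)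
    (Filter.Eventually.of_forall fun x => ?_)
  exact norm_inner_le_norm _ _

lemma enorm_pairing_le {u v : Euc n → ℂ} (hu : MemLp u 2 volume) (hv : MemLp v 2 volume) :
    ‖pairing u v‖ₑ ≤ eLpNorm u 2 volume * eLpNorm v 2 volume := by
  refine (enorm_integral_le_lintegral_enorm _).trans ?_
  refine (ENNReal.pow_le_pow_left_iff two_ne_zero).1 ?_
  rw [mul_pow, eLpNorm_two_sq, eLpNorm_two_sq]
  refine le_trans ?_ (lintegral_mul_sq_le volume hu.aestronglyMeasurable.enorm
    hv.aestronglyMeasurable.enorm)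
  refine pow_le_pow_left₀ zero_le (lintegral_mono fun x => ?_) 2
  rw [← ofReal_norm, ← ofReal_norm, ← ofReal_norm, ← ENNReal.ofReal_mul (norm_nonneg _)]
  exact ENNReal.ofReal_le_ofReal (norm_inner_le_norm _ _)

lemma pairing_add_right {u v w : Euc n → ℂ} (hu : MemLp u 2 volume) (hv : MemLp v 2 volume)
    (hw : MemLp w 2 volume) : pairing u (fun x => v x + w x) = pairing u v + pairing u w := by
  rw [pairing, pairing, pairing, ← integral_add (integrable_pairing hu hv) (integrable_pairing hu hw)]
  simp only [inner_add_right]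

lemma pairing_comm (u v : Euc n → ℂ) : pairing u v = pairing v u := by
  simp only [pairing, real_inner_comm]

lemma pairing_lineDeriv {u v u' v' : Euc n → ℂ} (l : Fin n) (hu : MemLp u 2 volume)
    (hv : MemLp v 2 volume) (hu' : MemLp u' 2 volume) (hv' : MemLp v' 2 volume)
    (hud : ∀ x, HasLineDerivAt ℝ u (u' x) x (basisVec l))
    (hvd : ∀ x, HasLineDerivAt ℝ v (v' x) x (basisVec l)) :
    pairing u v' = - pairing u' v :=
  integral_bilinear_hasLineDerivAt_right_eq_neg_left_of_integrable (B := innerSL ℝ)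
    (integrable_pairing hu' hv) (integrable_pairing hu hv') (integrable_pairing hu hv)
    (fun x _ => hud x) fun x _ => hvd x

end Pairing

end BilinearPDO

namespace BilinearPDO

/-! ### Almost orthogonality of the dyadic pieces -/

section AlmostOrthogonality

open SchwartzMap
open scoped SchwartzMap

variable {n : ℕ} {δ e m : ℝ} {X : ℕ} {τ a b c : Phase n → ℂ} {wt : Euc n → ℝ}

lemma FirstDominant.add (ha : FirstDominant δ X e a) (hb : FirstDominant δ X e b) :
    FirstDominant δ X e fun p => a p + b p := by
  obtain ⟨w, hw, ha, C, hC, hwC⟩ := ha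
  obtain ⟨w', hw', hb, C', hC', hwC'⟩ := hb
  have hs : ∀ (_ : Unit) p, 0 ≤ w p + w' p := fun _ p => add_nonneg (hw p) (hw' p)
  refine ⟨fun p => w p + w' p, fun p => hs () p,
    (ha.mono (linearScale_nonneg δ) (fun _ _ => le_rfl) hs
      ⟨1, zero_le_one, fun _ p => by linarith [hw' p]⟩).add
    (hb.mono (linearScale_nonneg δ) (fun _ _ => le_rfl) hs
      ⟨1, zero_le_one, fun _ p => by linarith [hw p]⟩), C + C', by positivity, fun p => ?_⟩
  linarith [hwC p, hwC' p]

/-- Schwartz functions with frequencies of size `2^k`. -/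
def DyadicSupport (k : ℕ) (F : 𝓢(Euc n, ℂ)) : Prop := ∀ ξ, F ξ ≠ 0 → dyad k ξ ≠ 0

lemma FirstDominant.memLp_bilin (hδ : 0 ≤ δ) (hδ1 : δ ≤ 1) (ha : FirstDominant δ n e a)
    (hwt : FreqWeight δ wt) {k : ℕ} {F : 𝓢(Euc n, ℂ)} (hF : DyadicSupport k F) {B : ℝ≥0∞}
    (hB : B ≠ ⊤) {H : Euc n → ℂ} (hH : WeightedTransform wt B H) :
    MemLp (bilin a F H) 2 volume := by
  have h1 := ha.continuous_bilin hδ F (hH.continuous hwt) (hH.integrable hwt)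
  obtain ⟨C, hC⟩ := ha.exists_eLpNorm_piece_le hδ hδ1 hwt
  have hF2 : eLpNorm F 2 volume < ⊤ := (F.memLp 2 volume).eLpNorm_lt_top
  have h2 : C * ENNReal.ofReal ((2 : ℝ) ^ (e * k)) * B * eLpNorm F 2 volume < ⊤ :=
    ENNReal.mul_lt_top (ENNReal.mul_lt_top (ENNReal.mul_lt_top ENNReal.coe_lt_top
      ENNReal.ofReal_lt_top) hB.lt_top) hF2
  exact ⟨h1.aestronglyMeasurable, (hC k F hF hH).trans_lt h2⟩

/-- The decay in the almost orthogonality estimates. -/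
noncomputable def orthFactor (m δ : ℝ) (j k : ℕ) : ℝ≥0∞ :=
  ENNReal.ofReal ((2 : ℝ) ^ (m * j + m * k - (1 - δ) * (k - j)))

/-- Cauchy–Schwarz and the bounds for single pieces. It already yields off-diagonal decay when the
orders satisfy the stated inequality, which happens once the higher frequency has lost order. -/
lemma exists_pairing_le (hδ : 0 ≤ δ) (hδ1 : δ ≤ 1) (hwt : FreqWeight δ wt) {e₁ e₂ : ℝ}
    (ha : FirstDominant δ n e₁ a) (hb : FirstDominant δ n e₂ b)
    (he : ∀ j k : ℝ, 0 ≤ j → j ≤ k → e₁ * j + e₂ * k ≤ m * j + m * k - (1 - δ) * (k - j)) :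
    ∃ C : ℝ≥0, ∀ j k : ℕ, j ≤ k → ∀ F₁ F₂ : 𝓢(Euc n, ℂ), DyadicSupport j F₁ → DyadicSupport k F₂ →
      ∀ {B : ℝ≥0∞} {H₁ H₂ : Euc n → ℂ}, B ≠ ⊤ → WeightedTransform wt B H₁ → WeightedTransform wt B H₂ →
      ‖pairing (bilin a F₁ H₁) (bilin b F₂ H₂)‖ₑ ≤
        C * (orthFactor m δ j k * B ^ 2 * (eLpNorm F₁ 2 volume * eLpNorm F₂ 2 volume)) := by
  obtain ⟨C₁, h₁⟩ := ha.exists_eLpNorm_piece_le hδ hδ1 hwt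
  obtain ⟨C₂, h₂⟩ := hb.exists_eLpNorm_piece_le hδ hδ1 hwt
  refine ⟨C₁ * C₂, fun j k hjk F₁ F₂ hF₁ hF₂ B H₁ H₂ hB hH₁ hH₂ => ?_⟩
  refine (enorm_pairing_le (ha.memLp_bilin hδ hδ1 hwt hF₁ hB hH₁)
    (hb.memLp_bilin hδ hδ1 hwt hF₂ hB hH₂)).trans ((mul_le_mul' (h₁ j F₁ hF₁ hH₁)
    (h₂ k F₂ hF₂ hH₂)).trans ?_)
  have hf : ENNReal.ofReal ((2 : ℝ) ^ (e₁ * j)) * ENNReal.ofReal ((2 : ℝ) ^ (e₂ * k)) ≤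
      orthFactor m δ j k := by
    rw [← ENNReal.ofReal_mul (by positivity), ← Real.rpow_add (by norm_num)]
    exact ENNReal.ofReal_le_ofReal (Real.rpow_le_rpow_of_exponent_le (by norm_num)
      (he j k (Nat.cast_nonneg j) (Nat.cast_le.2 hjk)))
  calc _ = (C₁ * C₂ : ℝ≥0∞) * ((ENNReal.ofReal ((2 : ℝ) ^ (e₁ * j)) *
        ENNReal.ofReal ((2 : ℝ) ^ (e₂ * k))) * B ^ 2 * (eLpNorm F₁ 2 volume * eLpNorm F₂ 2 volume)) := by
        ring
    _ ≤ _ := by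
        rw [ENNReal.coe_mul]
        gcongr

/-- Almost orthogonality of the dyadic pieces of two operators. -/
def AlmostOrth (m δ : ℝ) (wt : Euc n → ℝ) (a b : Phase n → ℂ) : Prop :=
  ∃ C : ℝ≥0, ∀ j k : ℕ, j ≤ k → ∀ F₁ F₂ : 𝓢(Euc n, ℂ), DyadicSupport j F₁ → DyadicSupport k F₂ →
    ∀ {B : ℝ≥0∞} {H : Euc n → ℂ}, B ≠ ⊤ → WeightedTransform wt B H →
    (∀ l, WeightedTransform wt B (mulη l H)) →
    ‖pairing (bilin a F₁ H) (bilin b F₂ H)‖ₑ ≤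
      C * (orthFactor m δ j k * B ^ 2 * (eLpNorm F₁ 2 volume * eLpNorm F₂ 2 volume))

lemma AlmostOrth.add (hδ : 0 ≤ δ) (hδ1 : δ ≤ 1) (hwt : FreqWeight δ wt) {e₁ e₂ e₃ : ℝ}
    (ha : FirstDominant δ n e₁ a) (hb : FirstDominant δ n e₂ b) (hc : FirstDominant δ n e₃ c)
    (h : AlmostOrth m δ wt a b) (h' : AlmostOrth m δ wt a c) :
    AlmostOrth m δ wt a fun p => b p + c p := by
  obtain ⟨C, h⟩ := h
  obtain ⟨C', h'⟩ := h'
  refine ⟨C + C', fun j k hjk F₁ F₂ hF₁ hF₂ B H hB hH hH' => ?_⟩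
  have hadd : bilin (fun p => b p + c p) F₂ H = fun x => bilin b F₂ H x + bilin c F₂ H x :=
    funext fun x => hb.bilin_add hδ hc F₂ (hH.continuous hwt) (hH.integrable hwt) x
  rw [hadd, pairing_add_right (ha.memLp_bilin hδ hδ1 hwt hF₁ hB hH)
    (hb.memLp_bilin hδ hδ1 hwt hF₂ hB hH) (hc.memLp_bilin hδ hδ1 hwt hF₂ hB hH), ENNReal.coe_add, add_mul]
  exact (enorm_add_le _ _).trans (add_le_add (h j k hjk F₁ F₂ hF₁ hF₂ hB hH hH')
    (h' j k hjk F₁ F₂ hF₁ hF₂ hB hH hH'))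

/-- The gain from an integration by parts. -/
lemma almostOrth_mulξ (hδ : 0 ≤ δ) (hδ1 : δ ≤ 1) (hwt : FreqWeight δ wt)
    (hτ : FirstDominant δ (n + 1) m τ) (hc : FirstDominant δ (n + 1) (m - 1) c) (l : Fin n) :
    AlmostOrth m δ wt τ (BilinearPDO.mulξ l c) := by
  have hτ0 := hτ.of_le hδ (Nat.le_succ n)
  have hc0 := hc.of_le hδ (Nat.le_succ n)
  have hτ1 := hτ.dirDeriv_x l
  have hc1 := hc.dirDeriv_x l
  have hτ2 := hτ0.mulξ hδ1 l
  have hc2 := hc0.mulξ hδ1 l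
  -- The four types of term have exponents mj + mk plus, in turn, δj - k, j - k, -k and -(1-δ)k. All
  -- are admissible because 0 ≤ j ≤ k and 0 ≤ δ ≤ 1.
  obtain ⟨C₁, h₁⟩ := exists_pairing_le (m := m) hδ hδ1 hwt hτ1 hc0 fun j k hj hjk => by
    nlinarith [mul_le_mul_of_nonneg_left hjk hδ]
  obtain ⟨C₂, h₂⟩ := exists_pairing_le (m := m) hδ hδ1 hwt hτ2 hc0 fun j k hj hjk => by
    nlinarith [mul_le_mul_of_nonneg_left hjk hδ]
  obtain ⟨C₃, h₃⟩ := exists_pairing_le (m := m) hδ hδ1 hwt hτ0 hc0 fun j k hj hjk => by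
    nlinarith [mul_le_mul_of_nonneg_left hjk hδ]
  obtain ⟨C₄, h₄⟩ := exists_pairing_le (m := m) hδ hδ1 hwt hτ0 hc1 fun j k hj hjk => by
    nlinarith [mul_le_mul_of_nonneg_left hjk hδ]
  -- The constant C₃ occurs twice, as iη_l appears once on each side of the pairing.
  refine ⟨C₁ + C₂ + C₃ + C₄ + C₃, fun j k hjk F₁ F₂ hF₁ hF₂ B H hB hH hH' => ?_⟩
  have hHc := hH.continuous hwt
  have hHi := hH.integrable hwt
  have hHl := (hH' l).integrable hwt
  have L : ∀ {a : Phase n → ℂ} {e : ℝ} {k : ℕ} {F : 𝓢(Euc n, ℂ)} {H : Euc n → ℂ},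
      FirstDominant δ n e a → DyadicSupport k F → WeightedTransform wt B H →
      MemLp (bilin a F H) 2 volume := fun ha hF hH => ha.memLp_bilin hδ hδ1 hwt hF hB hH
  have u := L hτ0 hF₁ hH
  have u1 := L hτ1 hF₁ hH
  have u2 := L hτ2 hF₁ hH
  have u3 := L hτ0 hF₁ (hH' l)
  have v := L hc0 hF₂ hH
  have v1 := L hc1 hF₂ hH
  have v2 := L hc2 hF₂ hH
  have v3 := L hc0 hF₂ (hH' l)
  have key := pairing_lineDeriv l u v ((u1.add u2).add u3) ((v1.add v2).add v3)
    (fun x => hτ.hasLineDerivAt_bilin hδ hδ1 F₁ hHc hHi l hHl x)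
    (fun x => hc.hasLineDerivAt_bilin hδ hδ1 F₂ hHc hHi l hHl x)
  have k1 := pairing_add_right u (v1.add v2) v3
  have k2 := pairing_add_right u v1 v2
  have k3 := pairing_add_right v (u1.add u2) u3
  have k4 := pairing_add_right v u1 u2
  rw [pairing_comm _ (bilin c F₂ H)] at key
  -- Integration by parts, solved for the one term in which iξ_l multiplies the higher frequency.
  have e : pairing (bilin τ F₁ H) (bilin (BilinearPDO.mulξ l c) F₂ H) =
      -(pairing (bilin (dirDeriv axis (xIdx l) τ) F₁ H) (bilin c F₂ H)) -
      pairing (bilin (BilinearPDO.mulξ l τ) F₁ H) (bilin c F₂ H) -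
      pairing (bilin τ F₁ (mulη l H)) (bilin c F₂ H) -
      pairing (bilin τ F₁ H) (bilin (dirDeriv axis (xIdx l) c) F₂ H) -
      pairing (bilin τ F₁ H) (bilin c F₂ (mulη l H)) := by
    rw [pairing_comm _ (bilin c F₂ H), pairing_comm _ (bilin c F₂ H), pairing_comm _ (bilin c F₂ H)]
    have k1' := k1.symm.trans (key.trans (congrArg Neg.neg k3))
    have k2' := k2
    have k4' := k4
    change pairing (bilin τ F₁ H) (fun x => bilin (dirDeriv axis (xIdx l) c) F₂ H x +
      bilin (BilinearPDO.mulξ l c) F₂ H x) + _ = -(pairing (bilin c F₂ H) (fun x =>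
      bilin (dirDeriv axis (xIdx l) τ) F₁ H x + bilin (BilinearPDO.mulξ l τ) F₁ H x) + _) at k1'
    rw [k2', k4'] at k1'
    linarith
  rw [e]
  have ht : ∀ p q r s t : ℝ, ‖-p - q - r - s - t‖ₑ ≤ ‖p‖ₑ + ‖q‖ₑ + ‖r‖ₑ + ‖s‖ₑ + ‖t‖ₑ := by
    intro p q r s t
    have h0 : ∀ a b : ℝ, ‖a - b‖ₑ ≤ ‖a‖ₑ + ‖b‖ₑ := fun a b => by
      simpa [sub_eq_add_neg] using enorm_add_le a (-b)
    refine (h0 _ _).trans (add_le_add ((h0 _ _).trans (add_le_add ((h0 _ _).trans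
      (add_le_add ((h0 _ _).trans (add_le_add ?_ le_rfl)) le_rfl)) le_rfl)) le_rfl)
    rw [enorm_neg]
  refine (ht _ _ _ _ _).trans ?_
  simp only [ENNReal.coe_add, add_mul]
  exact add_le_add (add_le_add (add_le_add (add_le_add
    (h₁ j k hjk F₁ F₂ hF₁ hF₂ hB hH hH) (h₂ j k hjk F₁ F₂ hF₁ hF₂ hB hH hH))
    (h₃ j k hjk F₁ F₂ hF₁ hF₂ hB (hH' l) hH)) (h₄ j k hjk F₁ F₂ hF₁ hF₂ hB hH hH))
    (h₃ j k hjk F₁ F₂ hF₁ hF₂ hB hH (hH' l))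

/-- From 1 = (1 + Σ_l ξ_l²)/⟨ξ⟩², τ is the sum of τ/⟨ξ⟩², whose order is already low enough, and of
terms iξ_l c_l with c_l of order m - 1, to which `almostOrth_mulξ` applies. The extra x-derivative
in the hypothesis is the one that falls on the symbols. -/
lemma FirstDominant.almostOrth (hδ : 0 ≤ δ) (hδ1 : δ ≤ 1) (hwt : FreqWeight δ wt)
    (hτ : FirstDominant δ (n + 1) m τ) : AlmostOrth m δ wt τ τ := by
  have hinv : Sym (axis (n := n)) (linearScale δ) (fun (_ : Unit) p => japξ p ^ (-1 : ℝ))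
      (fun _ p => ((japξ p ^ (-1 : ℝ) : ℝ) : ℂ)) :=
    (sym_japξ hδ1).rpow (linearScale_nonneg δ) japξ_pos contDiff_japξ (-1)
  have hτ0 := hτ.of_le hδ (Nat.le_succ n)
  set b : Phase n → ℂ := fun p => τ p * ((japξ p ^ (-1 : ℝ) : ℝ) : ℂ) with hb
  have hbF : FirstDominant δ n (m - 1 + δ) b :=
    (hτ0.mul_sym hinv).mono_order (by linarith)
  -- That is c_l = -iξ_l τ/⟨ξ⟩², so that iξ_l c_l = ξ_l² τ/⟨ξ⟩².
  set c : Fin n → Phase n → ℂ := fun l p =>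
    BilinearPDO.mulξ l τ p * ((japξ p ^ (-1 : ℝ) : ℝ) : ℂ) * (-1) with hc
  have hcF : ∀ l, FirstDominant δ (n + 1) (m - 1) (c l) := fun l => by
    have := (((hτ.mulξ hδ1 l).mul_sym hinv).const_mul (-1))
    convert this using 1
    ring
  have hcF0 := fun l => (hcF l).of_le hδ (Nat.le_succ n)
  have key : ∀ S : Finset (Fin n),
      FirstDominant δ n m (fun p => b p + ∑ l ∈ S, BilinearPDO.mulξ l (c l) p) ∧
      AlmostOrth m δ wt τ (fun p => b p + ∑ l ∈ S, BilinearPDO.mulξ l (c l) p) := by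
    classical
    intro S
    induction S using Finset.induction_on with
    | empty =>
      simp only [Finset.sum_empty, add_zero]
      refine ⟨hbF.mono_order (by linarith), ?_⟩
      obtain ⟨C, hC⟩ := exists_pairing_le (m := m) hδ hδ1 hwt hτ0 hbF fun j k hj hjk => by
        nlinarith [mul_le_mul_of_nonneg_left hjk hδ]
      exact ⟨C, fun j k hjk F₁ F₂ hF₁ hF₂ B H hB hH _ => hC j k hjk F₁ F₂ hF₁ hF₂ hB hH hH⟩
    | insert l S hl ih =>
      have e : (fun p => b p + ∑ l ∈ insert l S, BilinearPDO.mulξ l (c l) p) =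
          fun p => (b p + ∑ l ∈ S, BilinearPDO.mulξ l (c l) p) + BilinearPDO.mulξ l (c l) p := by
        funext p
        rw [Finset.sum_insert hl]; ring
      have h1 : FirstDominant δ n m (BilinearPDO.mulξ l (c l)) := by
        have := (hcF0 l).mulξ hδ1 l
        rwa [sub_add_cancel] at this
      rw [e]
      exact ⟨ih.1.add h1, ih.2.add hδ hδ1 hwt hτ0 ih.1 h1 (almostOrth_mulξ hδ hδ1 hwt hτ (hcF l) l)⟩
  have e : (fun p => b p + ∑ l, BilinearPDO.mulξ l (c l) p) = τ := by
    funext p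
    have h1 : ∀ l, BilinearPDO.mulξ l (c l) p =
        τ p * ((japξ p ^ (-1 : ℝ) : ℝ) : ℂ) * (((p.2.1 l) ^ 2 : ℝ) : ℂ) := by
      intro l
      simp only [hc, BilinearPDO.mulξ]
      push_cast
      linear_combination (-(τ p) * ((japξ p ^ (-1 : ℝ) : ℝ) : ℂ) * (p.2.1 l : ℂ) ^ 2) * Complex.I_sq
    simp only [h1]
    rw [← Finset.mul_sum, ← Complex.ofReal_sum, hb]
    have h2 : ∑ l, (p.2.1 l) ^ 2 = japξ p - 1 := by
      rw [japξ, EuclideanSpace.real_norm_sq_eq]; ring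
    have h3 : (japξ p ^ (-1 : ℝ)) * japξ p = 1 := by
      rw [Real.rpow_neg_one, inv_mul_cancel₀ (japξ_pos p).ne']
    have h3' : (((japξ p ^ (-1 : ℝ) : ℝ) : ℂ)) * (japξ p : ℂ) = 1 := by exact_mod_cast h3
    rw [h2]
    push_cast
    linear_combination τ p * h3'
  have := (key Finset.univ).2
  rwa [e] at this

end AlmostOrthogonality

end BilinearPDO

namespace BilinearPDO

/-! ### Schur's test for geometrically decaying matrices -/

section SchurSum

/-- With truncated subtraction (j - k) + (k - j) is |j - k|. On each side of j the distances are
distinct, which gives at most one geometric series per side. -/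
lemma sum_pow_dist_le (Q : ℝ≥0∞) (s : Finset ℕ) (j : ℕ) :
    ∑ k ∈ s, Q ^ ((j - k) + (k - j)) ≤ 2 * ∑' i, Q ^ i := by
  rw [← Finset.sum_filter_add_sum_filter_not s (fun k => k ≤ j), two_mul]
  refine add_le_add ?_ ?_
  · have h : ∀ k ∈ s.filter (fun k => k ≤ j), Q ^ ((j - k) + (k - j)) = Q ^ (j - k) := by
      intro k hk
      have := (Finset.mem_filter.1 hk).2
      rw [Nat.sub_eq_zero_of_le this, add_zero]
    rw [Finset.sum_congr rfl h, ← Finset.sum_image (f := fun i => Q ^ i) (g := fun k => j - k)]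
    · exact ENNReal.sum_le_tsum _
    · intro a ha b hb hab
      have h1 := (Finset.mem_filter.1 (Finset.mem_coe.1 ha)).2
      have h2 := (Finset.mem_filter.1 (Finset.mem_coe.1 hb)).2
      simp only at hab
      omega
  · have h : ∀ k ∈ s.filter (fun k => ¬ k ≤ j), Q ^ ((j - k) + (k - j)) = Q ^ (k - j) := by
      intro k hk
      have := (Finset.mem_filter.1 hk).2
      rw [Nat.sub_eq_zero_of_le (by omega), zero_add]
    rw [Finset.sum_congr rfl h, ← Finset.sum_image (f := fun i => Q ^ i) (g := fun k => k - j)]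
    · exact ENNReal.sum_le_tsum _
    · intro a ha b hb hab
      have h1 := (Finset.mem_filter.1 (Finset.mem_coe.1 ha)).2
      have h2 := (Finset.mem_filter.1 (Finset.mem_coe.1 hb)).2
      simp only at hab
      omega

lemma schur_sum_le (Q : ℝ≥0∞) (s : Finset ℕ) (a : ℕ → ℝ≥0∞) :
    ∑ j ∈ s, ∑ k ∈ s, Q ^ ((j - k) + (k - j)) * (a j * a k) ≤ 4 * (∑' i, Q ^ i) * ∑ j ∈ s, a j ^ 2 := by
  have h0 : ∀ x y : ℝ≥0∞, x * y ≤ x ^ 2 + y ^ 2 := by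
    intro x y
    rcases le_total x y with h | h
    · exact (mul_le_mul' h le_rfl).trans (by rw [sq y]; exact le_add_self)
    · exact (mul_le_mul' le_rfl h).trans (by rw [sq x]; exact le_self_add)
  have h1 : ∀ j k : ℕ, (j - k) + (k - j) = (k - j) + (j - k) := fun j k => add_comm _ _
  calc _ ≤ ∑ j ∈ s, ∑ k ∈ s, (Q ^ ((j - k) + (k - j)) * a j ^ 2 + Q ^ ((j - k) + (k - j)) * a k ^ 2) :=
        Finset.sum_le_sum fun j _ => Finset.sum_le_sum fun k _ => by
          rw [← mul_add]; exact mul_le_mul' le_rfl (h0 _ _)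
    _ = ∑ j ∈ s, (∑ k ∈ s, Q ^ ((j - k) + (k - j))) * a j ^ 2 +
        ∑ k ∈ s, (∑ j ∈ s, Q ^ ((k - j) + (j - k))) * a k ^ 2 := by
        simp only [Finset.sum_add_distrib, Finset.sum_mul]
        congr 1
        rw [Finset.sum_comm]
        exact Finset.sum_congr rfl fun k _ => Finset.sum_congr rfl fun j _ => by rw [h1]
    _ ≤ ∑ j ∈ s, (2 * ∑' i, Q ^ i) * a j ^ 2 + ∑ j ∈ s, (2 * ∑' i, Q ^ i) * a j ^ 2 :=
        add_le_add (Finset.sum_le_sum fun j _ => mul_le_mul' (sum_pow_dist_le Q s j) le_rfl)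
          (Finset.sum_le_sum fun j _ => mul_le_mul' (sum_pow_dist_le Q s j) le_rfl)
    _ = _ := by
        rw [← Finset.mul_sum]; ring

end SchurSum

/-! ### Summation of the dyadic pieces -/

section DyadicSum

open SchwartzMap
open scoped SchwartzMap

variable {n : ℕ} {δ e m : ℝ} {X : ℕ} {τ a b c : Phase n → ℂ} {wt : Euc n → ℝ}

/-- The dyadic pieces of a Schwartz function. -/
noncomputable def dyadPiece (k : ℕ) (F : 𝓢(Euc n, ℂ)) : 𝓢(Euc n, ℂ) :=
  smulLeftCLM ℂ (fun ξ : Euc n => ((dyad k ξ : ℝ) : ℂ)) F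

lemma dyadPiece_apply (k : ℕ) (F : 𝓢(Euc n, ℂ)) (ξ : Euc n) :
    dyadPiece k F ξ = ((dyad k ξ : ℝ) : ℂ) * F ξ := by
  have h1 : ContDiff ℝ ∞ fun ξ : Euc n => ((dyad k ξ : ℝ) : ℂ) :=
    Complex.ofRealCLM.contDiff.comp (contDiff_dyad k)
  have h2 : HasCompactSupport fun ξ : Euc n => ((dyad k ξ : ℝ) : ℂ) :=
    (hasCompactSupport_dyad k).comp_left (g := fun t : ℝ => (t : ℂ)) Complex.ofReal_zero
  rw [dyadPiece, smulLeftCLM_apply_apply (hasTemperateGrowth_of_compact h1 h2), smul_eq_mul]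

lemma dyadicSupport_dyadPiece (k : ℕ) (F : 𝓢(Euc n, ℂ)) : DyadicSupport k (dyadPiece k F) := by
  intro ξ h h0
  exact h (by rw [dyadPiece_apply, h0]; simp)

/-- On the support of the k-th cutoff 4^k ≤ 4(1 + |ξ|²), so 4^(mk) is bounded because m ≥ 0; then
the squares of the cutoffs are at most the cutoffs, whose sum is at most 1. -/
lemma sum_dyad_sq_le (hm : 0 ≤ m) (K : ℕ) (ξ : Euc n) :
    ∑ k ∈ Finset.range (K + 1), ((2 : ℝ) ^ (m * k) * dyad k ξ) ^ 2 ≤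
      ((2 : ℝ) ^ m * (1 + ‖ξ‖ ^ 2) ^ (m / 2)) ^ 2 := by
  have hr : 0 < 1 + ‖ξ‖ ^ 2 := by positivity
  have e1 : ((2 : ℝ) ^ m * (1 + ‖ξ‖ ^ 2) ^ (m / 2)) ^ 2 = (4 * (1 + ‖ξ‖ ^ 2)) ^ m := by
    rw [mul_pow, ← Real.rpow_natCast (_ ^ m), ← Real.rpow_natCast (_ ^ (m / 2)),
      ← Real.rpow_mul (by norm_num), ← Real.rpow_mul hr.le, Real.mul_rpow (by norm_num) hr.le,
      show (4 : ℝ) = 2 ^ (2 : ℝ) by norm_num, ← Real.rpow_mul (by norm_num)]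
    congr 2 <;> push_cast <;> ring
  have h1 : ∀ k ∈ Finset.range (K + 1), ((2 : ℝ) ^ (m * k) * dyad k ξ) ^ 2 ≤
      (4 * (1 + ‖ξ‖ ^ 2)) ^ m * dyad k ξ := by
    intro k _
    by_cases h : dyad k ξ = 0
    · simp [h]
    have h2 := (dyad_support h).1
    have h4 : (0 : ℝ) < 4 ^ k := by positivity
    rw [inv_mul_eq_div, div_le_div_iff₀ (by norm_num) h4] at h2
    have hd0 := dyad_nonneg k ξ
    have hd1 : dyad k ξ ≤ 1 := by
      have h1 := chi_le_one ((4 ^ k)⁻¹ * (1 + ‖ξ‖ ^ 2))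
      have h2 := chi_nonneg (4 * ((4 ^ k)⁻¹ * (1 + ‖ξ‖ ^ 2)))
      rw [dyad]; linarith
    have h3 : ((2 : ℝ) ^ (m * k)) ^ 2 ≤ (4 * (1 + ‖ξ‖ ^ 2)) ^ m := by
      have : ((2 : ℝ) ^ (m * k)) ^ 2 = ((4 : ℝ) ^ k) ^ m := by
        rw [← Real.rpow_natCast (_ ^ _), ← Real.rpow_mul (by norm_num), ← Real.rpow_natCast 4,
          ← Real.rpow_mul (by norm_num), show (4 : ℝ) = 2 ^ (2 : ℝ) by norm_num,
          ← Real.rpow_mul (by norm_num)]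
        congr 1; push_cast; ring
      rw [this]
      exact Real.rpow_le_rpow h4.le (by linarith) hm
    rw [mul_pow]
    refine mul_le_mul h3 ?_ (by positivity) (by positivity)
    rw [sq]; exact mul_le_of_le_one_left hd0 hd1
  rw [e1]
  refine (Finset.sum_le_sum h1).trans ?_
  rw [← Finset.mul_sum, sum_dyad]
  exact mul_le_of_le_one_right (by positivity) (chi_le_one _)

lemma sum_eLpNorm_dyadPiece_sq_le (hm : 0 ≤ m) (K : ℕ) (F : 𝓢(Euc n, ℂ)) :
    ∑ k ∈ Finset.range (K + 1),
      (ENNReal.ofReal ((2 : ℝ) ^ (m * k)) * eLpNorm (dyadPiece k F) 2 volume) ^ 2 ≤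
    (ENNReal.ofReal ((2 : ℝ) ^ m) *
      eLpNorm (fun ξ => (((1 + ‖ξ‖ ^ 2) ^ (m / 2) : ℝ) : ℂ) * F ξ) 2 volume) ^ 2 := by
  have hen : ∀ (r : ℝ) (z : ℂ), 0 ≤ r → ‖(r : ℂ) * z‖ₑ ^ 2 = ENNReal.ofReal (r ^ 2) * ‖z‖ₑ ^ 2 := by
    intro r z hr
    rw [enorm_mul, mul_pow, ← ofReal_norm (r : ℂ), Complex.norm_real, Real.norm_of_nonneg hr,
      ENNReal.ofReal_pow hr]
  have hFm : Measurable fun ξ => ‖F ξ‖ₑ ^ 2 := F.continuous.measurable.enorm.pow_const 2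
  have hk : ∀ k ∈ Finset.range (K + 1),
      (ENNReal.ofReal ((2 : ℝ) ^ (m * k)) * eLpNorm (dyadPiece k F) 2 volume) ^ 2 =
      ∫⁻ ξ, ENNReal.ofReal (((2 : ℝ) ^ (m * k) * dyad k ξ) ^ 2) * ‖F ξ‖ₑ ^ 2 := by
    intro k _
    rw [mul_pow, eLpNorm_two_sq, ← lintegral_const_mul' _ _ (ENNReal.pow_ne_top ENNReal.ofReal_ne_top)]
    refine lintegral_congr fun ξ => ?_
    rw [dyadPiece_apply, hen _ _ (dyad_nonneg k ξ), mul_pow, ENNReal.ofReal_mul (by positivity),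
      ENNReal.ofReal_pow (show (0 : ℝ) ≤ (2 : ℝ) ^ (m * k) by positivity), mul_assoc]
  rw [Finset.sum_congr rfl hk, ← lintegral_finsetSum _ fun k _ => ?_]
  · rw [mul_pow, eLpNorm_two_sq, ← lintegral_const_mul' _ _ (ENNReal.pow_ne_top ENNReal.ofReal_ne_top)]
    refine lintegral_mono fun ξ => ?_
    rw [← Finset.sum_mul, hen _ _ (by positivity), ← mul_assoc,
      ← ENNReal.ofReal_pow (by positivity), ← ENNReal.ofReal_mul (by positivity),
      ← ENNReal.ofReal_sum_of_nonneg fun k _ => sq_nonneg _, ← mul_pow]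
    exact mul_le_mul' (ENNReal.ofReal_le_ofReal (sum_dyad_sq_le hm K ξ)) le_rfl
  · exact (((contDiff_dyad k).continuous.measurable.const_mul _).pow_const 2).ennreal_ofReal.mul hFm

lemma eLpNorm_sq_eq_pairing {u : Euc n → ℂ} (hu : MemLp u 2 volume) :
    eLpNorm u 2 volume ^ 2 = ENNReal.ofReal (pairing u u) := by
  rw [eLpNorm_two_sq, pairing, ofReal_integral_eq_lintegral_ofReal (integrable_pairing hu hu)
    (Filter.Eventually.of_forall fun x => real_inner_self_nonneg)]
  refine lintegral_congr fun x => ?_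
  rw [real_inner_self_eq_norm_sq, ENNReal.ofReal_pow (norm_nonneg _), ofReal_norm]

lemma pairing_sum (s : Finset ℕ) {u : ℕ → Euc n → ℂ} (hu : ∀ k, MemLp (u k) 2 volume) :
    pairing (fun x => ∑ k ∈ s, u k x) (fun x => ∑ k ∈ s, u k x) =
      ∑ j ∈ s, ∑ k ∈ s, pairing (u j) (u k) := by
  simp only [pairing]
  simp only [sum_inner, inner_sum]
  rw [integral_finsetSum _ fun j _ => integrable_finsetSum _ fun k _ =>
    integrable_pairing (hu _) (hu _)]
  exact (Finset.sum_congr rfl fun j _ => integral_finsetSum _ fun k _ =>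
    integrable_pairing (hu k) (hu j)).trans Finset.sum_comm

lemma FirstDominant.sum_bilin_dyadPiece (hδ : 0 ≤ δ) (hτ : FirstDominant δ X e τ) (F : 𝓢(Euc n, ℂ))
    {H : Euc n → ℂ} (hHc : Continuous H) (hH : Integrable H) (K : ℕ) :
    (fun x => ∑ k ∈ Finset.range (K + 1), bilin τ (dyadPiece k F) H x) =
      bilin τ (fun ξ => ((lowCut K ξ : ℝ) : ℂ) * F ξ) H := by
  funext x
  have := integral_finsetSum (μ := (volume : Measure (Euc n × Euc n))) (Finset.range (K + 1))
    (f := fun k q => bilinKernel τ (dyadPiece k F) H x q)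
    fun k _ => hτ.integrable_bilinKernel hδ (dyadPiece k F) hHc hH x
  refine Eq.trans this.symm (integral_congr_ae (Filter.Eventually.of_forall fun q => ?_))
  simp only [bilinKernel, dyadPiece_apply]
  rw [← sum_dyad]
  push_cast
  simp only [Finset.mul_sum, Finset.sum_mul]

/-- The uniform bound for the truncated operators. -/
lemma FirstDominant.exists_eLpNorm_lowCut_le (hδ : 0 ≤ δ) (hδ1 : δ < 1) (hm : 0 ≤ m)
    (hwt : FreqWeight δ wt) (hτ : FirstDominant δ (n + 1) m τ) : ∃ C : ℝ≥0, ∀ (K : ℕ)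
    (F : 𝓢(Euc n, ℂ)) {B : ℝ≥0∞} {H : Euc n → ℂ}, B ≠ ⊤ → WeightedTransform wt B H →
    (∀ l, WeightedTransform wt B (mulη l H)) →
    eLpNorm (bilin τ (fun ξ => ((lowCut K ξ : ℝ) : ℂ) * F ξ) H) 2 volume ≤
      C * B * eLpNorm (fun ξ => (((1 + ‖ξ‖ ^ 2) ^ (m / 2) : ℝ) : ℂ) * F ξ) 2 volume := by
  obtain ⟨C, hC⟩ := hτ.almostOrth hδ hδ1.le hwt
  set Q : ℝ≥0∞ := ENNReal.ofReal ((2 : ℝ) ^ (-(1 - δ))) with hQ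
  have hQ1 : Q < 1 := by
    rw [hQ, ENNReal.ofReal_lt_one]
    exact Real.rpow_lt_one_of_one_lt_of_neg (by norm_num) (by linarith)
  have hS : ∑' i, Q ^ i ≠ ⊤ := by
    rw [ENNReal.tsum_geometric]
    exact ENNReal.inv_ne_top.2 (tsub_pos_of_lt hQ1).ne'
  -- The square of the final constant: almost orthogonality, Schur's test and the square function
  -- bound, in this order. The series converges because δ < 1.
  obtain ⟨D, hD⟩ : ∃ D : ℝ≥0∞, D = C * (4 * ∑' i, Q ^ i) * ENNReal.ofReal ((2 : ℝ) ^ m) ^ 2 := ⟨_, rfl⟩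
  have hDt : D ≠ ⊤ := by
    rw [hD]
    exact ENNReal.mul_ne_top (ENNReal.mul_ne_top ENNReal.coe_ne_top (ENNReal.mul_ne_top (by simp) hS))
      (ENNReal.pow_ne_top ENNReal.ofReal_ne_top)
  have hDs : (D ^ (1 / 2 : ℝ)) ^ 2 = D := by
    rw [← ENNReal.rpow_natCast, ← ENNReal.rpow_mul]; simp
  have hDt' : D ^ (1 / 2 : ℝ) ≠ ⊤ := ENNReal.rpow_ne_top_of_nonneg (by norm_num) hDt
  refine ⟨(D ^ (1 / 2 : ℝ)).toNNReal, fun K F B H hB hH hH' => ?_⟩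
  rw [ENNReal.coe_toNNReal hDt', ← hτ.sum_bilin_dyadPiece hδ F (hH.continuous hwt) (hH.integrable hwt)]
  refine (ENNReal.pow_le_pow_left_iff two_ne_zero).1 ?_
  rw [mul_pow, mul_pow, hDs]
  obtain ⟨u, hu⟩ : ∃ u : ℕ → Euc n → ℂ, ∀ k, bilin τ (dyadPiece k F) H = u k := ⟨_, fun _ => rfl⟩
  have hum : ∀ k, MemLp (u k) 2 volume := fun k => hu k ▸
    (hτ.of_le hδ (Nat.le_succ n)).memLp_bilin hδ hδ1.le hwt (dyadicSupport_dyadPiece k F) hB hH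
  simp only [hu]
  set β : ℕ → ℝ≥0∞ := fun k => ENNReal.ofReal ((2 : ℝ) ^ (m * k)) * eLpNorm (dyadPiece k F) 2 volume
    with hβ
  have hf : ∀ j k, j ≤ k → orthFactor m δ j k = ENNReal.ofReal ((2 : ℝ) ^ (m * j)) *
      ENNReal.ofReal ((2 : ℝ) ^ (m * k)) * Q ^ ((j - k) + (k - j)) := by
    intro j k hjk
    rw [Nat.sub_eq_zero_of_le hjk, zero_add, hQ, orthFactor, ← ENNReal.ofReal_pow (by positivity),
      ← ENNReal.ofReal_mul (by positivity), ← ENNReal.ofReal_mul (by positivity),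
      ← Real.rpow_natCast (_ ^ _), ← Real.rpow_mul (by norm_num), ← Real.rpow_add (by norm_num),
      ← Real.rpow_add (by norm_num), Nat.cast_sub hjk]
    congr 2; ring
  have hpair0 : ∀ j k, j ≤ k → ‖pairing (u j) (u k)‖ₑ ≤
      C * B ^ 2 * (Q ^ ((j - k) + (k - j)) * (β j * β k)) := by
    intro j k hjk
    have := hC j k hjk _ _ (dyadicSupport_dyadPiece j F) (dyadicSupport_dyadPiece k F) hB hH hH'
    rw [hu, hu, hf j k hjk] at this
    refine this.trans_eq ?_
    simp only [hβ]
    ring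
  have hpair : ∀ j k, ‖pairing (u j) (u k)‖ₑ ≤
      C * B ^ 2 * (Q ^ ((j - k) + (k - j)) * (β j * β k)) := by
    intro j k
    rcases le_total j k with h | h
    · exact hpair0 j k h
    · rw [pairing_comm, add_comm (j - k), mul_comm (β j)]
      exact hpair0 k j h
  have hsum : MemLp (fun x => ∑ k ∈ Finset.range (K + 1), u k x) 2 volume :=
    memLp_finsetSum _ fun k _ => hum k
  rw [eLpNorm_sq_eq_pairing hsum, pairing_sum _ hum]
  calc _ ≤ ‖∑ j ∈ Finset.range (K + 1), ∑ k ∈ Finset.range (K + 1), pairing (u j) (u k)‖ₑ := by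
        rw [← ofReal_norm]
        exact ENNReal.ofReal_le_ofReal (le_abs_self _)
    _ ≤ ∑ j ∈ Finset.range (K + 1), ∑ k ∈ Finset.range (K + 1), ‖pairing (u j) (u k)‖ₑ :=
        (enorm_sum_le _ _).trans (Finset.sum_le_sum fun j _ => enorm_sum_le _ _)
    _ ≤ ∑ j ∈ Finset.range (K + 1), ∑ k ∈ Finset.range (K + 1),
        C * B ^ 2 * (Q ^ ((j - k) + (k - j)) * (β j * β k)) :=
        Finset.sum_le_sum fun j _ => Finset.sum_le_sum fun k _ => hpair j k
    _ = C * B ^ 2 * ∑ j ∈ Finset.range (K + 1), ∑ k ∈ Finset.range (K + 1),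
        Q ^ ((j - k) + (k - j)) * (β j * β k) := by
        simp only [Finset.mul_sum]
    _ ≤ C * B ^ 2 * (4 * (∑' i, Q ^ i) * ∑ j ∈ Finset.range (K + 1), β j ^ 2) :=
        mul_le_mul' le_rfl (schur_sum_le Q _ β)
    _ ≤ C * B ^ 2 * (4 * (∑' i, Q ^ i) * (ENNReal.ofReal ((2 : ℝ) ^ m) *
          eLpNorm (fun ξ => (((1 + ‖ξ‖ ^ 2) ^ (m / 2) : ℝ) : ℂ) * F ξ) 2 volume) ^ 2) :=
        mul_le_mul' le_rfl (mul_le_mul' le_rfl (sum_eLpNorm_dyadPiece_sq_le hm K F))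
    _ = _ := by
        rw [hD]; ring

lemma tendsto_lowCut (ξ : Euc n) : Filter.Tendsto (fun K => lowCut K ξ) Filter.atTop (nhds 1) := by
  refine tendsto_const_nhds.congr' ?_
  have h := (tendsto_pow_atTop_atTop_of_one_lt (show (1 : ℝ) < 4 by norm_num)).eventually_ge_atTop
    (1 + ‖ξ‖ ^ 2)
  filter_upwards [h] with K hK
  rw [lowCut, chi_of_le]
  rw [inv_mul_le_iff₀ (by positivity)]
  linarith

/-- The `L²` bound for operators whose symbol is controlled by the frequency `ξ`. -/
lemma FirstDominant.exists_eLpNorm_bilin_le (hδ : 0 ≤ δ) (hδ1 : δ < 1) (hm : 0 ≤ m)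
    (hwt : FreqWeight δ wt) (hτ : FirstDominant δ (n + 1) m τ) : ∃ C : ℝ≥0, ∀
    (F : 𝓢(Euc n, ℂ)) {B : ℝ≥0∞} {H : Euc n → ℂ}, B ≠ ⊤ → WeightedTransform wt B H →
    (∀ l, WeightedTransform wt B (mulη l H)) →
    eLpNorm (bilin τ F H) 2 volume ≤
      C * B * eLpNorm (fun ξ => (((1 + ‖ξ‖ ^ 2) ^ (m / 2) : ℝ) : ℂ) * F ξ) 2 volume := by
  obtain ⟨C, hC⟩ := hτ.exists_eLpNorm_lowCut_le hδ hδ1 hm hwt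
  refine ⟨C, fun F B H hB hH hH' => ?_⟩
  have hHc := hH.continuous hwt
  have hHi := hH.integrable hwt
  obtain ⟨b, hb, hτb⟩ := hτ.exists_bound hδ F hHi
  have hker : ∀ K x q, bilinKernel τ (fun ξ => ((lowCut K ξ : ℝ) : ℂ) * F ξ) H x q =
      ((lowCut K q.1 : ℝ) : ℂ) * bilinKernel τ F H x q := fun K x q => by
    simp only [bilinKernel]; ring
  have hmeas : ∀ K, AEStronglyMeasurable (bilin τ (fun ξ => ((lowCut K ξ : ℝ) : ℂ) * F ξ) H) volume := by
    intro K
    rw [← hτ.sum_bilin_dyadPiece hδ F hHc hHi]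
    exact (continuous_finsetSum _ fun k _ => hτ.continuous_bilin hδ _ hHc hHi).aestronglyMeasurable
  have hlim : ∀ x, Filter.Tendsto (fun K => bilin τ (fun ξ => ((lowCut K ξ : ℝ) : ℂ) * F ξ) H x)
      Filter.atTop (nhds (bilin τ F H x)) := by
    intro x
    have h0 := hτ.integrable_bilinKernel hδ F hHc hHi x
    refine tendsto_integral_of_dominated_convergence (F := fun K q =>
      bilinKernel τ (fun ξ => ((lowCut K ξ : ℝ) : ℂ) * F ξ) H x q) (f := bilinKernel τ F H x) b
      (fun K => ?_) hb (fun K => Filter.Eventually.of_forall fun q => ?_)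
      (Filter.Eventually.of_forall fun q => ?_)
    · simp only [hker]
      have : Continuous fun q : Euc n × Euc n => ((lowCut K q.1 : ℝ) : ℂ) :=
        Complex.continuous_ofReal.comp ((contDiff_lowCut K).continuous.comp continuous_fst)
      exact this.aestronglyMeasurable.mul h0.aestronglyMeasurable
    · rw [hker, norm_mul, Complex.norm_real, lowCut, Real.norm_of_nonneg (chi_nonneg _)]
      exact (mul_le_of_le_one_left (norm_nonneg _) (chi_le_one _)).trans (hτb x q)
    · simp only [hker]
      have := ((Complex.continuous_ofReal.tendsto _).comp (tendsto_lowCut q.1)).mul_const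
        (bilinKernel τ F H x q)
      simpa using this
  -- Fatou's lemma: the truncated operators converge pointwise and their norms are bounded uniformly
  -- in K.
  refine (Lp.eLpNorm_lim_le_liminf_eLpNorm hmeas _ (Filter.Eventually.of_forall hlim)).trans ?_
  refine Filter.liminf_le_of_le (by isBoundedDefault) fun c hc => ?_
  obtain ⟨K, hK⟩ := hc.exists
  exact hK.trans (hC K F hB hH hH')

end DyadicSum

end BilinearPDO

namespace BilinearPDO

/-! ### Fourier transforms and norms of test functions -/

section TestFunctions

open SchwartzMap FourierTransform
open scoped SchwartzMap

variable {n : ℕ} {f g : Euc n → ℂ}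

lemma fourier_eq_integral_expI (f : Euc n → ℂ) (ξ : Euc n) :
    fourier f ξ = ∫ y, f y * expI (-ξ) y := by
  refine integral_congr_ae (Filter.Eventually.of_forall fun y => ?_)
  simp only [expI, inner_neg_left, real_inner_comm]
  ring

lemma exists_schwartz_eq_fourier (hf : ContDiff ℝ ∞ f) (hfc : HasCompactSupport f) :
    ∃ F : 𝓢(Euc n, ℂ), ∀ ξ, F ξ = fourier f ξ := by
  set S : 𝓢(Euc n, ℂ) := hfc.toSchwartzMap hf with hS
  refine ⟨((((2 * Real.pi) ^ n : ℝ) : ℂ)) • (𝓕 (dilate S) : 𝓢(Euc n, ℂ)), fun ξ => ?_⟩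
  rw [fourier_eq_integral_expI, integral_expI_eq, smul_apply, smul_eq_mul, fourier_coe]
  congr 1
  rw [Real.fourierInv_eq_fourier_neg, neg_neg]
  rfl

/-- Plancherel's theorem; the constant only records the normalization, and the bound is in fact an
equality. -/
lemma exists_eLpNorm_le_sobolevNorm (n : ℕ) (m : ℝ) : ∃ C : ℝ≥0, ∀ (f : Euc n → ℂ) (F : 𝓢(Euc n, ℂ)),
    (∀ ξ, F ξ = fourier f ξ) → eLpNorm (fun ξ => (((1 + ‖ξ‖ ^ 2) ^ (m / 2) : ℝ) : ℂ) * F ξ) 2 volume ≤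
      C * sobolevNorm m f ∧ sobolevNorm m f ≠ ⊤ := by
  have hpi : (0 : ℝ) < (2 * Real.pi) ^ n := by have := Real.pi_pos; positivity
  have hP0 := plancherelConst_ne_zero (n := n)
  have hPt := plancherelConst_ne_top (n := n)
  have hinv : (ENNReal.ofReal ((2 * Real.pi) ^ n)) * (plancherelConst n)⁻¹ ≠ ⊤ :=
    ENNReal.mul_ne_top ENNReal.ofReal_ne_top (ENNReal.inv_ne_top.2 hP0)
  refine ⟨((ENNReal.ofReal ((2 * Real.pi) ^ n)) * (plancherelConst n)⁻¹).toNNReal, fun f F hF => ?_⟩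
  rw [ENNReal.coe_toNNReal hinv]
  set S : 𝓢(Euc n, ℂ) := smulLeftCLM ℂ (fun ξ : Euc n => (1 + ‖ξ‖ ^ 2) ^ (m / 2)) F with hS
  have hSa : ∀ ξ, S ξ = (((1 + ‖ξ‖ ^ 2) ^ (m / 2) : ℝ) : ℂ) * F ξ := fun ξ => by
    rw [hS, smulLeftCLM_apply_apply
      (Function.hasTemperateGrowth_one_add_norm_sq_rpow (H := Euc n) (m / 2)), Complex.real_smul]
  have e1 : besselJ m f = ((((2 * Real.pi) ^ n : ℝ) : ℂ)⁻¹) • fun x => ∫ ξ, S ξ * expI x ξ := by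
    funext x
    simp only [besselJ, Pi.smul_apply, smul_eq_mul, hSa, hF]
  have e2 : sobolevNorm m f = (ENNReal.ofReal ((2 * Real.pi) ^ n))⁻¹ *
      (plancherelConst n * eLpNorm S 2 volume) := by
    rw [sobolevNorm, e1, eLpNorm_const_smul, eLpNorm_integral_expI]
    congr 1
    rw [← ofReal_norm, norm_inv, Complex.norm_real, Real.norm_of_nonneg hpi.le,
      ENNReal.ofReal_inv_of_pos hpi]
  have hp1 : ENNReal.ofReal ((2 * Real.pi) ^ n) ≠ 0 := by simpa using hpi
  have hS2 : eLpNorm S 2 volume ≠ ⊤ := (S.memLp 2 volume).eLpNorm_ne_top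
  constructor
  · rw [← funext hSa, e2]
    refine le_of_eq ?_
    have : ∀ a b c : ℝ≥0∞, a ≠ 0 → a ≠ ⊤ → b ≠ 0 → b ≠ ⊤ → a * b⁻¹ * (a⁻¹ * (b * c)) = c := by
      intro a b c ha ha' hb hb'
      calc a * b⁻¹ * (a⁻¹ * (b * c)) = (a * a⁻¹) * (b * b⁻¹) * c := by ring
        _ = c := by rw [ENNReal.mul_inv_cancel ha ha', ENNReal.mul_inv_cancel hb hb', one_mul, one_mul]
    rw [this _ _ _ hp1 ENNReal.ofReal_ne_top hP0 hPt]
  · rw [e2]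
    exact ENNReal.mul_ne_top (ENNReal.inv_ne_top.2 hp1) (ENNReal.mul_ne_top hPt hS2)

lemma hasCompactSupport_dirDerivs (hgc : HasCompactSupport g) (L : List (Fin n)) :
    HasCompactSupport (dirDerivs basisVec L g) :=
  hgc.of_isClosed_subset isClosed_closure (tsupport_dirDerivs_subset L)

/-- The oscillatory integration by parts with the single factor 1 - ∂_l, after cancelling the
contribution of 1. -/
lemma fourier_dirDeriv (hg : ContDiff ℝ ∞ g) (hgc : HasCompactSupport g) (l : Fin n) :
    fourier (dirDeriv basisVec l g) = mulη l (fourier g) := by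
  funext η
  have hint : ∀ L : List (Fin n), Integrable (dirDerivs basisVec L g) := fun L =>
    (contDiff_dirDerivs L hg).continuous.integrable_of_hasCompactSupport (hasCompactSupport_dirDerivs hgc L)
  have h := linProd_mul_integral_expI hg [l] (fun L _ => hint L) (-η)
  have hE : ∀ {G : Euc n → ℂ}, Integrable G → Integrable fun y => G y * expI (-η) y := fun hG =>
    hG.mul_bdd (c := 1) (Continuous.expI continuous_const continuous_id).aestronglyMeasurable
      (Filter.Eventually.of_forall fun y => (norm_expI _ _).le)
  have e1 : ∫ y, shiftOps basisVec 1 [l] g y * expI (-η) y =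
      fourier g η - fourier (dirDeriv basisVec l g) η := by
    have hint0 : Integrable g := hint []
    have hint1 : Integrable (dirDeriv basisVec l g) := hint [l]
    rw [fourier_eq_integral_expI, fourier_eq_integral_expI, ← integral_sub (hE hint0) (hE hint1)]
    refine integral_congr_ae (Filter.Eventually.of_forall fun y => ?_)
    simp only [shiftOps]
    push_cast
    ring
  rw [e1, ← fourier_eq_integral_expI] at h
  simp only [linProd, List.map_cons, List.map_nil, List.prod_cons, List.prod_nil, mul_one, linFactor] at h
  simp only [mulη]
  have h2 : ((1 * ((-η : Euc n) l - (0 : Euc n) l) : ℝ) : ℂ) = -(η l : ℂ) := by simp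
  rw [h2] at h
  linear_combination h

/-- The operator `1 - Δ`. -/
noncomputable def oneSubLaplacian (g : Euc n → ℂ) (y : Euc n) : ℂ :=
  g y + ∑ l, (-1) * dirDerivs basisVec [l, l] g y

lemma dirDerivs_sum {ι W α : Type*} [NormedAddCommGroup W] [NormedSpace ℝ W] {v : ι → W}
    (S : Finset α) {f : α → W → ℂ} (hf : ∀ a, ContDiff ℝ ∞ (f a)) (L : List ι) :
    dirDerivs v L (fun p => ∑ a ∈ S, f a p) = fun p => ∑ a ∈ S, dirDerivs v L (f a) p := by
  classical
  induction S using Finset.induction_on with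
  | empty =>
    simp only [Finset.sum_empty]
    have := dirDerivs_const_mul (v := v) (f := fun _ : W => (0 : ℂ)) contDiff_const 0 L
    simpa using this
  | insert a S ha ih =>
    simp only [Finset.sum_insert ha]
    rw [dirDerivs_add (hf a) (ContDiff.sum fun b _ => hf b), ih]

lemma contDiff_oneSubLaplacian (hg : ContDiff ℝ ∞ g) : ContDiff ℝ ∞ (oneSubLaplacian g) :=
  hg.add (ContDiff.sum fun l _ => contDiff_const.mul (contDiff_dirDerivs [l, l] hg))

lemma hasCompactSupport_oneSubLaplacian (hgc : HasCompactSupport g) :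
    HasCompactSupport (oneSubLaplacian g) := by
  refine HasCompactSupport.intro hgc fun y hy => ?_
  rw [oneSubLaplacian, image_eq_zero_of_notMem_tsupport hy, zero_add]
  refine Finset.sum_eq_zero fun l _ => ?_
  rw [image_eq_zero_of_notMem_tsupport fun h => hy (tsupport_dirDerivs_subset _ h), mul_zero]

lemma dirDerivs_oneSubLaplacian (hg : ContDiff ℝ ∞ g) (L : List (Fin n)) (y : Euc n) :
    dirDerivs basisVec L (oneSubLaplacian g) y =
      dirDerivs basisVec L g y + ∑ l, (-1) * dirDerivs basisVec (l :: l :: L) g y := by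
  have h1 : ∀ l : Fin n, ContDiff ℝ ∞ fun y => (-1 : ℂ) * dirDerivs basisVec [l, l] g y := fun l =>
    contDiff_const.mul (contDiff_dirDerivs [l, l] hg)
  change dirDerivs basisVec L (fun y => g y + ∑ l, (-1) * dirDerivs basisVec [l, l] g y) y = _
  have h2 : ContDiff ℝ ∞ fun y => ∑ l, (-1 : ℂ) * dirDerivs basisVec [l, l] g y :=
    ContDiff.sum (s := Finset.univ) fun l _ => h1 l
  rw [dirDerivs_add hg h2, dirDerivs_sum Finset.univ h1]
  refine congrArg (dirDerivs basisVec L g y + ·) (Finset.sum_congr rfl fun l _ => ?_)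
  rw [dirDerivs_const_mul (contDiff_dirDerivs [l, l] hg), ← dirDerivs_append]
  rfl

lemma fourier_oneSubLaplacian (hg : ContDiff ℝ ∞ g) (hgc : HasCompactSupport g) (η : Euc n) :
    fourier (oneSubLaplacian g) η = ((1 + ‖η‖ ^ 2 : ℝ) : ℂ) * fourier g η := by
  have hint : ∀ L : List (Fin n), Integrable (dirDerivs basisVec L g) := fun L =>
    (contDiff_dirDerivs L hg).continuous.integrable_of_hasCompactSupport (hasCompactSupport_dirDerivs hgc L)
  have hE : ∀ {G : Euc n → ℂ}, Integrable G → Integrable fun y => G y * expI (-η) y := fun hG =>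
    hG.mul_bdd (c := 1) (Continuous.expI continuous_const continuous_id).aestronglyMeasurable
      (Filter.Eventually.of_forall fun y => (norm_expI _ _).le)
  have h2 : ∀ l : Fin n, fourier (dirDerivs basisVec [l, l] g) η = -((η l ^ 2 : ℝ) : ℂ) * fourier g η := by
    intro l
    rw [show dirDerivs basisVec [l, l] g = dirDeriv basisVec l (dirDeriv basisVec l g) from rfl,
      fourier_dirDeriv (contDiff_dirDeriv hg l) (hasCompactSupport_dirDerivs hgc [l]) l,
      mulη, fourier_dirDeriv hg hgc, mulη]
    push_cast
    linear_combination ((η l : ℂ) ^ 2 * fourier g η) * Complex.I_sq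
  have e1 : fourier (oneSubLaplacian g) η =
      fourier g η + ∑ l, (-1) * fourier (dirDerivs basisVec [l, l] g) η := by
    simp only [fourier_eq_integral_expI, ← integral_const_mul]
    have hint0 : Integrable g := hint []
    have hint2 : ∀ l ∈ Finset.univ, Integrable fun y =>
        -1 * (dirDerivs basisVec [l, l] g y * expI (-η) y) := fun l _ => (hE (hint [l, l])).const_mul _
    rw [← integral_finsetSum Finset.univ hint2,
      ← integral_add (hE hint0) (integrable_finsetSum Finset.univ hint2)]
    refine integral_congr_ae (Filter.Eventually.of_forall fun y => ?_)
    simp only [oneSubLaplacian, add_mul, Finset.sum_mul, mul_assoc]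
  rw [e1, EuclideanSpace.real_norm_sq_eq]
  simp only [h2]
  push_cast
  rw [add_mul, one_mul, Finset.sum_mul]
  congr 1
  exact Finset.sum_congr rfl fun l _ => by ring

/-- Each factor 1 - Δ is a sum of 1 + n terms and uses two derivatives, whence (1 + n)^r and the
order N + 2r. -/
lemma iterate_oneSubLaplacian (hg : ContDiff ℝ ∞ g) (hgc : HasCompactSupport g) (r : ℕ) :
    ContDiff ℝ ∞ (oneSubLaplacian^[r] g) ∧ HasCompactSupport (oneSubLaplacian^[r] g) ∧
    (∀ η, fourier (oneSubLaplacian^[r] g) η = ((1 + ‖η‖ ^ 2 : ℝ) : ℂ) ^ r * fourier g η) ∧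
    ∀ (N : ℕ) (B : ℝ≥0∞), (∀ L : List (Fin n), L.length ≤ N + 2 * r → ∀ y, ‖dirDerivs basisVec L g y‖ₑ ≤ B) →
      ∀ L : List (Fin n), L.length ≤ N → ∀ y,
        ‖dirDerivs basisVec L (oneSubLaplacian^[r] g) y‖ₑ ≤ (1 + n) ^ r * B := by
  induction r with
  | zero => exact ⟨hg, hgc, fun η => by simp, fun N B h L hL y => by simpa using h L hL y⟩
  | succ r ih =>
    obtain ⟨h1, h2, h3, h4⟩ := ih
    rw [Function.iterate_succ_apply']
    refine ⟨contDiff_oneSubLaplacian h1, hasCompactSupport_oneSubLaplacian h2, fun η => ?_,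
      fun N B h L hL y => ?_⟩
    · rw [fourier_oneSubLaplacian h1 h2, h3, pow_succ]; ring
    · have h5 := h4 (N + 2) B (fun L hL => h L (by omega))
      rw [dirDerivs_oneSubLaplacian h1]
      have h6 : ‖∑ l, (-1) * dirDerivs basisVec (l :: l :: L) (oneSubLaplacian^[r] g) y‖ₑ ≤
          ∑ _l : Fin n, (1 + n) ^ r * B :=
        (enorm_sum_le _ _).trans (Finset.sum_le_sum fun l _ => by
          rw [enorm_mul]
          simpa using h5 (l :: l :: L) (by simpa using hL) y)
      refine (enorm_add_le _ _).trans ((add_le_add (h5 L (by omega) y) h6).trans_eq ?_)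
      · rw [Finset.sum_const, Finset.card_univ, Fintype.card_fin, nsmul_eq_mul, pow_succ]
        ring

/-- For continuous u the set where the essential supremum is exceeded is open and null, hence empty.
-/
lemma enorm_le_eLpNorm_top {u : Euc n → ℂ} (hu : Continuous u) (y : Euc n) :
    ‖u y‖ₑ ≤ eLpNorm u ⊤ volume := by
  rw [eLpNorm_exponent_top]
  have h := enorm_ae_le_eLpNormEssSup u (volume : Measure (Euc n))
  by_contra! hlt
  have hopen : IsOpen {z | eLpNormEssSup u (volume : Measure (Euc n)) < ‖u z‖ₑ} :=
    isOpen_lt continuous_const hu.enorm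
  have h0 : (volume : Measure (Euc n)) {z | eLpNormEssSup u (volume : Measure (Euc n)) < ‖u z‖ₑ} = 0 := by
    rw [ae_iff] at h
    simpa using h
  have := (hopen.measure_eq_zero_iff volume).1 h0
  have hy : y ∈ {z | eLpNormEssSup u (volume : Measure (Euc n)) < ‖u z‖ₑ} := hlt
  rw [this] at hy
  exact hy

lemma enorm_dirDerivs_le_supNorm (hg : ContDiff ℝ ∞ g) {s : ℕ} {L : List (Fin n)} (hL : L.length ≤ s)
    (y : Euc n) : ‖dirDerivs basisVec L g y‖ₑ ≤ supNorm s g := by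
  have e : dirDerivs basisVec L g = multiDeriv (fun i => L.count i) g := by
    rw [multiDeriv_eq_dirDerivs, dirDerivs_perm (perm_multiList L) hg]
  have hs : ∑ i, L.count i ≤ s := by
    rw [← length_multiList, ← (perm_multiList L).length_eq]; exact hL
  refine (enorm_le_eLpNorm_top (contDiff_dirDerivs L hg).continuous y).trans ?_
  rw [e]
  exact le_iSup₂_of_le (f := fun (γ : Fin n → ℕ) (_ : ∑ i, γ i ≤ s) =>
    eLpNorm (multiDeriv γ g) ⊤ volume) (fun i => L.count i) hs le_rfl

lemma supNorm_ne_top (hg : ContDiff ℝ ∞ g) (hgc : HasCompactSupport g) (s : ℕ) : supNorm s g ≠ ⊤ := by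
  have hb : ∀ L : List (Fin n), ∃ C : ℝ, ∀ y, ‖dirDerivs basisVec L g y‖ ≤ C := fun L =>
    (hasCompactSupport_dirDerivs hgc L).exists_bound_of_continuous (contDiff_dirDerivs L hg).continuous
  choose C hC using hb
  obtain ⟨M, hM⟩ := ((List.finite_length_le (Fin n) s).image C).bddAbove
  refine ne_top_of_le_ne_top (ENNReal.ofReal_ne_top (r := M)) (iSup₂_le fun γ hγ => ?_)
  rw [multiDeriv_eq_dirDerivs]
  refine eLpNormEssSup_le_of_ae_bound (C := M) (Filter.Eventually.of_forall fun y => ?_)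
  refine (hC _ y).trans (hM ⟨_, ?_, rfl⟩)
  change (multiList γ).length ≤ s
  rw [length_multiList]; exact hγ

/-- The weight `(1 + |η|²)^{-r}`. -/
noncomputable def invWeight (r : ℕ) (η : Euc n) : ℝ := (1 + ‖η‖ ^ 2) ^ (-(r : ℝ))

lemma freqWeight_invWeight {δ : ℝ} {r : ℕ} (hr : n = 0 ∨ n < 2 * r) :
    FreqWeight (n := n) δ (invWeight r) := by
  have hc : Continuous (invWeight (n := n) r) :=
    (continuous_const.add (continuous_norm.pow 2)).rpow_const fun η => Or.inl (by positivity : (0 : ℝ) < 1 + ‖η‖ ^ 2).ne'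
  refine ⟨fun η => Real.rpow_pos_of_pos (by positivity) _, hc, ?_,
    sym_japη.rpow (linearScale_nonneg δ) japη_pos contDiff_japη _⟩
  rcases hr with rfl | hr
  · exact hc.integrable_of_hasCompactSupport (HasCompactSupport.of_compactSpace _)
  · have := integrable_rpow_neg_one_add_norm_sq (E := Euc n) (μ := volume) (r := 2 * r)
      (by rw [finrank_euclideanSpace_fin]; exact_mod_cast hr)
    refine this.congr (Filter.Eventually.of_forall fun η => ?_)
    simp only [invWeight]
    congr 1; ring

/-- The bounded functions behind ĝ and iη_l ĝ are (1 - Δ)^r g and ∂_l (1 - Δ)^r g; the derivative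
∂_l, required by almost orthogonality, is the extra 1 in 2r + 1. -/
lemma weightedTransform_fourier (hg : ContDiff ℝ ∞ g) (hgc : HasCompactSupport g) {r s : ℕ}
    (hs : 2 * r + 1 ≤ s) : WeightedTransform (invWeight r) ((1 + n) ^ r * supNorm s g) (fourier g) ∧
    ∀ l, WeightedTransform (invWeight r) ((1 + n) ^ r * supNorm s g) (mulη l (fourier g)) := by
  obtain ⟨h1, h2, h3, h4⟩ := iterate_oneSubLaplacian hg hgc r
  have h5 := h4 1 (supNorm s g) fun L hL => enorm_dirDerivs_le_supNorm hg (hL.trans (by omega))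
  have h6 : ∀ η : Euc n, ((invWeight r η : ℝ) : ℂ) * ((1 + ‖η‖ ^ 2 : ℝ) : ℂ) ^ r = 1 := by
    intro η
    have ht : (0 : ℝ) < 1 + ‖η‖ ^ 2 := by positivity
    rw [← Complex.ofReal_pow, ← Complex.ofReal_mul, invWeight, Real.rpow_neg ht.le, Real.rpow_natCast,
      inv_mul_cancel₀ (pow_pos ht r).ne', Complex.ofReal_one]
  refine ⟨⟨_, h1.continuous, h1.continuous.integrable_of_hasCompactSupport h2,
    fun y => h5 [] (by simp) y, funext fun η => ?_⟩, fun l => ⟨_, (contDiff_dirDeriv h1 l).continuous,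
    (contDiff_dirDeriv h1 l).continuous.integrable_of_hasCompactSupport
      (hasCompactSupport_dirDerivs h2 [l]), fun y => h5 [l] (by simp) y, funext fun η => ?_⟩⟩
  · rw [h3, ← mul_assoc, h6, one_mul]
  · rw [fourier_dirDeriv h1 h2, mulη, mulη, h3]
    linear_combination (-(Complex.I * ((η l : ℝ) : ℂ) * fourier g η)) * h6 η

end TestFunctions

end BilinearPDO

namespace BilinearPDO

/-! ### Splitting the symbol according to the dominant frequency -/

section Splitting

variable {n : ℕ} {δ m : ℝ} {σ : Phase n → ℂ}

/-- The exchange of the two frequencies. -/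
noncomputable def swapFreq : Phase n →L[ℝ] Phase n :=
  (ContinuousLinearMap.fst ℝ (Euc n) (Euc n × Euc n)).prod
    (((ContinuousLinearMap.snd ℝ (Euc n) (Euc n)).comp
      (ContinuousLinearMap.snd ℝ (Euc n) (Euc n × Euc n))).prod
      ((ContinuousLinearMap.fst ℝ (Euc n) (Euc n)).comp
        (ContinuousLinearMap.snd ℝ (Euc n) (Euc n × Euc n))))

lemma swapFreq_apply (p : Phase n) : swapFreq p = (p.1, p.2.2, p.2.1) := rfl

lemma jap_swapFreq (p : Phase n) : jap (swapFreq p) = jap p := add_comm _ _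

lemma sym_swapFreq (h : Sym axis (bilinearScale δ) (fun (_ : Unit) (p : Phase n) => jap p ^ (m / 2))
    (fun _ => σ)) :
    Sym axis (bilinearScale δ) (fun (_ : Unit) (p : Phase n) => jap p ^ (m / 2))
      (fun _ p => σ (swapFreq p)) := by
  intro N
  obtain ⟨hσ, C, hC, h⟩ := h N
  refine ⟨fun _ => (hσ ()).comp swapFreq.contDiff, C, hC, symBound_of_dirDerivs fun L hL _ p => ?_⟩
  have e := dirDerivs_slice (swapFreq (n := n)) 0 (v := axis) (v' := axis)
    (Sum.map id Sum.swap : Idx n → Idx n) (fun i => by rcases i with i | i | i <;> rfl) (hσ ()) L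
  simp only [zero_add] at e
  rw [e]
  have h1 := h.dirDerivs (L.map (Sum.map id Sum.swap)) (by simpa using hL) () (swapFreq p)
  rw [jap_swapFreq, List.map_map] at h1
  have h2 : ((fun i => bilinearScale δ i (swapFreq p)) ∘ (Sum.map id Sum.swap : Idx n → Idx n)) =
      fun i => bilinearScale δ i p := by
    funext i
    rcases i with i | i | i <;> simp [bilinearScale, jap_swapFreq]
  rwa [h2] at h1

/-- The part of the binomial expansion of `1 = (⟨ξ⟩² / (⟨ξ⟩² + ⟨η⟩²) + ⟨η⟩² / (⟨ξ⟩² + ⟨η⟩²))^(2p+1)`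
in which the frequency `ξ` has the larger exponent. -/
noncomputable def firstPart (p : ℕ) (z : Phase n) : ℝ :=
  ∑ b ∈ Finset.range (p + 1), japξ z ^ (((2 * p + 1 - b : ℕ) : ℕ) : ℝ) * japη z ^ (b : ℝ) *
    jap z ^ (-((2 * p + 1 : ℕ) : ℝ)) * ((2 * p + 1).choose b : ℝ)

/-- The exponent 2p + 1 is odd, so the binomial sum has no middle term and b ↦ 2p + 1 - b exchanges
its two halves. -/
lemma firstPart_add_firstPart_swapFreq (p : ℕ) (z : Phase n) :
    firstPart p z + firstPart p (swapFreq z) = 1 := by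
  have hR := jap_pos z
  have h1 : ∑ b ∈ Finset.range (2 * p + 1 + 1), japη z ^ b * japξ z ^ (2 * p + 1 - b) *
      ((2 * p + 1).choose b : ℝ) = jap z ^ (2 * p + 1) := by
    rw [← add_pow, jap, add_comm]
  rw [show 2 * p + 1 + 1 = (p + 1) + (p + 1) by ring, Finset.sum_range_add,
    ← Finset.sum_range_reflect (fun x => japη z ^ (p + 1 + x) * _ * _)] at h1
  have h2 : firstPart p z = (∑ b ∈ Finset.range (p + 1), japη z ^ b * japξ z ^ (2 * p + 1 - b) *
      ((2 * p + 1).choose b : ℝ)) * (jap z ^ (2 * p + 1))⁻¹ := by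
    rw [firstPart, Finset.sum_mul]
    refine Finset.sum_congr rfl fun b _ => ?_
    rw [Real.rpow_neg hR.le]
    simp only [Real.rpow_natCast]
    ring
  have h3 : firstPart p (swapFreq z) = (∑ b ∈ Finset.range (p + 1),
      japη z ^ (p + 1 + (p + 1 - 1 - b)) * japξ z ^ (2 * p + 1 - (p + 1 + (p + 1 - 1 - b))) *
      ((2 * p + 1).choose (p + 1 + (p + 1 - 1 - b)) : ℝ)) * (jap z ^ (2 * p + 1))⁻¹ := by
    rw [firstPart, Finset.sum_mul]
    refine Finset.sum_congr rfl fun b hb => ?_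
    rw [Finset.mem_range] at hb
    rw [jap_swapFreq, Real.rpow_neg hR.le]
    simp only [Real.rpow_natCast]
    rw [show japξ (swapFreq z) = japη z from rfl, show japη (swapFreq z) = japξ z from rfl,
      show p + 1 + (p + 1 - 1 - b) = 2 * p + 1 - b by omega,
      Nat.choose_symm (show b ≤ 2 * p + 1 by omega), show 2 * p + 1 - (2 * p + 1 - b) = b by omega]
    ring
  rw [h2, h3, ← add_mul, h1, mul_inv_cancel₀ (pow_pos hR _).ne']

/-- With q = m/2 + δX/2 ≤ p, every term contains `japξ` to a power at least p + 1 > q. The power q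
is kept, the remaining powers of `japξ` and `japη` are bounded by powers of `jap`, and these cancel
exactly against `jap`^(-(2p+1)), the weight of σ and the loss of X derivatives in x. -/
lemma firstDominant_mul_firstPart (hδ : 0 ≤ δ) (hδ1 : δ ≤ 1)
    (h : Sym axis (bilinearScale δ) (fun (_ : Unit) (p : Phase n) => jap p ^ (m / 2)) (fun _ => σ))
    {X p : ℕ} (hp : m / 2 + δ / 2 * X ≤ p) :
    FirstDominant δ X m fun z => σ z * ((firstPart p z : ℝ) : ℂ) := by
  have hw : ∀ (_ : Unit) (p : Phase n), 0 ≤ jap p ^ (m / 2) := fun _ z =>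
    (Real.rpow_pos_of_pos (jap_pos z) _).le
  have h0 := h.mono (bilinearScale_nonneg δ) (bilinearScale_le_linearScale hδ) hw
    ⟨1, zero_le_one, fun _ p => (one_mul _).ge⟩
  have hterm : ∀ b ∈ Finset.range (p + 1), FirstDominant δ X m fun z =>
      σ z * ((japξ z ^ (((2 * p + 1 - b : ℕ) : ℕ) : ℝ) * japη z ^ (b : ℝ) *
        jap z ^ (-((2 * p + 1 : ℕ) : ℝ)) * ((2 * p + 1).choose b : ℝ) : ℝ) : ℂ) := by
    intro b hb
    rw [Finset.mem_range] at hb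
    have s1 := (sym_japξ (n := n) hδ1).rpow (linearScale_nonneg δ) japξ_pos contDiff_japξ
      ((2 * p + 1 - b : ℕ) : ℝ)
    have s2 := (sym_japη (n := n) (δ := δ)).rpow (linearScale_nonneg δ) japη_pos contDiff_japη (b : ℝ)
    have s3 := (sym_jap (n := n) hδ1).rpow (linearScale_nonneg δ) jap_pos contDiff_jap
      (-((2 * p + 1 : ℕ) : ℝ))
    have hF : FirstDominant δ X m fun z => σ z * (((japξ z ^ ((2 * p + 1 - b : ℕ) : ℝ) : ℝ) : ℂ) *
        ((japη z ^ (b : ℝ) : ℝ) : ℂ) * ((jap z ^ (-((2 * p + 1 : ℕ) : ℝ)) : ℝ) : ℂ)) := by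
      refine ⟨_, fun z => ?_, h0.mul ((s1.mul s2).mul s3), 1, zero_le_one, fun z => ?_⟩
      · have h1 := japξ_pos z; have h2 := japη_pos z; have h3 := jap_pos z
        positivity
      · have h1 := japξ_pos z; have h2 := japη_pos z; have h3 := jap_pos z
        set q := m / 2 + δ / 2 * X with hq
        have hcast : ((2 * p + 1 - b : ℕ) : ℝ) = 2 * p + 1 - b := by
          rw [Nat.cast_sub (by omega)]; push_cast; ring
        have hb' : (b : ℝ) ≤ p := by exact_mod_cast (by omega : b ≤ p)
        have e1 : japξ z ^ ((2 * p + 1 - b : ℕ) : ℝ) = japξ z ^ q * japξ z ^ (2 * p + 1 - b - q : ℝ) := by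
          rw [← Real.rpow_add h1, hcast]; congr 1; ring
        have e2 : japξ z ^ (2 * p + 1 - b - q : ℝ) ≤ jap z ^ (2 * p + 1 - b - q : ℝ) :=
          Real.rpow_le_rpow h1.le (japξ_le_jap z) (by linarith)
        have e3 : japη z ^ (b : ℝ) ≤ jap z ^ (b : ℝ) :=
          Real.rpow_le_rpow h2.le (japη_le_jap z) (Nat.cast_nonneg b)
        have e4 : jap z ^ (m / 2) * jap z ^ (-((2 * p + 1 : ℕ) : ℝ)) * jap z ^ (δ / 2 * X) *
            (jap z ^ (2 * p + 1 - b - q : ℝ) * jap z ^ (b : ℝ)) = 1 := by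
          simp only [← Real.rpow_add h3]
          refine (congrArg (jap z ^ ·) ?_).trans (Real.rpow_zero (jap z))
          rw [hq]; push_cast; ring
        rw [one_mul, e1]
        calc jap z ^ (m / 2) * (japξ z ^ q * japξ z ^ (2 * p + 1 - b - q : ℝ) * japη z ^ (b : ℝ) *
              jap z ^ (-((2 * p + 1 : ℕ) : ℝ))) * jap z ^ (δ / 2 * X)
            = japξ z ^ q * (jap z ^ (m / 2) * jap z ^ (-((2 * p + 1 : ℕ) : ℝ)) * jap z ^ (δ / 2 * X) *
              (japξ z ^ (2 * p + 1 - b - q : ℝ) * japη z ^ (b : ℝ))) := by ring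
          _ ≤ japξ z ^ q * (jap z ^ (m / 2) * jap z ^ (-((2 * p + 1 : ℕ) : ℝ)) * jap z ^ (δ / 2 * X) *
              (jap z ^ (2 * p + 1 - b - q : ℝ) * jap z ^ (b : ℝ))) := by gcongr
          _ = japξ z ^ q := by rw [e4, mul_one]
    convert hF.const_mul ((2 * p + 1).choose b : ℂ) using 2 with z
    push_cast
    ring
  have key : ∀ S : Finset ℕ, S ⊆ Finset.range (p + 1) → FirstDominant δ X m fun z => ∑ b ∈ S,
      σ z * ((japξ z ^ (((2 * p + 1 - b : ℕ) : ℕ) : ℝ) * japη z ^ (b : ℝ) *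
        jap z ^ (-((2 * p + 1 : ℕ) : ℝ)) * ((2 * p + 1).choose b : ℝ) : ℝ) : ℂ) := by
    classical
    intro S
    induction S using Finset.induction_on with
    | empty =>
      intro _
      simpa using (hterm 0 (by simp)).const_mul 0
    | insert b S hb ih =>
      intro hS
      simp only [Finset.sum_insert hb]
      exact (hterm b (hS (Finset.mem_insert_self _ _))).add
        (ih fun c hc => hS (Finset.mem_insert_of_mem hc))
  convert key _ subset_rfl using 2 with z
  rw [firstPart, Complex.ofReal_sum, Finset.mul_sum]

/-- A bilinear symbol is a sum of two symbols, in each of which one of the frequencies dominates. -/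
lemma exists_firstDominant_add (hδ : 0 ≤ δ) (hδ1 : δ ≤ 1)
    (h : Sym axis (bilinearScale δ) (fun (_ : Unit) (p : Phase n) => jap p ^ (m / 2)) (fun _ => σ))
    (X : ℕ) : ∃ τ₁ τ₂, FirstDominant δ X m τ₁ ∧ FirstDominant δ X m τ₂ ∧
      ∀ z, σ z = τ₁ z + τ₂ (swapFreq z) := by
  obtain ⟨p, hp⟩ := exists_nat_ge (m / 2 + δ / 2 * X)
  refine ⟨_, _, firstDominant_mul_firstPart hδ hδ1 h hp,
    firstDominant_mul_firstPart hδ hδ1 (sym_swapFreq h) hp, fun z => ?_⟩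
  have h1 : ((firstPart p z : ℝ) : ℂ) + ((firstPart p (swapFreq z) : ℝ) : ℂ) = 1 := by
    exact_mod_cast firstPart_add_firstPart_swapFreq p z
  have h2 : swapFreq (swapFreq z) = z := rfl
  rw [h2, ← mul_add, h1, mul_one]

end Splitting

/-! ### Conclusion -/

section Main

open SchwartzMap
open scoped SchwartzMap

variable {n : ℕ} {δ m : ℝ} {X : ℕ}

lemma bilinearOp_eq_bilin_add (hδ : 0 ≤ δ) {σ : Euc n → Euc n → Euc n → ℂ} {τ₁ τ₂ : Phase n → ℂ}
    (h₁ : FirstDominant δ X m τ₁) (h₂ : FirstDominant δ X m τ₂)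
    (hσ : ∀ z, uncurry3 σ z = τ₁ z + τ₂ (swapFreq z)) {f g : Euc n → ℂ} {F H : 𝓢(Euc n, ℂ)}
    (hF : ∀ ξ, F ξ = fourier f ξ) (hH : ∀ ξ, H ξ = fourier g ξ) :
    bilinearOp σ f g = fun x => bilin τ₁ F H x + bilin τ₂ H F x := by
  funext x
  have i1 : Integrable (bilinKernel τ₁ F H x) :=
    h₁.integrable_bilinKernel hδ F H.continuous H.integrable x
  have i2 : Integrable (bilinKernel τ₂ H F x) :=
    h₂.integrable_bilinKernel hδ H F.continuous F.integrable x
  have i2' : Integrable fun q : Euc n × Euc n => bilinKernel τ₂ H F x q.swap := i2.swap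
  have e2 : ∫ q : Euc n × Euc n, bilinKernel τ₂ H F x q.swap = bilin τ₂ H F x :=
    integral_prod_swap (μ := (volume : Measure (Euc n))) (ν := (volume : Measure (Euc n)))
      (bilinKernel τ₂ H F x)
  have e1 : ∫ q : Euc n × Euc n, bilinKernel τ₁ F H x q = bilin τ₁ F H x := rfl
  rw [← e1, ← e2, ← integral_add i1 i2']
  -- The operator is defined with the ξ-integral inside, hence the symmetric form of Fubini's
  -- theorem.
  refine Eq.trans ?_ (integral_prod_symm _ (i1.add i2')).symm
  simp only [bilinearOp]
  congr 1
  funext η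
  congr 1
  funext ξ
  have := hσ (x, ξ, η)
  simp only [uncurry3, swapFreq_apply] at this
  simp only [Pi.add_apply, bilinKernel, Prod.swap, hF, hH, this, add_comm η ξ]
  ring

/-- As 1/(1-δ) ≥ 1, the hypothesis gives s ≥ n + [n/2] + 2, which for n ≥ 1 is at least 2r + 1 with
r = [n/2] + 1, and 2r > n. For n = 0 no weight is needed and r = 0. -/
lemma exists_regularity {s : ℕ} (hδ : 0 ≤ δ) (hδ1 : δ < 1)
    (hs : ((n / 2 + 1 : ℕ) : ℝ) / (1 - δ) + (n : ℝ) < (s : ℝ)) :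
    ∃ r : ℕ, (n = 0 ∨ n < 2 * r) ∧ 2 * r + 1 ≤ s := by
  have h1 : ((n / 2 + 1 : ℕ) : ℝ) ≤ ((n / 2 + 1 : ℕ) : ℝ) / (1 - δ) :=
    le_div_self (Nat.cast_nonneg _) (by linarith) (by linarith)
  have h2 : n / 2 + 1 + n < s := by
    have : (((n / 2 + 1 : ℕ) : ℝ) + (n : ℝ)) < (s : ℝ) := by linarith
    exact_mod_cast this
  rcases Nat.eq_zero_or_pos n with rfl | hn
  · exact ⟨0, Or.inl rfl, by omega⟩
  · exact ⟨n / 2 + 1, Or.inr (by omega), by omega⟩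

lemma FirstDominant.exists_sobolev_bound (hδ : 0 ≤ δ) (hδ1 : δ < 1) (hm : 0 ≤ m) {τ : Phase n → ℂ}
    (hτ : FirstDominant δ (n + 1) m τ) {s : ℕ}
    (hs : ((n / 2 + 1 : ℕ) : ℝ) / (1 - δ) + (n : ℝ) < (s : ℝ)) :
    ∃ C : ℝ≥0, ∀ (f g : Euc n → ℂ) (F H : 𝓢(Euc n, ℂ)), (∀ ξ, F ξ = fourier f ξ) →
      (∀ ξ, H ξ = fourier g ξ) → ContDiff ℝ ∞ g → HasCompactSupport g →
      MemLp (bilin τ F H) 2 volume ∧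
        eLpNorm (bilin τ F H) 2 volume ≤ C * (sobolevNorm m f * supNorm s g) := by
  obtain ⟨r, hr, hrs⟩ := exists_regularity hδ hδ1 hs
  obtain ⟨C₁, hC₁⟩ := hτ.exists_eLpNorm_bilin_le hδ hδ1 hm (freqWeight_invWeight hr)
  obtain ⟨C₂, hC₂⟩ := exists_eLpNorm_le_sobolevNorm n m
  refine ⟨C₁ * (1 + n) ^ r * C₂, fun f g F H hF hH hg hgc => ?_⟩
  obtain ⟨h1, h2⟩ := weightedTransform_fourier hg hgc hrs
  obtain ⟨h3, h4⟩ := hC₂ f F hF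
  have hS := supNorm_ne_top hg hgc s
  have hB : (1 + n : ℝ≥0∞) ^ r * supNorm s g ≠ ⊤ :=
    ENNReal.mul_ne_top (ENNReal.pow_ne_top (by simp)) hS
  have hle : eLpNorm (bilin τ F H) 2 volume ≤
      ((C₁ * (1 + n) ^ r * C₂ : ℝ≥0) : ℝ≥0∞) * (sobolevNorm m f * supNorm s g) := by
    have h5 := hC₁ F hB h1 h2
    rw [← funext hH] at h5
    refine (h5.trans (mul_le_mul' le_rfl h3)).trans_eq ?_
    push_cast
    ring
  exact ⟨⟨(hτ.continuous_bilin hδ F H.continuous H.integrable).aestronglyMeasurable,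
    hle.trans_lt (ENNReal.mul_lt_top ENNReal.coe_lt_top (ENNReal.mul_lt_top h4.lt_top hS.lt_top))⟩, hle⟩

end Main

end BilinearPDO

theorem mainTheorem5 (n : ℕ) (m ρ δ : ℝ) (hm : 0 ≤ m) (hδ : 0 ≤ δ) (hδρ : δ ≤ ρ) (hρ : ρ ≤ 1)
    (hδ1 : δ < 1) (σ : BilinearPDO.Euc n → BilinearPDO.Euc n → BilinearPDO.Euc n → ℂ)
    (hσ : BilinearPDO.BS m ρ δ σ) (s : ℕ)
    (hs : ((n / 2 + 1 : ℕ) : ℝ) / (1 - δ) + (n : ℝ) < (s : ℝ)) :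
    ∃ C : ℝ≥0, ∀ f g : BilinearPDO.Euc n → ℂ,
      ContDiff ℝ ∞ f → HasCompactSupport f → ContDiff ℝ ∞ g → HasCompactSupport g →
      MemLp (BilinearPDO.bilinearOp σ f g) 2 volume ∧
      eLpNorm (BilinearPDO.bilinearOp σ f g) 2 volume ≤
        (C : ℝ≥0∞) *
          (BilinearPDO.sobolevNorm m f * BilinearPDO.supNorm s g +
            BilinearPDO.supNorm s f * BilinearPDO.sobolevNorm m g) := by
  -- Domination is needed for n derivatives in x in the estimate of a piece and for one more in the
  -- integration by parts.
  obtain ⟨τ₁, τ₂, h₁, h₂, hτ⟩ := BilinearPDO.exists_firstDominant_add hδ hδ1.le (hσ.sym hδρ) (n + 1)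
  obtain ⟨C₁, hC₁⟩ := h₁.exists_sobolev_bound hδ hδ1 hm hs
  obtain ⟨C₂, hC₂⟩ := h₂.exists_sobolev_bound hδ hδ1 hm hs
  refine ⟨C₁ + C₂, fun f g hf hfc hg hgc => ?_⟩
  obtain ⟨F, hF⟩ := BilinearPDO.exists_schwartz_eq_fourier hf hfc
  obtain ⟨H, hH⟩ := BilinearPDO.exists_schwartz_eq_fourier hg hgc
  obtain ⟨m₁, b₁⟩ := hC₁ f g F H hF hH hg hgc
  obtain ⟨m₂, b₂⟩ := hC₂ g f H F hH hF hf hfc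
  rw [BilinearPDO.bilinearOp_eq_bilin_add hδ h₁ h₂ hτ hF hH]
  refine ⟨m₁.add m₂, (eLpNorm_add_le m₁.1 m₂.1 (by norm_num)).trans ((add_le_add b₁ b₂).trans ?_)⟩
  rw [ENNReal.coe_add, add_mul, mul_comm (BilinearPDO.supNorm s f)]
  exact add_le_add (mul_le_mul' le_rfl le_self_add) (mul_le_mul' le_rfl le_add_self)
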